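/- **Theorem ("Explicit Formula").** Let $\varepsilon>0$ and let $g:(0,\infty)\to\mathbb{C}$ be a (Lebesgue measurable) function such that - $(A_\varepsilon)$: the function $u\mapsto g(u)\,(u^{-\varepsilon}+u^{1+\varepsilon})$ has bounded total variation on $(0,\infty)$; - $(B)$: $g(u+)+g(u-)=2g(u)$ for every $u>0$, where $g(u\pm)$ are the one-sided limits (they exist by $(A_\varepsilon)$). Write $\widehat g(s)=\int_0^\infty g(u)u^{s}\,\frac{du}{u}$ for the Mellin transform, $g^\tau(x)=\frac1x\,g\!\left(\frac1x\right)$ for the transpose, $L_r(s)=\pi^{-s/2}\,\Gamma(s/2)$, and $V_p(g)=\log(p)\sum_{k\ge1}g(p^k)$ for a prime $p$. Let $0<c<1+\varepsilon$. Then $\widehat g(s)$ converges absolutely for $-\varepsilon<\mathrm{Re}(s)<1+\varepsilon$, the sums $\sum_p\sum_{k\ge1}\log(p)\,g(p^k)$ and $\sum_p\sum_{k\ge1}\log(p)\,g^\tau(p^k)$ converge absolutely, and the limit $$W_r(g)=\lim_{T\to\infty}\frac1{2\pi i}\int_{c-iT}^{c+iT}-\frac{L_r'(s)}{L_r(s)}\bigl(\widehat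 g(s)+\widehat g(1-s)\bigr)\,ds$$ exists if and only if $$Z(g)=\widehat g(0)+\widehat g(1)-\lim_{T\to\infty}\sum_{|\mathrm{Im}(\rho)|<T}\widehat g(\rho)$$ exists, where $\rho$ runs over the zeros of the Riemann zeta function in the critical strip $0<\mathrm{Re}(s)<1$, counted with multiplicity. When they exist, $$Z(g)=\sum_p\bigl(V_p(g)+V_p(g^\tau)\bigr)+W_r(g),$$ where $p$ runs over the primes. -/

import Mathlib

open Filter Topology

namespace ExplicitFormula

/-- The weight `K_ε(u) = u ^ (-ε) + u ^ (1 + ε)`, for `u > 0`. -/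
noncomputable def weight (ε u : ℝ) : ℝ := u ^ (-ε) + u ^ (1 + ε)

/-- Condition `(A_ε)`: `g · K_ε` has bounded total variation on `(0, ∞)`. -/
def CondA (ε : ℝ) (g : ℝ → ℂ) : Prop :=
  BoundedVariationOn (fun u : ℝ => g u * (weight ε u : ℂ)) (Set.Ioi 0)

/-- Condition `(B)`: `g(u+) + g(u-) = 2 g(u)` for every `u > 0`. -/
def CondB (g : ℝ → ℂ) : Prop :=
  ∀ u : ℝ, 0 < u → Function.rightLim g u + Function.leftLim g u = 2 * g u

/-- The transpose `g^τ(x) = (1 / x) g(1 / x)`, for `x > 0`. -/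
noncomputable def transpose (g : ℝ → ℂ) (x : ℝ) : ℂ := (1 / x : ℝ) * g (1 / x)

/-- The local term `V_p(g) = log p · ∑_{k ≥ 1} g(p ^ k)`. -/
noncomputable def localTerm (p : ℕ) (g : ℝ → ℂ) : ℂ :=
  (Real.log p : ℂ) * ∑' k : ℕ, g ((p : ℝ) ^ (k + 1))

/-- `∑_p ∑_{k ≥ 1} log p · g(p ^ k)` converges absolutely (as a double sum). -/
def PrimePowerSumConverges (g : ℝ → ℂ) : Prop :=
  Summable fun q : Nat.Primes × ℕ => ‖(Real.log (q.1 : ℕ) : ℂ) * g (((q.1 : ℕ) : ℝ) ^ (q.2 + 1))‖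

/-- The integrand `-(L_r'/L_r)(s) (ĝ(s) + ĝ(1 - s))`, where `L_r(s) = π ^ (-s / 2) Γ(s / 2)` is
Mathlib's `Complex.Gammaℝ` and `ĝ` is the Mellin transform. -/
noncomputable def archIntegrand (g : ℝ → ℂ) (s : ℂ) : ℂ :=
  -(deriv Complex.Gammaℝ s / Complex.Gammaℝ s) * (mellin g s + mellin g (1 - s))

/-- `(1 / 2πi) ∫ F(s) ds` over the vertical segment from `c - iT` to `c + iT`, parametrised by
`s = c + it`, `ds = i dt`. -/
noncomputable def segmentIntegral (F : ℂ → ℂ) (c T : ℝ) : ℂ :=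
  1 / (2 * Real.pi * Complex.I) * ∫ t in (-T)..T, F (c + t * Complex.I) * Complex.I

/-- `w` is the value of the archimedean limit `W_r(g)` on the line `Re s = c`. -/
def IsArchLimit (g : ℝ → ℂ) (c : ℝ) (w : ℂ) : Prop :=
  Tendsto (fun T : ℝ => segmentIntegral (archIntegrand g) c T) atTop (𝓝 w)

/-- The zeros of the Riemann zeta function in the critical strip with `|Im ρ| < T`. -/
def zerosBelow (T : ℝ) : Set ℂ :=
  {ρ | riemannZeta ρ = 0 ∧ 0 < ρ.re ∧ ρ.re < 1 ∧ |ρ.im| < T}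

theorem zerosBelow_finite (T : ℝ) : (zerosBelow T).Finite := by
  have hK : IsCompact (Set.Icc (0 : ℝ) 1 ×ℂ Set.Icc (-T) T) :=
    isCompact_Icc.reProdIm isCompact_Icc
  refine hK.inter_riemannZetaZeros_finite.subset ?_
  rintro ρ ⟨h0, h1, h2, h3⟩
  have h4 := abs_lt.mp h3
  exact ⟨Complex.mem_reProdIm.mpr ⟨⟨h1.le, h2.le⟩, ⟨h4.1.le, h4.2.le⟩⟩, h0⟩

/-- `∑_{|Im ρ| < T} ĝ(ρ)`, every zero being counted with its multiplicity. -/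
noncomputable def zeroSum (g : ℝ → ℂ) (T : ℝ) : ℂ :=
  ∑ ρ ∈ (zerosBelow_finite T).toFinset, (analyticOrderNatAt riemannZeta ρ : ℂ) * mellin g ρ

/-- `z` is the value of `Z(g) = ĝ(0) + ĝ(1) - lim_{T → ∞} ∑_{|Im ρ| < T} ĝ(ρ)`. -/
def IsZeroSide (g : ℝ → ℂ) (z : ℂ) : Prop :=
  ∃ S : ℂ, Tendsto (fun T : ℝ => zeroSum g T) atTop (𝓝 S) ∧ z = mellin g 0 + mellin g 1 - S

end ExplicitFormula

/-!
The sum over the zeros, the sum over prime powers and the archimedean integral are three parts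
of one contour integral: that of the logarithmic derivative of `π ^ (-s / 2) Γ(s / 2) ζ(s)` times
the Mellin transform `ĝ(s)` around the rectangle `1 - c ≤ Re s ≤ c`, `|Im s| ≤ T`, where
`1 < c < 1 + ε`.
The residues are `ĝ(ρ)` at the zeros and `-ĝ(0)`, `-ĝ(1)` at the poles
(`CondA.rectIntegral_completedLogDeriv_mul`). The functional equation folds the left side of the
rectangle onto the right one, where the logarithmic derivative splits into the Gamma factor and the
Dirichlet series of `ζ' / ζ` (`CondA.segmentIntegral_completedLogDeriv`). What makes this a theorem
is the weak decay of `ĝ`: none of the vertical integrals need converge absolutely.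

Everything about `g` comes from bounded variation, through one inequality,
`norm_integral_mul_le_variation`, a substitute for the second mean value theorem. In logarithmic
coordinates `ĝ` on a vertical line is the Fourier transform of a function of bounded variation
(`CondA.exists_variation_logProfile_le`). Hence `ĝ(s) = O(1 / |Im s|)` uniformly in the strip
(`CondA.exists_norm_mellin_le`), and the Dirichlet–Jordan theorem
(`tendsto_integral_mul_dirichletKernel`) gives pointwise Mellin inversion, the condition on
`g(u+) + g(u-)` making the limit equal to `g(u)`. The truncated inverse Mellin integrals are
dominated by `y ^ (-σ)`, so on a line `Re s = σ > 1` the Dirichlet series can be integrated term by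
term, and the limit exists and is the sum over prime powers (`CondA.tendsto_segmentIntegral_zeta`).

With `ĝ(s) = O(1 / |Im s|)`, the horizontal sides are negligible along heights `T_N ∈ [N, N + 1]` on
which the logarithmic derivative is `o(N)`. Such heights come from the pigeonhole principle, the
`O(log N)` zeros near height `N` (Jensen) and the local formula of Landau
(`exists_norm_logDeriv_le_sum_add`), which need only a polynomial bound for `ζ`, together with the
bound `O(|t| ^ (1 / 2))` for the digamma function (`exists_norm_digamma_le`); the outcome is
`exists_xi_window_bounds`. The same bounds show that the zero sum and the archimedean integral
change by `o(1)` between `T_N` and any `T ∈ [N, N + 1]`, and that the archimedean integral may be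
moved to any line `Re s = c` with `0 < c < 1 + ε` at the cost of `o(1)`.

So the difference of the zero side and the archimedean side, both truncated at `T`, converges to the
sum over the primes whether or not the two sides converge separately
(`CondA.tendsto_zeroSide_sub_arch`). The equivalence and the formula are both read off from this.
-/

namespace ExplicitFormula

open MeasureTheory Set intervalIntegral

/-! ### Integration against functions of bounded variation -/

theorem measurable_of_boundedVariationOn {G : ℝ → ℂ} (hG : BoundedVariationOn G univ) :
    Measurable G := by
  have key : ∀ f : ℝ → ℝ, BoundedVariationOn f univ → Measurable f := by
    intro f hf
    obtain ⟨p, q, hp, hq, rfl⟩ := hf.locallyBoundedVariationOn.exists_monotoneOn_sub_monotoneOn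
    exact (monotoneOn_univ.1 hp).measurable.sub (monotoneOn_univ.1 hq).measurable
  have hre : Measurable fun x => (G x).re :=
    key _ (Complex.reCLM.lipschitz.comp_boundedVariationOn hG)
  have him : Measurable fun x => (G x).im :=
    key _ (Complex.imCLM.lipschitz.comp_boundedVariationOn hG)
  have : G = fun x => ((G x).re : ℂ) + (G x).im * Complex.I := by
    funext x; exact (Complex.re_add_im (G x)).symm
  rw [this]
  fun_prop

theorem exists_norm_le_of_boundedVariationOn {α : Type*} [LinearOrder α] {G : α → ℂ} {s : Set α}
    (hG : BoundedVariationOn G s) : ∃ C, 0 ≤ C ∧ ∀ x ∈ s, ‖G x‖ ≤ C := by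
  rcases s.eq_empty_or_nonempty with rfl | ⟨x, hx⟩
  · exact ⟨0, le_rfl, by simp⟩
  · refine ⟨‖G x‖ + (eVariationOn G s).toReal, by positivity, fun y hy => ?_⟩
    have := hG.dist_le hy hx
    rw [dist_eq_norm] at this
    linarith [norm_le_norm_add_norm_sub' (G y) (G x)]

theorem intervalIntegrable_mul_of_boundedVariationOn {G f : ℝ → ℂ} {a b : ℝ}
    (hG : BoundedVariationOn G univ) (hf : Continuous f) :
    IntervalIntegrable (fun x => G x * f x) volume a b := by
  obtain ⟨C, -, hC⟩ := exists_norm_le_of_boundedVariationOn hG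
  rw [intervalIntegrable_iff]
  exact (hf.intervalIntegrable a b).def'.bdd_mul
    (measurable_of_boundedVariationOn hG).aestronglyMeasurable
    (Eventually.of_forall fun x => hC x (mem_univ x))

/-- Summation by parts for the products `u Δ F`, in absolute value. -/
theorem norm_sum_mul_sub_le (u F : ℕ → ℂ) (M : ℝ) (hF0 : F 0 = 0) (hF : ∀ i, ‖F i‖ ≤ M) (n : ℕ) :
    ‖∑ i ∈ Finset.range n, u (i + 1) * (F (i + 1) - F i)‖ ≤
      M * (‖u n‖ + ∑ i ∈ Finset.range n, ‖u (i + 1) - u i‖) := by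
  have h : ∑ i ∈ Finset.range n, u (i + 1) * (F (i + 1) - F i) =
      u n * F n - ∑ i ∈ Finset.range n, (u (i + 1) - u i) * F i := by
    rw [eq_sub_iff_add_eq, ← Finset.sum_add_distrib]
    have := Finset.sum_range_sub (fun i => u i * F i) n
    rw [hF0, mul_zero, sub_zero] at this
    rw [← this]
    exact Finset.sum_congr rfl fun i _ => by ring
  rw [h]
  refine (norm_sub_le _ _).trans ?_
  rw [norm_mul, mul_add, Finset.mul_sum, mul_comm M]
  gcongr
  · exact hF n
  · refine (norm_sum_le _ _).trans (Finset.sum_le_sum fun i _ => ?_)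
    rw [norm_mul, mul_comm M]
    gcongr
    exact hF i

/-- The bound by variation that replaces the second mean value theorem: if the primitive of `f`
from `a` is bounded by `M` on `[a, b]`, then `∫ G f` over `[a, b]` is bounded by `M` times the
variation of `G` plus a boundary term. It is proved by replacing `G` with a step function on a
fine subdivision and summing by parts. -/
theorem norm_integral_mul_le_variation {G f : ℝ → ℂ} {a b M : ℝ} (hab : a ≤ b)
    (hG : BoundedVariationOn G univ) (hf : Continuous f)
    (hM : ∀ x ∈ Icc a b, ‖∫ t in a..x, f t‖ ≤ M) :
    ‖∫ t in a..b, G t * f t‖ ≤ M * (‖G b‖ + (eVariationOn G (Icc a b)).toReal) := by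
  set V := (eVariationOn G (Icc a b)).toReal with hV
  have hGab : BoundedVariationOn G (Icc a b) := hG.mono (subset_univ _)
  obtain ⟨B, hB⟩ := (isCompact_Icc (a := a) (b := b)).exists_bound_of_continuousOn hf.continuousOn
  have key : ∀ n : ℕ, 0 < n →
      ‖∫ t in a..b, G t * f t‖ ≤ M * (‖G b‖ + V) + V * B * ((b - a) / n) := by
    intro n hn
    have hn' : (0 : ℝ) < n := by exact_mod_cast hn
    set x : ℕ → ℝ := fun i => a + i * ((b - a) / n) with hx
    have hd : 0 ≤ (b - a) / n := div_nonneg (by linarith) hn'.le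
    have hx0 : x 0 = a := by simp [hx]
    have hxn : x n = b := by simp only [hx]; field_simp; ring
    have hmono : Monotone x := by
      intro i j hij
      have : (i : ℝ) ≤ j := by exact_mod_cast hij
      simp only [hx]; gcongr
    have hstep : ∀ i, x (i + 1) - x i = (b - a) / n := by
      intro i; simp only [hx]; push_cast; ring
    have hmem : ∀ i, i ≤ n → x i ∈ Icc a b := fun i hi =>
      ⟨hx0 ▸ hmono (Nat.zero_le i), hxn ▸ hmono hi⟩
    have hsub : ∀ i < n, Icc (x i) (x (i + 1)) ⊆ Icc a b := fun i hi =>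
      Icc_subset_Icc (hmem i hi.le).1 (hmem (i + 1) hi).2
    -- On a piece of the subdivision `G` differs from its right end value by at most its variation
    -- `v i` there, and the `v i` add up to `V`: the error of the step function is `O(1 / n)`.
    set v : ℕ → ℝ := fun i => (eVariationOn G (Icc (x i) (x (i + 1)))).toReal with hv
    have hvsum : ∑ i ∈ Finset.range n, v i = V := by
      have h := eVariationOn.sum' G hmono (n := n)
      rw [hx0, hxn] at h
      rw [hV, ← h, ENNReal.toReal_sum]
      intro i _
      exact hG.mono (subset_univ _)
    have hdist : ∀ i, ∀ t ∈ Icc (x i) (x (i + 1)), ‖G t - G (x (i + 1))‖ ≤ v i := by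
      intro i t ht
      rw [← dist_eq_norm]
      exact (hG.mono (subset_univ _)).dist_le ht (right_mem_Icc.2 (hmono (Nat.le_succ i)))
    have hint : ∀ c d : ℝ, IntervalIntegrable (fun t => G t * f t) volume c d := fun c d =>
      intervalIntegrable_mul_of_boundedVariationOn hG hf
    have hfint : ∀ c d : ℝ, IntervalIntegrable f volume c d := fun c d => hf.intervalIntegrable c d
    have hsplit : ∫ t in a..b, G t * f t =
        ∑ i ∈ Finset.range n, G (x (i + 1)) * ((∫ t in a..x (i + 1), f t) - ∫ t in a..x i, f t) +
        ∑ i ∈ Finset.range n, ∫ t in x i..x (i + 1), (G t - G (x (i + 1))) * f t := by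
      have h := sum_integral_adjacent_intervals (f := fun t => G t * f t) (μ := volume)
        (a := x) (n := n) fun k _ => hint _ _
      rw [hx0, hxn] at h
      rw [← h, ← Finset.sum_add_distrib]
      refine Finset.sum_congr rfl fun i _ => ?_
      rw [integral_interval_sub_left (hfint _ _) (hfint _ _), ← intervalIntegral.integral_const_mul,
        ← integral_add ((hfint _ _).const_mul _)]
      · exact integral_congr fun t _ => by ring
      · simp only [sub_mul]
        exact (hint _ _).sub ((hfint _ _).const_mul _)
    rw [hsplit]
    refine (norm_add_le _ _).trans (add_le_add ?_ ?_)
    · set F : ℕ → ℂ := fun i => ∫ t in a..x (min i n), f t with hF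
      have h := norm_sum_mul_sub_le (fun i => G (x i)) F M (by simp [hF, hx0])
        (fun i => hM _ (hmem _ (min_le_right _ _))) n
      have hM0 : 0 ≤ M := (norm_nonneg _).trans (hM a (left_mem_Icc.2 hab))
      have e : ∑ i ∈ Finset.range n, G (x (i + 1)) *
          ((∫ t in a..x (i + 1), f t) - ∫ t in a..x i, f t) =
          ∑ i ∈ Finset.range n, G (x (i + 1)) * (F (i + 1) - F i) := by
        refine Finset.sum_congr rfl fun i hi => ?_
        have hi' := Finset.mem_range.1 hi
        simp only [hF, min_eq_left (Nat.succ_le_of_lt hi'), min_eq_left hi'.le]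
      rw [e]
      refine h.trans ?_
      rw [hxn]
      gcongr
      rw [← hvsum]
      refine Finset.sum_le_sum fun i _ => ?_
      rw [norm_sub_rev]
      exact hdist i _ (left_mem_Icc.2 (hmono (Nat.le_succ i)))
    · refine (norm_sum_le _ _).trans ?_
      have hterm : ∀ i ∈ Finset.range n,
          ‖∫ t in x i..x (i + 1), (G t - G (x (i + 1))) * f t‖ ≤ v i * B * ((b - a) / n) := by
        intro i hi
        have hle := hmono (Nat.le_succ i)
        have := norm_integral_le_of_norm_le_const (a := x i) (b := x (i + 1)) (C := v i * B)
          (f := fun t => (G t - G (x (i + 1))) * f t) (fun t ht => by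
            rw [uIoc_of_le hle] at ht
            have ht' := Ioc_subset_Icc_self ht
            rw [norm_mul]
            exact mul_le_mul (hdist i t ht') (hB t (hsub i (Finset.mem_range.1 hi) ht'))
              (norm_nonneg _) ENNReal.toReal_nonneg)
        rwa [hstep, abs_of_nonneg hd] at this
      refine (Finset.sum_le_sum hterm).trans ?_
      rw [← Finset.sum_mul, ← Finset.sum_mul, hvsum]
  have hlim : Tendsto (fun n : ℕ => M * (‖G b‖ + V) + V * B * ((b - a) / n)) atTop
      (𝓝 (M * (‖G b‖ + V) + V * B * 0)) :=
    (((tendsto_const_div_atTop_nhds_zero_nat (b - a)).const_mul _).const_add _)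
  have := ge_of_tendsto hlim (by
    filter_upwards [eventually_gt_atTop 0] with n hn using key n hn)
  simpa using this

theorem norm_setIntegral_Ioi_mul_le_variation {G f : ℝ → ℂ} {a M : ℝ}
    (hG : BoundedVariationOn G univ) (hf : Continuous f) (h0 : Tendsto G atTop (𝓝 0))
    (hint : IntegrableOn (fun t => G t * f t) (Ioi a))
    (hM : ∀ x, a ≤ x → ‖∫ t in a..x, f t‖ ≤ M) :
    ‖∫ t in Ioi a, G t * f t‖ ≤ M * (eVariationOn G univ).toReal := by
  have h1 := (intervalIntegral_tendsto_integral_Ioi a hint tendsto_id).norm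
  have hM0 : 0 ≤ M := (norm_nonneg _).trans (hM a le_rfl)
  have h2 : Tendsto (fun b => M * (‖G b‖ + (eVariationOn G univ).toReal)) atTop
      (𝓝 (M * (‖(0 : ℂ)‖ + (eVariationOn G univ).toReal))) :=
    (h0.norm.add_const _).const_mul _
  rw [norm_zero, zero_add] at h2
  refine le_of_tendsto_of_tendsto h1 h2 ?_
  filter_upwards [eventually_ge_atTop a] with b hb
  refine (norm_integral_mul_le_variation hb hG hf fun x hx => hM x hx.1).trans ?_
  gcongr
  exact eVariationOn.mono G (subset_univ _)

theorem norm_integral_univ_mul_le_variation {G f : ℝ → ℂ} {M : ℝ}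
    (hG : BoundedVariationOn G univ) (hf : Continuous f) (h0 : Tendsto G atTop (𝓝 0))
    (hint : Integrable (fun t => G t * f t))
    (hM : ∀ a x, a ≤ x → ‖∫ t in a..x, f t‖ ≤ M) :
    ‖∫ t, G t * f t‖ ≤ M * (eVariationOn G univ).toReal := by
  have h1 := (intervalIntegral_tendsto_integral hint tendsto_neg_atTop_atBot tendsto_id).norm
  have hM0 : 0 ≤ M := (norm_nonneg _).trans (hM 0 0 le_rfl)
  have h2 : Tendsto (fun b => M * (‖G b‖ + (eVariationOn G univ).toReal)) atTop
      (𝓝 (M * (‖(0 : ℂ)‖ + (eVariationOn G univ).toReal))) :=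
    (h0.norm.add_const _).const_mul _
  rw [norm_zero, zero_add] at h2
  refine le_of_tendsto_of_tendsto h1 h2 ?_
  filter_upwards [eventually_ge_atTop 0] with b hb
  refine (norm_integral_mul_le_variation (by simp only [id]; linarith) hG hf
    fun x hx => hM _ x hx.1).trans ?_
  simp only [id]
  gcongr
  exact eVariationOn.mono G (subset_univ _)

/-! ### The Dirichlet kernel -/

/-- Integration by parts, using that `1 / x` is monotone. -/
theorem abs_integral_sinc_le {a b : ℝ} (ha : 0 < a) (hab : a ≤ b) :
    |∫ x in a..b, Real.sinc x| ≤ 2 / a := by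
  have hpos : ∀ x ∈ uIcc a b, 0 < x := fun x hx => by
    rw [uIcc_of_le hab] at hx; exact ha.trans_le hx.1
  have h1 : ∫ x in a..b, Real.sinc x = ∫ x in a..b, x⁻¹ * Real.sin x :=
    integral_congr fun x hx => by
      simp only [Real.sinc_of_ne_zero (hpos x hx).ne']; ring
  have hcont : ContinuousOn (fun x : ℝ => -(x ^ 2)⁻¹) (uIcc a b) :=
    (ContinuousOn.inv₀ (by fun_prop) fun x hx => pow_ne_zero 2 (hpos x hx).ne').neg
  have h2 := intervalIntegral.integral_mul_deriv_eq_deriv_mul (a := a) (b := b)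
    (u := fun x : ℝ => x⁻¹) (v := fun x => -Real.cos x) (u' := fun x => -(x ^ 2)⁻¹) (v' := Real.sin)
    (fun x hx => hasDerivAt_inv (hpos x hx).ne')
    (fun x _ => by simpa using (Real.hasDerivAt_cos x).fun_neg)
    (hcont.intervalIntegrable (μ := volume)) (Real.continuous_sin.intervalIntegrable _ _)
  rw [h1, h2]
  have h3 : |∫ x in a..b, -(x ^ 2)⁻¹ * -Real.cos x| ≤ ∫ x in a..b, (x ^ 2)⁻¹ := by
    have := norm_integral_le_of_norm_le (μ := volume) (f := fun x : ℝ => -(x ^ 2)⁻¹ * -Real.cos x)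
      (g := fun x : ℝ => (x ^ 2)⁻¹) hab
      (Eventually.of_forall fun x _ => by
        rw [norm_mul, norm_neg, norm_neg, Real.norm_eq_abs, Real.norm_eq_abs,
          abs_of_nonneg (by positivity : (0 : ℝ) ≤ (x ^ 2)⁻¹)]
        exact mul_le_of_le_one_right (by positivity) (Real.abs_cos_le_one x))
      (by simpa using hcont.fun_neg.intervalIntegrable)
    simpa using this
  have h4 : ∫ x in a..b, (x ^ 2)⁻¹ = a⁻¹ - b⁻¹ := by
    have := integral_eq_sub_of_hasDerivAt (a := a) (b := b) (f := fun x : ℝ => -x⁻¹)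
      (f' := fun x => (x ^ 2)⁻¹)
      (fun x hx => by simpa using (hasDerivAt_inv (hpos x hx).ne').fun_neg)
      (by simpa using hcont.fun_neg.intervalIntegrable)
    rw [this]; ring
  rw [h4] at h3
  have hb : 0 < b := ha.trans_le hab
  have hA : |b⁻¹ * -Real.cos b| ≤ b⁻¹ := by
    rw [abs_mul, abs_neg, abs_of_pos (inv_pos.2 hb)]
    exact mul_le_of_le_one_right (by positivity) (Real.abs_cos_le_one b)
  have hB : |a⁻¹ * -Real.cos a| ≤ a⁻¹ := by
    rw [abs_mul, abs_neg, abs_of_pos (inv_pos.2 ha)]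
    exact mul_le_of_le_one_right (by positivity) (Real.abs_cos_le_one a)
  rw [div_eq_mul_inv]
  rw [abs_le] at *
  constructor <;> linarith

theorem abs_integral_sinc_le_three {a b : ℝ} (ha : 0 ≤ a) (hab : a ≤ b) :
    |∫ x in a..b, Real.sinc x| ≤ 3 := by
  have hI : ∀ c d : ℝ, IntervalIntegrable Real.sinc volume c d := fun c d =>
    Real.continuous_sinc.intervalIntegrable c d
  have hsmall : ∀ c d : ℝ, |∫ x in c..d, Real.sinc x| ≤ |d - c| := fun c d => by
    have := norm_integral_le_of_norm_le_const (a := c) (b := d) (f := Real.sinc) (C := 1)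
      (fun x _ => Real.abs_sinc_le_one x)
    simpa using this
  rcases le_total 1 a with h1 | h1
  · refine (abs_integral_sinc_le (by linarith) hab).trans ?_
    rw [div_le_iff₀ (by linarith)]; linarith
  rcases le_total b 1 with h2 | h2
  · refine (hsmall a b).trans ?_
    rw [abs_of_nonneg (by linarith)]; linarith
  · rw [← integral_add_adjacent_intervals (hI a 1) (hI 1 b)]
    refine (abs_add_le _ _).trans ?_
    have := hsmall a 1
    rw [abs_of_nonneg (show (0 : ℝ) ≤ 1 - a by linarith)] at this
    have h3 := abs_integral_sinc_le one_pos h2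
    linarith

theorem abs_integral_sinc_le_six {a b : ℝ} (hab : a ≤ b) :
    |∫ x in a..b, Real.sinc x| ≤ 6 := by
  have hI : ∀ c d : ℝ, IntervalIntegrable Real.sinc volume c d := fun c d =>
    Real.continuous_sinc.intervalIntegrable c d
  have hneg : ∀ c d : ℝ, ∫ x in c..d, Real.sinc x = ∫ x in -d..-c, Real.sinc x := fun c d => by
    rw [← integral_comp_neg]; simp
  rcases le_total 0 a with h1 | h1
  · linarith [abs_integral_sinc_le_three h1 hab]
  rcases le_total b 0 with h2 | h2
  · rw [hneg]
    linarith [abs_integral_sinc_le_three (a := -b) (b := -a) (by linarith) (by linarith)]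
  · rw [← integral_add_adjacent_intervals (hI a 0) (hI 0 b), hneg a 0]
    refine (abs_add_le _ _).trans ?_
    have := abs_integral_sinc_le_three (a := -0) (b := -a) (by simp) (by linarith)
    have := abs_integral_sinc_le_three le_rfl h2
    linarith

/-- The Dirichlet kernel `sin (T y) / y`, continuously extended to `y = 0`. -/
noncomputable def dirichletKernel (T y : ℝ) : ℂ := ((T * Real.sinc (T * y) : ℝ) : ℂ)

theorem continuous_dirichletKernel (T : ℝ) : Continuous (dirichletKernel T) := by
  unfold dirichletKernel
  have := Real.continuous_sinc
  fun_prop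

theorem dirichletKernel_neg (T y : ℝ) : dirichletKernel T (-y) = dirichletKernel T y := by
  simp [dirichletKernel]

theorem integral_dirichletKernel (T a b : ℝ) :
    ∫ y in a..b, dirichletKernel T y = ((∫ x in T * a..T * b, Real.sinc x : ℝ) : ℂ) := by
  unfold dirichletKernel
  rw [intervalIntegral.integral_ofReal, intervalIntegral.integral_const_mul,
    mul_integral_comp_mul_left]

theorem norm_dirichletKernel_le (T y : ℝ) : ‖dirichletKernel T y‖ ≤ |T| := by
  rw [dirichletKernel, Complex.norm_real, Real.norm_eq_abs, abs_mul]
  exact mul_le_of_le_one_right (abs_nonneg T) (Real.abs_sinc_le_one _)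

theorem integral_exp_eq_dirichletKernel (T y : ℝ) :
    ∫ t in -T..T, Complex.exp (t * y * Complex.I) = 2 * dirichletKernel T y := by
  unfold dirichletKernel
  rcases eq_or_ne y 0 with rfl | hy
  · simp; ring
  rcases eq_or_ne T 0 with rfl | hT
  · simp
  have h := integral_exp_mul_complex (a := -T) (b := T) (c := y * Complex.I)
    (by simp [hy])
  have e : ∀ t : ℝ, Complex.exp (t * y * Complex.I) = Complex.exp (y * Complex.I * t) := by
    intro t; congr 1; ring
  simp_rw [e]
  rw [h, Real.sinc_of_ne_zero (mul_ne_zero hT hy)]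
  push_cast
  rw [Complex.sin]
  have h1 : Complex.exp (y * Complex.I * T) = Complex.exp (T * y * Complex.I) := by
    congr 1; ring
  have h2 : Complex.exp (y * Complex.I * -T) = Complex.exp (-(T * y) * Complex.I) := by
    congr 1; ring
  have hy' : (y : ℂ) ≠ 0 := by exact_mod_cast hy
  have hT' : (T : ℂ) ≠ 0 := by exact_mod_cast hT
  rw [h1, h2]
  field_simp
  rw [Complex.I_sq]
  ring

/-! ### The Dirichlet–Jordan theorem -/

theorem boundedVariationOn_add {α : Type*} [LinearOrder α] {f g : α → ℂ} {s : Set α}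
    (hf : BoundedVariationOn f s) (hg : BoundedVariationOn g s) :
    BoundedVariationOn (fun x => f x + g x) s := by
  refine ne_top_of_le_ne_top (ENNReal.add_ne_top.2 ⟨hf, hg⟩) ?_
  refine iSup_le ?_
  rintro ⟨n, u, hu, us⟩
  calc ∑ i ∈ Finset.range n, edist (f (u (i + 1)) + g (u (i + 1))) (f (u i) + g (u i))
      ≤ ∑ i ∈ Finset.range n, (edist (f (u (i + 1))) (f (u i)) + edist (g (u (i + 1))) (g (u i))) :=
        Finset.sum_le_sum fun i _ => edist_add_add_le _ _ _ _
    _ ≤ _ := by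
        rw [Finset.sum_add_distrib]
        exact add_le_add (eVariationOn.sum_le hu us) (eVariationOn.sum_le hu us)

/-- Fubini turns a symmetric partial Fourier integral into an integral against the Dirichlet
kernel. -/
theorem integral_partial_fourier {G : ℝ → ℂ} (hG : Integrable G) (x₀ T : ℝ) :
    ∫ t in -T..T, Complex.exp (-(t * x₀) * Complex.I) * ∫ x, G x * Complex.exp (t * x * Complex.I) =
      2 * ∫ x, G x * dirichletKernel T (x - x₀) := by
  have h1 : ∀ t : ℝ, Complex.exp (-(t * x₀) * Complex.I) *
      ∫ x, G x * Complex.exp (t * x * Complex.I) =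
      ∫ x, G x * Complex.exp (t * ((x - x₀ : ℝ) : ℂ) * Complex.I) := by
    intro t
    rw [← MeasureTheory.integral_const_mul]
    congr 1; funext x
    rw [mul_left_comm, ← Complex.exp_add]
    congr 2; push_cast; ring
  simp_rw [h1]
  rw [intervalIntegral_integral_swap, ← MeasureTheory.integral_const_mul]
  · congr 1; funext x
    rw [intervalIntegral.integral_const_mul, integral_exp_eq_dirichletKernel]; ring
  · have h2 : Integrable (fun p : ℝ × ℝ => (1 : ℂ) * G p.2)
        ((volume.restrict (uIoc (-T) T)).prod volume) :=
      Integrable.mul_prod (f := fun _ : ℝ => (1 : ℂ)) (by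
        rw [uIoc]; exact integrable_const _) hG
    simp only [one_mul] at h2
    refine h2.mul_bdd (c := 1) (by fun_prop) (Eventually.of_forall fun p => ?_)
    have : Complex.exp ((p.1 : ℂ) * ((p.2 - x₀ : ℝ) : ℂ) * Complex.I) =
        Complex.exp (((p.1 * (p.2 - x₀) : ℝ) : ℂ) * Complex.I) := by push_cast; rfl
    simp only [this, Complex.norm_exp_ofReal_mul_I, le_refl]

theorem integrable_mul_dirichletKernel {G : ℝ → ℂ} {μ : Measure ℝ} (hG : Integrable G μ)
    (T x₀ : ℝ) :
    Integrable (fun x => G x * dirichletKernel T (x - x₀)) μ :=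
  hG.mul_bdd (c := |T|)
    ((continuous_dirichletKernel T).comp (continuous_sub_right x₀)).aestronglyMeasurable
    (Eventually.of_forall fun _ => norm_dirichletKernel_le _ _)

theorem norm_integral_mul_dirichletKernel_le {G : ℝ → ℂ} (hG : BoundedVariationOn G univ)
    (hint : Integrable G) (h0 : Tendsto G atTop (𝓝 0)) (x₀ : ℝ) {T : ℝ} (hT : 0 ≤ T) :
    ‖∫ x, G x * dirichletKernel T (x - x₀)‖ ≤ 6 * (eVariationOn G univ).toReal := by
  refine norm_integral_univ_mul_le_variation hG
    ((continuous_dirichletKernel T).comp (continuous_sub_right x₀)) h0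
    (integrable_mul_dirichletKernel hint T x₀) fun a x hax => ?_
  have : ∫ t in a..x, dirichletKernel T (t - x₀) = ∫ t in (a - x₀)..(x - x₀), dirichletKernel T t :=
    integral_comp_sub_right _ _
  rw [this, integral_dirichletKernel, Complex.norm_real, Real.norm_eq_abs]
  exact abs_integral_sinc_le_six (by gcongr)

/-- A function of bounded variation that is right continuous with value `0` at `0` integrates to
`o(1)` against the Dirichlet kernel on `(0, ∞)`: near `0` its variation is small, and away from `0`
the kernel has small primitives. -/
theorem tendsto_integral_Ioi_mul_dirichletKernel_zero {k : ℝ → ℂ} (hk : BoundedVariationOn k univ)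
    (hint : IntegrableOn k (Ioi 0)) (hTop : Tendsto k atTop (𝓝 0)) (hk0 : k 0 = 0)
    (hcont : ContinuousWithinAt k (Ici 0) 0) :
    Tendsto (fun T => ∫ y in Ioi 0, k y * dirichletKernel T y) atTop (𝓝 0) := by
  set V := (eVariationOn k univ).toReal with hV
  rw [Metric.tendsto_nhds]
  intro η hη
  have h1 := hk.tendsto_eVariationOn_Icc_zero_right (0 : ℝ) (by simpa using hcont)
  simp only [univ_inter, nhdsWithin_univ] at h1
  have h2 : ∀ᶠ y in 𝓝 (0 : ℝ), eVariationOn k (Icc 0 y) < ENNReal.ofReal (η / 12) :=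
    h1.eventually (gt_mem_nhds (by simpa using by positivity))
  obtain ⟨d, hd, hd'⟩ := Metric.eventually_nhds_iff.1 h2
  set δ := d / 2 with hδ
  have hδ0 : 0 < δ := by positivity
  have hvar : eVariationOn k (Icc 0 δ) < ENNReal.ofReal (η / 12) :=
    hd' (by rw [Real.dist_eq, sub_zero, abs_of_pos hδ0]; linarith)
  have hvar' : (eVariationOn k (Icc 0 δ)).toReal ≤ η / 12 := by
    rw [← ENNReal.toReal_ofReal (by positivity : (0 : ℝ) ≤ η / 12)]
    exact ENNReal.toReal_mono ENNReal.ofReal_ne_top hvar.le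
  have hkδ : ‖k δ‖ ≤ η / 12 := by
    have := (hk.mono (subset_univ (Icc 0 δ))).dist_le (right_mem_Icc.2 hδ0.le)
      (left_mem_Icc.2 hδ0.le)
    rw [hk0, dist_zero_right] at this
    exact this.trans hvar'
  have h3 : ∀ᶠ T : ℝ in atTop, 2 / (T * δ) * V < η / 2 := by
    have : Tendsto (fun T : ℝ => 2 / (T * δ) * V) atTop (𝓝 (0 * V)) :=
      ((tendsto_const_nhds.div_atTop (tendsto_id.atTop_mul_const hδ0))).mul_const V
    rw [zero_mul] at this
    exact this.eventually (gt_mem_nhds (by positivity))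
  filter_upwards [h3, eventually_gt_atTop 0] with T hT hT0
  have hI : IntegrableOn (fun y => k y * dirichletKernel T y) (Ioi 0) := by
    simpa [IntegrableOn] using integrable_mul_dirichletKernel hint T 0
  rw [dist_zero_right, ← integral_interval_add_Ioi (b := δ) hI
    (hI.mono_set (Ioi_subset_Ioi hδ0.le))]
  have hA : ‖∫ y in (0 : ℝ)..δ, k y * dirichletKernel T y‖ ≤ 3 * (η / 12 + η / 12) := by
    refine (norm_integral_mul_le_variation (M := 3) hδ0.le hk (continuous_dirichletKernel T)
      fun x hx => ?_).trans (by gcongr)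
    rw [integral_dirichletKernel, Complex.norm_real, Real.norm_eq_abs]
    have := hx.1
    exact abs_integral_sinc_le_three (by simp) (by gcongr)
  have hB : ‖∫ y in Ioi δ, k y * dirichletKernel T y‖ ≤ 2 / (T * δ) * V := by
    refine norm_setIntegral_Ioi_mul_le_variation hk (continuous_dirichletKernel T) hTop
      (hI.mono_set (Ioi_subset_Ioi hδ0.le)) fun x hx => ?_
    rw [integral_dirichletKernel, Complex.norm_real, Real.norm_eq_abs]
    exact abs_integral_sinc_le (by positivity) (by gcongr)
  have := norm_add_le (∫ y in (0 : ℝ)..δ, k y * dirichletKernel T y)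
    (∫ y in Ioi δ, k y * dirichletKernel T y)
  linarith

/-- Folding an integral over the line onto the half-line. -/
theorem integral_eq_integral_Ioi_add_neg {F : ℝ → ℂ} (hF : Integrable F) :
    ∫ x, F x = ∫ x in Ioi 0, (F x + F (-x)) := by
  rw [integral_add hF.integrableOn hF.comp_neg.integrableOn, integral_comp_neg_Ioi,
    neg_zero, add_comm]
  exact (intervalIntegral.integral_Iic_add_Ioi hF.integrableOn hF.integrableOn).symm

/-- The Gaussian is the reference function that fixes the constant `π / 2` in the Dirichlet–Jordan
theorem: its Fourier transform is explicit and integrable, so Fubini gives the limit. -/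
theorem tendsto_integral_gaussian_mul_dirichletKernel :
    Tendsto (fun T => ∫ y in Ioi (0 : ℝ), Complex.exp (-(y : ℂ) ^ 2) * dirichletKernel T y) atTop
      (𝓝 (Real.pi / 2)) := by
  have hG : Integrable (fun x : ℝ => Complex.exp (-(x : ℂ) ^ 2)) := by
    simpa using integrable_cexp_neg_mul_sq (b := 1) (by simp)
  have e1 : ∀ T : ℝ, ∫ y in Ioi (0 : ℝ), Complex.exp (-(y : ℂ) ^ 2) * dirichletKernel T y =
      1 / 4 * ∫ t in -T..T, (Real.pi : ℂ) ^ (1 / 2 : ℂ) * Complex.exp (-(1 / 4) * (t : ℂ) ^ 2) := by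
    intro T
    have h1 := integral_partial_fourier hG 0 T
    have hI := integrable_mul_dirichletKernel hG T 0
    simp only [sub_zero] at h1 hI
    rw [integral_eq_integral_Ioi_add_neg hI] at h1
    have h2 : ∀ x : ℝ, Complex.exp (-(x : ℂ) ^ 2) * dirichletKernel T x +
        Complex.exp (-((-x : ℝ) : ℂ) ^ 2) * dirichletKernel T (-x) =
        2 * (Complex.exp (-(x : ℂ) ^ 2) * dirichletKernel T x) := by
      intro x; rw [dirichletKernel_neg]; push_cast; rw [neg_sq]; ring
    simp_rw [h2] at h1
    rw [MeasureTheory.integral_const_mul] at h1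
    have h3 : ∀ t : ℝ, Complex.exp (-(t * ((0 : ℝ) : ℂ)) * Complex.I) *
        ∫ x : ℝ, Complex.exp (-(x : ℂ) ^ 2) * Complex.exp (t * x * Complex.I) =
        (Real.pi : ℂ) ^ (1 / 2 : ℂ) * Complex.exp (-(1 / 4) * (t : ℂ) ^ 2) := by
      intro t
      have := fourierIntegral_gaussian (b := 1) (by simp) (t : ℂ)
      simp only [neg_mul, one_mul, div_one, mul_one] at this
      simp only [Complex.ofReal_zero, mul_zero, neg_zero, zero_mul, Complex.exp_zero, one_mul]
      have e : ∀ x : ℝ, Complex.exp (-(x : ℂ) ^ 2) * Complex.exp (t * x * Complex.I) =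
          Complex.exp (Complex.I * t * x) * Complex.exp (-(x : ℂ) ^ 2) := by
        intro x; rw [mul_comm]; congr 2; ring
      simp_rw [e]
      rw [this]
      congr 2
      ring
    simp_rw [h3] at h1
    rw [h1]; ring
  simp_rw [e1]
  have hg : Integrable (fun t : ℝ => (Real.pi : ℂ) ^ (1 / 2 : ℂ) *
      Complex.exp (-(1 / 4) * (t : ℂ) ^ 2)) :=
    (integrable_cexp_neg_mul_sq (b := 1 / 4) (by norm_num)).const_mul _
  have h := (intervalIntegral_tendsto_integral hg tendsto_neg_atTop_atBot tendsto_id).const_mul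
    (1 / 4 : ℂ)
  have e2 : (1 / 4 : ℂ) * ∫ t : ℝ, (Real.pi : ℂ) ^ (1 / 2 : ℂ) *
      Complex.exp (-(1 / 4) * (t : ℂ) ^ 2) = Real.pi / 2 := by
    rw [MeasureTheory.integral_const_mul, integral_gaussian_complex (by norm_num)]
    have hs : ∀ r : ℝ, 0 ≤ r → (r : ℂ) ^ (1 / 2 : ℂ) = (Real.sqrt r : ℂ) := by
      intro r hr
      rw [Real.sqrt_eq_rpow, Complex.ofReal_cpow hr]
      norm_num
    have h4 : (Real.pi : ℂ) / (1 / 4) = ((4 * Real.pi : ℝ) : ℂ) := by push_cast; ring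
    rw [h4, hs _ Real.pi_pos.le, hs _ (by positivity), Real.sqrt_mul (by norm_num),
      show Real.sqrt 4 = 2 by
        rw [show (4 : ℝ) = 2 ^ 2 by norm_num]; exact Real.sqrt_sq (by norm_num)]
    push_cast
    have : (Real.sqrt Real.pi : ℂ) * (Real.sqrt Real.pi : ℂ) = Real.pi := by
      rw [← Complex.ofReal_mul, Real.mul_self_sqrt Real.pi_pos.le]
    linear_combination (1 / 2) * this
  rw [e2] at h
  exact h

/-- With `max y 0` in place of `y` the Gaussian is constant on the negative half-line, hence
monotone on the whole line. -/
theorem boundedVariationOn_max_gaussian :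
    BoundedVariationOn (fun y : ℝ => Complex.exp (-((max y 0 : ℝ) : ℂ) ^ 2)) univ := by
  have h1 : MonotoneOn (fun y : ℝ => -Real.exp (-(max y 0) ^ 2)) univ := by
    intro x _ y _ hxy
    have h0 : (0 : ℝ) ≤ max x 0 := le_max_right _ _
    have h1 : max x 0 ≤ max y 0 := max_le_max_right 0 hxy
    simp only [neg_le_neg_iff, Real.exp_le_exp]
    gcongr
  have h2 := h1.boundedVariationOn (C := 1) fun x _ => by
    rw [abs_neg, abs_of_pos (Real.exp_pos _), Real.exp_le_one_iff]
    nlinarith [sq_nonneg (max x 0)]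
  have h3 : LipschitzWith 1 fun r : ℝ => ((-r : ℝ) : ℂ) :=
    LipschitzWith.of_edist_le fun x y => by
      rw [edist_dist, edist_dist, Complex.dist_eq, ← Complex.ofReal_sub, Complex.norm_real,
        Real.norm_eq_abs, neg_sub_neg, abs_sub_comm, Real.dist_eq]
  have h4 := h3.comp_boundedVariationOn h2
  have : (fun y : ℝ => Complex.exp (-((max y 0 : ℝ) : ℂ) ^ 2)) =
      (fun r : ℝ => ((-r : ℝ) : ℂ)) ∘ fun y : ℝ => -Real.exp (-(max y 0) ^ 2) := by
    funext y; simp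
  rw [this]
  exact h4

/-- The **Dirichlet–Jordan theorem** on the real line. -/
theorem tendsto_integral_mul_dirichletKernel {G : ℝ → ℂ} (hG : BoundedVariationOn G univ)
    (hint : Integrable G) (hTop : Tendsto G atTop (𝓝 0)) (hBot : Tendsto G atBot (𝓝 0)) {x₀ : ℝ}
    (hx : Function.rightLim G x₀ + Function.leftLim G x₀ = 2 * G x₀) :
    Tendsto (fun T => ∫ x, G x * dirichletKernel T (x - x₀)) atTop (𝓝 (Real.pi * G x₀)) := by
  -- Fold `G` about `x₀` and subtract the multiple `2 G(x₀)` of the Gaussian. By `hx` the difference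
  -- `k` is right continuous at `0` with value `0`, so that only the Gaussian contributes.
  set ψ : ℝ → ℂ := fun y => Complex.exp (-((max y 0 : ℝ) : ℂ) ^ 2) with hψ
  set k : ℝ → ℂ := fun y => (G (x₀ + y) + G (x₀ - y)) + (-(2 * G x₀)) * ψ y with hk
  have hψeq : ∀ y ∈ Ioi (0 : ℝ), ψ y = Complex.exp (-(y : ℂ) ^ 2) := fun y hy => by
    simp only [hψ, max_eq_left (le_of_lt (mem_Ioi.1 hy))]
  have hgauss : Integrable (fun x : ℝ => Complex.exp (-(x : ℂ) ^ 2)) := by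
    simpa using integrable_cexp_neg_mul_sq (b := 1) (by simp)
  have hψint : IntegrableOn ψ (Ioi 0) :=
    (integrableOn_congr_fun hψeq measurableSet_Ioi).2 hgauss.integrableOn
  have hadd : Integrable fun y => G (x₀ + y) := hint.comp_add_left x₀
  have hsub : Integrable fun y => G (x₀ - y) := hint.comp_sub_left x₀
  have hBV1 : BoundedVariationOn (fun y => G (x₀ + y)) univ :=
    ne_top_of_le_ne_top hG (eVariationOn.comp_le_of_monotoneOn G (fun y => x₀ + y)
      (fun _ _ _ _ h => add_le_add_right h x₀) (mapsTo_univ _ _))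
  have hBV2 : BoundedVariationOn (fun y => G (x₀ - y)) univ :=
    ne_top_of_le_ne_top hG (eVariationOn.comp_le_of_antitoneOn G (fun y => x₀ - y)
      (fun _ _ _ _ h => sub_le_sub_left h x₀) (mapsTo_univ _ _))
  have hBV3 : BoundedVariationOn (fun y => -(2 * G x₀) * ψ y) univ :=
    (lipschitzWith_smul (-(2 * G x₀))).comp_boundedVariationOn boundedVariationOn_max_gaussian
  have hkBV : BoundedVariationOn k univ :=
    boundedVariationOn_add (boundedVariationOn_add hBV1 hBV2) hBV3
  have hkint : IntegrableOn k (Ioi 0) :=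
    (hadd.add hsub).integrableOn.add (hψint.const_mul _)
  have hk0 : k 0 = 0 := by simp [hk, hψ]; ring
  have hψc : Continuous ψ := by fun_prop
  have hkTop : Tendsto k atTop (𝓝 0) := by
    have h1 : Tendsto (fun y => G (x₀ + y)) atTop (𝓝 0) :=
      hTop.comp (tendsto_atTop_add_const_left _ x₀ tendsto_id)
    have h2 : Tendsto (fun y => G (x₀ - y)) atTop (𝓝 0) :=
      hBot.comp (tendsto_atBot_add_const_left _ x₀ tendsto_neg_atTop_atBot)
    have h3 : Tendsto ψ atTop (𝓝 0) := by
      have : Tendsto (fun y : ℝ => Real.exp (-y ^ 2)) atTop (𝓝 0) :=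
        Real.tendsto_exp_neg_atTop_nhds_zero.comp (tendsto_pow_atTop two_ne_zero)
      have h := (Complex.continuous_ofReal.tendsto 0).comp this
      rw [Complex.ofReal_zero] at h
      refine h.congr' ?_
      filter_upwards [eventually_gt_atTop 0] with y hy
      rw [hψeq y hy]; simp
    simpa [hk] using (h1.add h2).add (h3.const_mul (-(2 * G x₀)))
  have hkcont : ContinuousWithinAt k (Ici 0) 0 := by
    have h1 : Tendsto (fun y => G (x₀ + y)) (𝓝[>] 0) (𝓝 (Function.rightLim G x₀)) := by
      refine (hG.tendsto_rightLim x₀).comp ?_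
      refine tendsto_nhdsWithin_iff.2 ⟨?_, ?_⟩
      · exact ((continuous_const_add x₀).tendsto' 0 x₀ (by simp)).mono_left nhdsWithin_le_nhds
      · filter_upwards [self_mem_nhdsWithin] with y hy
        simpa using hy
    have h2 : Tendsto (fun y => G (x₀ - y)) (𝓝[>] 0) (𝓝 (Function.leftLim G x₀)) := by
      refine (hG.tendsto_leftLim x₀).comp ?_
      refine tendsto_nhdsWithin_iff.2 ⟨?_, ?_⟩
      · exact ((continuous_const.sub continuous_id).tendsto' 0 x₀ (by simp)).mono_left
          nhdsWithin_le_nhds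
      · filter_upwards [self_mem_nhdsWithin] with y hy
        simpa using hy
    have h3 : Tendsto ψ (𝓝[>] 0) (𝓝 1) :=
      (hψc.tendsto' 0 1 (by simp [hψ])).mono_left nhdsWithin_le_nhds
    have h4 : Tendsto k (𝓝[>] 0) (𝓝 (k 0)) := by
      have := (h1.add h2).add (h3.const_mul (-(2 * G x₀)))
      rwa [hx, mul_one, add_neg_cancel, ← hk0] at this
    exact continuousWithinAt_Ioi_iff_Ici.1 h4
  have hlim := (tendsto_integral_Ioi_mul_dirichletKernel_zero hkBV hkint hkTop hk0 hkcont).add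
    (tendsto_integral_gaussian_mul_dirichletKernel.const_mul (2 * G x₀))
  have hval : (0 : ℂ) + 2 * G x₀ * (Real.pi / 2) = Real.pi * G x₀ := by ring
  rw [hval] at hlim
  refine hlim.congr fun T => ?_
  have e1 : ∫ x, G x * dirichletKernel T (x - x₀) =
      ∫ y, G (x₀ + y) * dirichletKernel T y := by
    rw [← integral_add_left_eq_self _ x₀]
    simp
  have hI1 : Integrable fun y => G (x₀ + y) * dirichletKernel T y := by
    simpa using integrable_mul_dirichletKernel hadd T 0
  rw [e1, integral_eq_integral_Ioi_add_neg hI1, ← MeasureTheory.integral_const_mul,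
    ← MeasureTheory.integral_add]
  · refine setIntegral_congr_fun measurableSet_Ioi fun y hy => ?_
    simp only [hk, hψeq y hy, dirichletKernel_neg, ← sub_eq_add_neg]
    ring
  · simpa using integrable_mul_dirichletKernel hkint T 0
  · have := (integrable_mul_dirichletKernel hgauss T 0).integrableOn (s := Ioi 0)
    simp only [sub_zero] at this
    exact this.const_mul _

/-! ### Bounded variation in logarithmic coordinates -/

/-- A function whose increments are dominated by those of a real function `m` has variation at most
the oscillation of `m`. -/
theorem eVariationOn_le_of_dist_le_sub {w : ℝ → ℂ} {m : ℝ → ℝ} {s : Set ℝ} {B : ℝ}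
    (h : ∀ x ∈ s, ∀ y ∈ s, x ≤ y → ‖w y - w x‖ ≤ m y - m x)
    (hB : ∀ x ∈ s, ∀ y ∈ s, m y - m x ≤ B) : eVariationOn w s ≤ ENNReal.ofReal B := by
  refine iSup_le ?_
  rintro ⟨n, u, hu, us⟩
  calc ∑ i ∈ Finset.range n, edist (w (u (i + 1))) (w (u i))
      ≤ ∑ i ∈ Finset.range n, ENNReal.ofReal (m (u (i + 1)) - m (u i)) := by
        refine Finset.sum_le_sum fun i _ => ?_
        rw [edist_dist, dist_eq_norm]
        exact ENNReal.ofReal_le_ofReal (h _ (us i) _ (us (i + 1)) (hu (Nat.le_succ i)))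
    _ = ENNReal.ofReal (m (u n) - m (u 0)) := by
        rw [← ENNReal.ofReal_sum_of_nonneg fun i _ =>
          (norm_nonneg _).trans (h _ (us i) _ (us (i + 1)) (hu (Nat.le_succ i))),
          Finset.sum_range_sub (fun i => m (u i))]
    _ ≤ _ := ENNReal.ofReal_le_ofReal (hB _ (us 0) _ (us n))

/-- The reciprocal of `e ^ (-αx) + e ^ (βx)`. For `α = σ + ε` and `β = 1 + ε - σ` it is
`u ^ σ / K_ε(u)` at `u = e ^ x`. -/
noncomputable def bump (α β x : ℝ) : ℝ := (Real.exp (-(α * x)) + Real.exp (β * x))⁻¹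

theorem bump_pos (α β x : ℝ) : 0 < bump α β x := by unfold bump; positivity

theorem bump_neg (α β x : ℝ) : bump α β (-x) = bump β α x := by
  unfold bump; rw [add_comm]; ring_nf

theorem bump_le_exp_left (α β x : ℝ) : bump α β x ≤ Real.exp (α * x) := by
  have : Real.exp (α * x) = (Real.exp (-(α * x)))⁻¹ := by rw [Real.exp_neg, inv_inv]
  rw [this]
  unfold bump
  gcongr
  linarith [Real.exp_pos (β * x)]

theorem bump_le_exp_right (α β x : ℝ) : bump α β x ≤ Real.exp (-(β * x)) := by
  rw [Real.exp_neg]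
  unfold bump
  gcongr
  linarith [Real.exp_pos (-(α * x))]

theorem bump_le_one {α β : ℝ} (hα : 0 ≤ α) (hβ : 0 ≤ β) (x : ℝ) : bump α β x ≤ 1 := by
  rcases le_total x 0 with h | h
  · exact (bump_le_exp_left α β x).trans
      (Real.exp_le_one_iff.2 (mul_nonpos_of_nonneg_of_nonpos hα h))
  · exact (bump_le_exp_right α β x).trans
      (Real.exp_le_one_iff.2 (neg_nonpos.2 (mul_nonneg hβ h)))

/-- The bound does not depend on `α`, `β`. On the positive half-line the increments of the two
exponentials are dominated separately, by those of `-e ^ (-αx)` and `-e ^ (-βx)`. -/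
theorem eVariationOn_bump_Ici_le {α β : ℝ} (hα : 0 ≤ α) (hβ : 0 ≤ β) :
    eVariationOn (fun x => (bump α β x : ℂ)) (Ici 0) ≤ ENNReal.ofReal 2 := by
  refine eVariationOn_le_of_dist_le_sub
    (m := fun x => -Real.exp (-(α * x)) - Real.exp (-(β * x))) ?_ ?_
  · intro x hx y hy hxy
    rw [← Complex.ofReal_sub, Complex.norm_real, Real.norm_eq_abs]
    have hx0 : 0 ≤ x := hx
    have hy0 : 0 ≤ y := hy
    have hA : Real.exp (-(α * y)) ≤ Real.exp (-(α * x)) :=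
      Real.exp_le_exp.2 (neg_le_neg (mul_le_mul_of_nonneg_left hxy hα))
    have hB : Real.exp (β * x) ≤ Real.exp (β * y) :=
      Real.exp_le_exp.2 (mul_le_mul_of_nonneg_left hxy hβ)
    have hBx : 1 ≤ Real.exp (β * x) := Real.one_le_exp (mul_nonneg hβ hx0)
    have hBy : 1 ≤ Real.exp (β * y) := Real.one_le_exp (mul_nonneg hβ hy0)
    rw [Real.exp_neg (β * x), Real.exp_neg (β * y)]
    unfold bump
    set a := Real.exp (-(α * x))
    set a' := Real.exp (-(α * y))
    set b := Real.exp (β * x)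
    set b' := Real.exp (β * y)
    have ha : 0 < a := Real.exp_pos _
    have ha' : 0 < a' := Real.exp_pos _
    have hD1 : 1 ≤ (a + b) * (a' + b') := by nlinarith
    have hD2 : b * b' ≤ (a + b) * (a' + b') := by nlinarith
    have e : (a' + b')⁻¹ - (a + b)⁻¹ =
        (a - a') / ((a + b) * (a' + b')) - (b' - b) / ((a + b) * (a' + b')) := by
      field_simp; ring
    have h1 : (a - a') / ((a + b) * (a' + b')) ≤ a - a' :=
      div_le_self (by linarith) hD1
    have h1' : 0 ≤ (a - a') / ((a + b) * (a' + b')) := div_nonneg (by linarith) (by linarith)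
    have h2 : (b' - b) / ((a + b) * (a' + b')) ≤ (b' - b) / (b * b') :=
      div_le_div_of_nonneg_left (by linarith) (by positivity) hD2
    have h2' : 0 ≤ (b' - b) / ((a + b) * (a' + b')) := div_nonneg (by linarith) (by linarith)
    have h3 : (b' - b) / (b * b') = b⁻¹ - b'⁻¹ := by field_simp
    rw [e, abs_le]
    constructor <;> linarith
  · intro x hx y hy
    have h1 : Real.exp (-(α * x)) ≤ 1 := Real.exp_le_one_iff.2 (neg_nonpos.2 (mul_nonneg hα hx))
    have h2 : Real.exp (-(β * x)) ≤ 1 := Real.exp_le_one_iff.2 (neg_nonpos.2 (mul_nonneg hβ hx))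
    linarith [Real.exp_pos (-(α * y)), Real.exp_pos (-(β * y))]

theorem eVariationOn_bump_le {α β : ℝ} (hα : 0 ≤ α) (hβ : 0 ≤ β) :
    eVariationOn (fun x => (bump α β x : ℂ)) univ ≤ ENNReal.ofReal 4 := by
  have h1 : eVariationOn (fun x => (bump α β x : ℂ)) (Iic 0) ≤ ENNReal.ofReal 2 := by
    refine le_trans ?_ (eVariationOn_bump_Ici_le hβ hα)
    have := eVariationOn.comp_le_of_antitoneOn (fun x => (bump β α x : ℂ)) (s := Ici 0)
      (t := Iic 0) (fun x => -x) (fun _ _ _ _ h => neg_le_neg h)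
      (fun x hx => by simpa using hx)
    refine le_trans (le_of_eq (eVariationOn.congr fun x _ => ?_)) this
    simp [bump_neg]
  rw [← Iic_union_Ici (a := (0 : ℝ)), eVariationOn.union _ isGreatest_Iic isLeast_Ici]
  refine (add_le_add h1 (eVariationOn_bump_Ici_le hα hβ)).trans (le_of_eq ?_)
  rw [← ENNReal.ofReal_add (by norm_num) (by norm_num)]
  norm_num

/-- The function `g(e ^ x) e ^ (σx)`, whose Fourier transform is the Mellin transform of `g` on the
line `Re s = σ`. -/
noncomputable def logProfile (g : ℝ → ℂ) (σ x : ℝ) : ℂ := g (Real.exp x) * (Real.exp (σ * x) : ℂ)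

theorem weight_exp (ε x : ℝ) :
    weight ε (Real.exp x) = Real.exp (-(ε * x)) + Real.exp ((1 + ε) * x) := by
  unfold weight
  rw [← Real.exp_mul, ← Real.exp_mul]
  ring_nf

theorem weight_pos {u : ℝ} (ε : ℝ) (hu : 0 < u) : 0 < weight ε u := by
  unfold weight; positivity

/-- The profile is the weighted function of condition `CondA`, times a multiplier of variation at
most `4`. -/
theorem logProfile_eq (g : ℝ → ℂ) (ε σ x : ℝ) :
    logProfile g σ x = (bump (σ + ε) (1 + ε - σ) x : ℂ) •
      (g (Real.exp x) * (weight ε (Real.exp x) : ℂ)) := by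
  have h : Real.exp (σ * x) = bump (σ + ε) (1 + ε - σ) x * weight ε (Real.exp x) := by
    rw [weight_exp, bump, eq_inv_mul_iff_mul_eq₀ (by positivity), add_mul, ← Real.exp_add,
      ← Real.exp_add]
    ring_nf
  rw [logProfile, h, smul_eq_mul]
  push_cast
  ring

theorem CondA.exists_bound {ε : ℝ} {g : ℝ → ℂ} (hA : CondA ε g) :
    ∃ C, 0 ≤ C ∧ ∀ u, 0 < u → ‖g u * (weight ε u : ℂ)‖ ≤ C :=
  exists_norm_le_of_boundedVariationOn hA

theorem CondA.boundedVariationOn_comp_exp {ε : ℝ} {g : ℝ → ℂ} (hA : CondA ε g) :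
    BoundedVariationOn (fun x => g (Real.exp x) * (weight ε (Real.exp x) : ℂ)) univ :=
  ne_top_of_le_ne_top hA (eVariationOn.comp_le_of_monotoneOn
    (fun u => g u * (weight ε u : ℂ)) Real.exp (Real.exp_monotone.monotoneOn _)
    (fun x _ => Real.exp_pos x))

/-- The profiles `g(e ^ x) e ^ (σx)` have variation bounded uniformly for `-ε ≤ σ ≤ 1 + ε`. -/
theorem CondA.exists_variation_logProfile_le {ε : ℝ} {g : ℝ → ℂ} (hA : CondA ε g) :
    ∃ V, 0 ≤ V ∧ ∀ σ, -ε ≤ σ → σ ≤ 1 + ε → BoundedVariationOn (logProfile g σ) univ ∧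
      (eVariationOn (logProfile g σ) univ).toReal ≤ V := by
  obtain ⟨C, hC0, hC⟩ := hA.exists_bound
  have hW := hA.boundedVariationOn_comp_exp
  set W : ℝ → ℂ := fun x => g (Real.exp x) * (weight ε (Real.exp x) : ℂ) with hWdef
  refine ⟨(eVariationOn W univ + ENNReal.ofReal C * ENNReal.ofReal 4).toReal,
    ENNReal.toReal_nonneg, fun σ h1 h2 => ?_⟩
  have hle : eVariationOn (logProfile g σ) univ ≤
      eVariationOn W univ + ENNReal.ofReal C * ENNReal.ofReal 4 := by
    have e : logProfile g σ = fun x => (bump (σ + ε) (1 + ε - σ) x : ℂ) • W x :=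
      funext fun x => logProfile_eq g ε σ x
    rw [e]
    refine (eVariationOn_fun_smul_le (C := 1) (D := ENNReal.ofReal C) ?_ ?_).trans ?_
    · intro x _
      rw [← ofReal_norm, Complex.norm_real, Real.norm_eq_abs, abs_of_pos (bump_pos _ _ _)]
      exact ENNReal.ofReal_le_one.2 (bump_le_one (by linarith) (by linarith) x)
    · intro x _
      rw [← ofReal_norm]
      exact ENNReal.ofReal_le_ofReal (hC _ (Real.exp_pos x))
    · rw [one_mul]
      gcongr
      exact eVariationOn_bump_le (by linarith) (by linarith)
  have hfin : eVariationOn W univ + ENNReal.ofReal C * ENNReal.ofReal 4 ≠ ⊤ :=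
    ENNReal.add_ne_top.2 ⟨hW, ENNReal.mul_ne_top ENNReal.ofReal_ne_top ENNReal.ofReal_ne_top⟩
  exact ⟨ne_top_of_le_ne_top hfin hle, ENNReal.toReal_mono hfin hle⟩

theorem norm_logProfile_le {ε : ℝ} {g : ℝ → ℂ} {C : ℝ}
    (hC : ∀ u, 0 < u → ‖g u * (weight ε u : ℂ)‖ ≤ C) (σ x : ℝ) :
    ‖logProfile g σ x‖ ≤ C * bump (σ + ε) (1 + ε - σ) x := by
  rw [logProfile_eq g ε, norm_smul, Complex.norm_real, Real.norm_eq_abs,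
    abs_of_pos (bump_pos _ _ _), mul_comm]
  exact mul_le_mul_of_nonneg_right (hC _ (Real.exp_pos x)) (bump_pos _ _ _).le

theorem CondA.integrable_logProfile {ε : ℝ} {g : ℝ → ℂ} (hA : CondA ε g) {σ : ℝ}
    (h1 : -ε < σ) (h2 : σ < 1 + ε) : Integrable (logProfile g σ) := by
  obtain ⟨C, hC0, hC⟩ := hA.exists_bound
  obtain ⟨V, -, hV⟩ := hA.exists_variation_logProfile_le
  have hm := (measurable_of_boundedVariationOn (hV σ h1.le h2.le).1).aestronglyMeasurable
    (μ := volume)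
  have hb := norm_logProfile_le hC σ
  rw [← integrableOn_univ, ← Iic_union_Ioi (a := (0 : ℝ))]
  refine IntegrableOn.union ?_ ?_
  · refine Integrable.mono' ((integrableOn_exp_mul_Iic (show 0 < σ + ε by linarith) 0).const_mul C)
      hm.restrict (Eventually.of_forall fun x => (hb x).trans ?_)
    gcongr
    exact bump_le_exp_left _ _ _
  · refine Integrable.mono' ((integrableOn_exp_mul_Ioi (show -(1 + ε - σ) < 0 by linarith)
      0).const_mul C) hm.restrict (Eventually.of_forall fun x => (hb x).trans ?_)
    rw [neg_mul]
    gcongr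
    exact bump_le_exp_right _ _ _

theorem CondA.tendsto_logProfile_atTop {ε : ℝ} {g : ℝ → ℂ} (hA : CondA ε g) {σ : ℝ}
    (h2 : σ < 1 + ε) : Tendsto (logProfile g σ) atTop (𝓝 0) := by
  obtain ⟨C, hC0, hC⟩ := hA.exists_bound
  have h : Tendsto (fun x : ℝ => C * Real.exp (-((1 + ε - σ) * x))) atTop (𝓝 (C * 0)) :=
    (Real.tendsto_exp_neg_atTop_nhds_zero.comp
      (tendsto_id.const_mul_atTop (show 0 < 1 + ε - σ by linarith))).const_mul C
  rw [mul_zero] at h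
  refine squeeze_zero_norm (fun x => (norm_logProfile_le hC σ x).trans ?_) h
  gcongr
  exact bump_le_exp_right _ _ _

theorem CondA.tendsto_logProfile_atBot {ε : ℝ} {g : ℝ → ℂ} (hA : CondA ε g) {σ : ℝ}
    (h1 : -ε < σ) : Tendsto (logProfile g σ) atBot (𝓝 0) := by
  obtain ⟨C, hC0, hC⟩ := hA.exists_bound
  have h : Tendsto (fun x : ℝ => C * Real.exp ((σ + ε) * x)) atBot (𝓝 (C * 0)) :=
    (Real.tendsto_exp_atBot.comp
      (tendsto_id.const_mul_atBot (show 0 < σ + ε by linarith))).const_mul C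
  rw [mul_zero] at h
  refine squeeze_zero_norm (fun x => (norm_logProfile_le hC σ x).trans ?_) h
  gcongr
  exact bump_le_exp_left _ _ _

/-! ### The Mellin transform of a function of bounded variation -/

theorem abs_exp_smul_mellin_integrand (g : ℝ → ℂ) (s : ℂ) (x : ℝ) :
    |Real.exp x| • ((Real.exp x : ℂ) ^ (s - 1) • g (Real.exp x)) =
      logProfile g s.re x * Complex.exp (s.im * x * Complex.I) := by
  have h1 : (Real.exp x : ℂ) ^ (s - 1) = Complex.exp (x * (s - 1)) := by
    rw [Complex.cpow_def_of_ne_zero (by exact_mod_cast (Real.exp_pos x).ne'),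
      ← Complex.ofReal_log (Real.exp_pos x).le, Real.log_exp]
  rw [abs_of_pos (Real.exp_pos x), h1, logProfile, Complex.real_smul, smul_eq_mul, ← mul_assoc,
    mul_comm _ (g _), mul_assoc, Complex.ofReal_exp, Complex.ofReal_exp, ← Complex.exp_add,
    ← Complex.exp_add]
  congr 2
  conv_lhs => rw [← Complex.re_add_im s]
  push_cast
  ring

theorem CondA.mellinConvergent {ε : ℝ} {g : ℝ → ℂ} (hA : CondA ε g) {s : ℂ}
    (h1 : -ε < s.re) (h2 : s.re < 1 + ε) : MellinConvergent g s := by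
  have h := integrableOn_image_iff_integrableOn_abs_deriv_smul (s := univ) (f := Real.exp)
    (f' := Real.exp) MeasurableSet.univ (fun x _ => (Real.hasDerivAt_exp x).hasDerivWithinAt)
    Real.exp_injective.injOn (fun t : ℝ => (t : ℂ) ^ (s - 1) • g t)
  rw [image_univ, Real.range_exp] at h
  refine h.2 ?_
  simp_rw [abs_exp_smul_mellin_integrand]
  rw [integrableOn_univ]
  refine (hA.integrable_logProfile h1 h2).mul_bdd (c := 1) (by fun_prop)
    (Eventually.of_forall fun x => ?_)
  rw [← Complex.ofReal_mul, Complex.norm_exp_ofReal_mul_I]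

theorem mellin_eq_integral_logProfile (g : ℝ → ℂ) (s : ℂ) :
    mellin g s = ∫ x, logProfile g s.re x * Complex.exp (s.im * x * Complex.I) := by
  have h := integral_image_eq_integral_abs_deriv_smul (s := univ) (f := Real.exp)
    (f' := Real.exp) MeasurableSet.univ (fun x _ => (Real.hasDerivAt_exp x).hasDerivWithinAt)
    Real.exp_injective.injOn (fun t : ℝ => (t : ℂ) ^ (s - 1) • g t)
  rw [image_univ, Real.range_exp] at h
  simp_rw [abs_exp_smul_mellin_integrand] at h
  rw [mellin, h, Measure.restrict_univ]

theorem CondA.norm_le_rpow {ε : ℝ} {g : ℝ → ℂ} {C : ℝ}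
    (hC : ∀ u, 0 < u → ‖g u * (weight ε u : ℂ)‖ ≤ C) {u : ℝ} (hu : 0 < u) :
    ‖g u‖ ≤ C * u ^ (-(1 + ε)) ∧ ‖g u‖ ≤ C * u ^ ε := by
  have h := hC u hu
  rw [norm_mul, Complex.norm_real, Real.norm_eq_abs, abs_of_pos (weight_pos ε hu)] at h
  have h1 : 0 < u ^ (-ε) := Real.rpow_pos_of_pos hu _
  have h2 : 0 < u ^ (1 + ε) := Real.rpow_pos_of_pos hu _
  unfold weight at h
  constructor
  · rw [Real.rpow_neg hu.le, ← div_eq_mul_inv, le_div_iff₀ h2]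
    nlinarith [norm_nonneg (g u)]
  · have e : u ^ ε = (u ^ (-ε))⁻¹ := by rw [Real.rpow_neg hu.le, inv_inv]
    rw [e, ← div_eq_mul_inv, le_div_iff₀ h1]
    nlinarith [norm_nonneg (g u)]

theorem CondA.differentiableAt_mellin {ε : ℝ} (hε : 0 < ε) {g : ℝ → ℂ} (hA : CondA ε g) {s : ℂ}
    (h1 : -ε < s.re) (h2 : s.re < 1 + ε) : DifferentiableAt ℂ (mellin g) s := by
  obtain ⟨C, hC0, hC⟩ := hA.exists_bound
  have hloc : LocallyIntegrableOn g (Ioi 0) := by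
    have h := hA.mellinConvergent (s := 1) (by simp; linarith) (by simp; linarith)
    have e : (fun t : ℝ => (t : ℂ) ^ ((1 : ℂ) - 1) • g t) = g := by
      funext t; simp
    rw [MellinConvergent, e] at h
    exact h.locallyIntegrableOn
  refine mellin_differentiableAt_of_isBigO_rpow (a := 1 + ε) (b := -ε) hloc ?_ h2 ?_ h1
  · refine Asymptotics.IsBigO.of_bound C ?_
    filter_upwards [eventually_gt_atTop 0] with u hu
    rw [Real.norm_eq_abs, abs_of_pos (Real.rpow_pos_of_pos hu _)]
    exact (CondA.norm_le_rpow hC hu).1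
  · refine Asymptotics.IsBigO.of_bound C ?_
    filter_upwards [self_mem_nhdsWithin] with u hu
    rw [Real.norm_eq_abs, abs_of_pos (Real.rpow_pos_of_pos hu _), neg_neg]
    exact (CondA.norm_le_rpow hC hu).2

/-- Bounded variation makes the Mellin transform `O(1 / |Im s|)`, uniformly in the strip. -/
theorem CondA.exists_norm_mellin_le {ε : ℝ} {g : ℝ → ℂ} (hA : CondA ε g) :
    ∃ C, 0 ≤ C ∧ ∀ s : ℂ, -ε < s.re → s.re < 1 + ε → s.im ≠ 0 → ‖mellin g s‖ ≤ C / |s.im| := by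
  obtain ⟨V, hV0, hV⟩ := hA.exists_variation_logProfile_le
  refine ⟨2 * V, by positivity, fun s h1 h2 h3 => ?_⟩
  have h3' : 0 < |s.im| := abs_pos.2 h3
  have hbd := (hV s.re h1.le h2.le)
  rw [mellin_eq_integral_logProfile]
  have hI : Integrable fun x : ℝ => logProfile g s.re x * Complex.exp (s.im * x * Complex.I) := by
    refine (hA.integrable_logProfile h1 h2).mul_bdd (c := 1) (by fun_prop)
      (Eventually.of_forall fun x => ?_)
    rw [← Complex.ofReal_mul, Complex.norm_exp_ofReal_mul_I]
  refine (norm_integral_univ_mul_le_variation (M := 2 / |s.im|) hbd.1 (by fun_prop)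
    (hA.tendsto_logProfile_atTop h2) hI fun a x _ => ?_).trans ?_
  · have e : ∀ t : ℝ, Complex.exp (s.im * t * Complex.I) = Complex.exp (s.im * Complex.I * t) := by
      intro t; congr 1; ring
    simp_rw [e]
    rw [integral_exp_mul_complex (by simp [h3]), norm_div, norm_mul, Complex.norm_real,
      Complex.norm_I, mul_one, Real.norm_eq_abs]
    gcongr
    refine (norm_sub_le _ _).trans (le_of_eq ?_)
    simp_rw [← e]
    rw [← Complex.ofReal_mul, ← Complex.ofReal_mul, Complex.norm_exp_ofReal_mul_I,
      Complex.norm_exp_ofReal_mul_I]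
    norm_num
  · rw [div_mul_eq_mul_div]
    gcongr
    exact hbd.2

/-- Condition `CondB` passes to the profiles. -/
theorem rightLim_logProfile_add_leftLim {ε : ℝ} {g : ℝ → ℂ} (hA : CondA ε g)
    (hB : CondB g) {σ : ℝ} (h1 : -ε ≤ σ) (h2 : σ ≤ 1 + ε) (x : ℝ) :
    Function.rightLim (logProfile g σ) x + Function.leftLim (logProfile g σ) x =
      2 * logProfile g σ x := by
  obtain ⟨V, -, hV⟩ := hA.exists_variation_logProfile_le
  have hbv := (hV σ h1 h2).1
  set y := Real.exp x with hy
  have hy0 : 0 < y := Real.exp_pos x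
  have hlogy : Real.log y = x := Real.log_exp x
  have hE : (Real.exp (σ * x) : ℂ) ≠ 0 := by exact_mod_cast (Real.exp_pos _).ne'
  have hg : ∀ u, 0 < u →
      logProfile g σ (Real.log u) * (Real.exp (-(σ * Real.log u)) : ℂ) = g u := by
    intro u hu
    rw [logProfile, Real.exp_log hu, mul_assoc, ← Complex.ofReal_mul, ← Real.exp_add]
    simp
  have hc : Tendsto (fun u : ℝ => (Real.exp (-(σ * Real.log u)) : ℂ)) (𝓝 y)
      (𝓝 (Real.exp (-(σ * x)) : ℂ)) := by
    have : ContinuousAt (fun u : ℝ => (Real.exp (-(σ * Real.log u)) : ℂ)) y := by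
      have := Real.continuousAt_log hy0.ne'
      fun_prop
    have h := this.tendsto
    rwa [hlogy] at h
  have hlog : Tendsto Real.log (𝓝 y) (𝓝 x) := by
    have := (Real.continuousAt_log hy0.ne').tendsto
    rwa [hlogy] at this
  have hpos : ∀ᶠ u in 𝓝 y, 0 < u := lt_mem_nhds hy0
  have hR : Tendsto g (𝓝[>] y)
      (𝓝 (Function.rightLim (logProfile g σ) x * (Real.exp (-(σ * x)) : ℂ))) := by
    have h3 : Tendsto Real.log (𝓝[>] y) (𝓝[>] x) := by
      refine tendsto_nhdsWithin_iff.2 ⟨hlog.mono_left nhdsWithin_le_nhds, ?_⟩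
      filter_upwards [self_mem_nhdsWithin] with u hu
      rw [← hlogy]
      exact Real.log_lt_log hy0 hu
    refine (((hbv.tendsto_rightLim x).comp h3).mul
      (hc.mono_left nhdsWithin_le_nhds)).congr' ?_
    filter_upwards [nhdsWithin_le_nhds hpos] with u hu using hg u hu
  have hL : Tendsto g (𝓝[<] y)
      (𝓝 (Function.leftLim (logProfile g σ) x * (Real.exp (-(σ * x)) : ℂ))) := by
    have h3 : Tendsto Real.log (𝓝[<] y) (𝓝[<] x) := by
      refine tendsto_nhdsWithin_iff.2 ⟨hlog.mono_left nhdsWithin_le_nhds, ?_⟩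
      filter_upwards [self_mem_nhdsWithin, nhdsWithin_le_nhds hpos] with u hu hu0
      rw [← hlogy]
      exact Real.log_lt_log hu0 hu
    refine (((hbv.tendsto_leftLim x).comp h3).mul
      (hc.mono_left nhdsWithin_le_nhds)).congr' ?_
    filter_upwards [nhdsWithin_le_nhds hpos] with u hu using hg u hu
  have h := hB y hy0
  rw [rightLim_eq_of_tendsto hR, leftLim_eq_of_tendsto hL, ← add_mul] at h
  have hcancel : (Real.exp (-(σ * x)) : ℂ) * (Real.exp (σ * x) : ℂ) = 1 := by
    rw [← Complex.ofReal_mul, ← Real.exp_add]; simp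
  rw [logProfile, ← hy]
  linear_combination (Real.exp (σ * x) : ℂ) * h - (Function.rightLim (logProfile g σ) x +
    Function.leftLim (logProfile g σ) x) * hcancel

/-- A truncated inverse Mellin integral is an integral of the profile against the Dirichlet
kernel. -/
theorem CondA.segmentIntegral_mellin {ε : ℝ} {g : ℝ → ℂ} (hA : CondA ε g) {σ : ℝ}
    (h1 : -ε < σ) (h2 : σ < 1 + ε) {y : ℝ} (hy : 0 < y) (T : ℝ) :
    segmentIntegral (fun s => (y : ℂ) ^ (-s) * mellin g s) σ T =
      (y ^ (-σ) : ℝ) * (1 / Real.pi *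
        ∫ x, logProfile g σ x * dirichletKernel T (x - Real.log y)) := by
  have hF := integral_partial_fourier (hA.integrable_logProfile h1 h2) (Real.log y) T
  have e : ∀ t : ℝ, (y : ℂ) ^ (-((σ : ℂ) + t * Complex.I)) * mellin g (σ + t * Complex.I) *
      Complex.I = ((y ^ (-σ) : ℝ) * Complex.I : ℂ) *
        (Complex.exp (-(t * (Real.log y : ℝ)) * Complex.I) *
          ∫ x, logProfile g σ x * Complex.exp (t * x * Complex.I)) := by
    intro t
    rw [mellin_eq_integral_logProfile]
    have h3 : ((σ : ℂ) + t * Complex.I).re = σ := by simp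
    have h4 : ((σ : ℂ) + t * Complex.I).im = t := by simp
    rw [h3, h4]
    have h5 : (y : ℂ) ^ (-((σ : ℂ) + t * Complex.I)) =
        (y ^ (-σ) : ℝ) * Complex.exp (-(t * (Real.log y : ℝ)) * Complex.I) := by
      rw [neg_add, Complex.cpow_add _ _ (by exact_mod_cast hy.ne'), Complex.ofReal_cpow hy.le]
      congr 1
      · push_cast; rfl
      · rw [Complex.cpow_def_of_ne_zero (by exact_mod_cast hy.ne'), ← Complex.ofReal_log hy.le]
        congr 1
        ring
    rw [h5]
    ring
  rw [segmentIntegral]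
  simp_rw [e]
  rw [intervalIntegral.integral_const_mul, hF]
  have hpi : (Real.pi : ℂ) ≠ 0 := by exact_mod_cast Real.pi_ne_zero
  field_simp

/-- Pointwise **Mellin inversion** in the principal value sense. -/
theorem CondA.tendsto_segmentIntegral_mellin {ε : ℝ} {g : ℝ → ℂ} (hA : CondA ε g)
    (hB : CondB g) {σ : ℝ} (h1 : -ε < σ) (h2 : σ < 1 + ε) {y : ℝ} (hy : 0 < y) :
    Tendsto (fun T => segmentIntegral (fun s => (y : ℂ) ^ (-s) * mellin g s) σ T) atTop
      (𝓝 (g y)) := by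
  obtain ⟨V, -, hV⟩ := hA.exists_variation_logProfile_le
  simp_rw [hA.segmentIntegral_mellin h1 h2 hy]
  have h := ((tendsto_integral_mul_dirichletKernel (hV σ h1.le h2.le).1
    (hA.integrable_logProfile h1 h2) (hA.tendsto_logProfile_atTop h2)
    (hA.tendsto_logProfile_atBot h1)
    (rightLim_logProfile_add_leftLim hA hB h1.le h2.le (Real.log y))).const_mul
      (1 / Real.pi : ℂ)).const_mul ((y ^ (-σ) : ℝ) : ℂ)
  have e : ((y ^ (-σ) : ℝ) : ℂ) * (1 / Real.pi * (Real.pi * logProfile g σ (Real.log y))) =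
      g y := by
    have hpi : (Real.pi : ℂ) ≠ 0 := by exact_mod_cast Real.pi_ne_zero
    have h3 : Real.exp (σ * Real.log y) = y ^ σ := by
      rw [Real.rpow_def_of_pos hy]; ring_nf
    have h4 : ((y ^ (-σ) : ℝ) : ℂ) * ((y ^ σ : ℝ) : ℂ) = 1 := by
      rw [← Complex.ofReal_mul, ← Real.rpow_add hy]; simp
    rw [logProfile, Real.exp_log hy, h3]
    field_simp
    linear_combination (g y) * h4
  rwa [e] at h

/-- A bound for the truncated inverse Mellin integrals, uniform in the height `T`. It allows limits
to be taken termwise in the Dirichlet series of the logarithmic derivative of `ζ`. -/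
theorem CondA.exists_norm_segmentIntegral_mellin_le {ε : ℝ} {g : ℝ → ℂ} (hA : CondA ε g) :
    ∃ C, 0 ≤ C ∧ ∀ σ : ℝ, -ε < σ → σ < 1 + ε → ∀ y : ℝ, 0 < y → ∀ T : ℝ, 0 ≤ T →
      ‖segmentIntegral (fun s => (y : ℂ) ^ (-s) * mellin g s) σ T‖ ≤ C * y ^ (-σ) := by
  obtain ⟨V, hV0, hV⟩ := hA.exists_variation_logProfile_le
  refine ⟨1 / Real.pi * (6 * V), by have := Real.pi_pos; positivity, fun σ h1 h2 y hy T hT => ?_⟩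
  rw [hA.segmentIntegral_mellin h1 h2 hy, norm_mul, norm_mul, Complex.norm_real, Real.norm_eq_abs,
    abs_of_pos (Real.rpow_pos_of_pos hy _), mul_comm]
  have hpi : ‖(1 / Real.pi : ℂ)‖ = 1 / Real.pi := by
    rw [norm_div, norm_one, Complex.norm_real, Real.norm_eq_abs, abs_of_pos Real.pi_pos]
  have := Real.pi_pos
  rw [hpi]
  gcongr
  refine (norm_integral_mul_dirichletKernel_le (hV σ h1.le h2.le).1
    (hA.integrable_logProfile h1 h2) (hA.tendsto_logProfile_atTop h2) _ hT).trans ?_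
  gcongr
  exact (hV σ h1.le h2.le).2

/-! ### The transpose -/

theorem CondA.transpose {ε : ℝ} {g : ℝ → ℂ} (hA : CondA ε g) : CondA ε (transpose g) := by
  have h := eVariationOn.comp_le_of_antitoneOn (fun u : ℝ => g u * (weight ε u : ℂ)) (s := Ioi 0)
    (t := Ioi 0) (fun u => 1 / u) (fun a ha b _ hab => one_div_le_one_div_of_le ha hab)
    (fun u hu => mem_Ioi.2 (one_div_pos.2 (mem_Ioi.1 hu)))
  refine ne_top_of_le_ne_top hA (le_trans (le_of_eq (eVariationOn.congr fun u hu => ?_)) h)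
  have hu0 : 0 < u := hu
  have hw : weight ε (1 / u) = 1 / u * weight ε u := by
    unfold weight
    rw [one_div, Real.inv_rpow hu0.le, Real.inv_rpow hu0.le, ← Real.rpow_neg hu0.le,
      ← Real.rpow_neg hu0.le, mul_add, ← Real.rpow_neg_one, ← Real.rpow_add hu0,
      ← Real.rpow_add hu0, add_comm]
    congr 2 <;> ring
  simp only [ExplicitFormula.transpose, Function.comp_apply, hw]
  push_cast
  ring

theorem CondB.transpose {ε : ℝ} {g : ℝ → ℂ} (hA : CondA ε g) (hε : 0 < ε) (hB : CondB g) :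
    CondB (transpose g) := by
  obtain ⟨V, -, hV⟩ := hA.exists_variation_logProfile_le
  intro u hu
  have hv : 0 < 1 / u := one_div_pos.2 hu
  have hg0 : ∀ v : ℝ, 0 < v → g v = logProfile g 0 (Real.log v) := by
    intro v hv; simp [logProfile, Real.exp_log hv]
  have hbv := (hV 0 (by linarith) (by linarith)).1
  set v := 1 / u with hvdef
  have hlog : Tendsto Real.log (𝓝 v) (𝓝 (Real.log v)) := (Real.continuousAt_log hv.ne').tendsto
  have hR : Tendsto g (𝓝[>] v) (𝓝 (Function.rightLim (logProfile g 0) (Real.log v))) := by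
    have h3 : Tendsto Real.log (𝓝[>] v) (𝓝[>] (Real.log v)) := by
      refine tendsto_nhdsWithin_iff.2 ⟨hlog.mono_left nhdsWithin_le_nhds, ?_⟩
      filter_upwards [self_mem_nhdsWithin] with w hw using Real.log_lt_log hv hw
    refine ((hbv.tendsto_rightLim _).comp h3).congr' ?_
    filter_upwards [nhdsWithin_le_nhds (lt_mem_nhds hv)] with w hw using (hg0 w hw).symm
  have hL : Tendsto g (𝓝[<] v) (𝓝 (Function.leftLim (logProfile g 0) (Real.log v))) := by
    have h3 : Tendsto Real.log (𝓝[<] v) (𝓝[<] (Real.log v)) := by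
      refine tendsto_nhdsWithin_iff.2 ⟨hlog.mono_left nhdsWithin_le_nhds, ?_⟩
      filter_upwards [self_mem_nhdsWithin, nhdsWithin_le_nhds (lt_mem_nhds hv)] with w hw hw0
        using Real.log_lt_log hw0 hw
    refine ((hbv.tendsto_leftLim _).comp h3).congr' ?_
    filter_upwards [nhdsWithin_le_nhds (lt_mem_nhds hv)] with w hw using (hg0 w hw).symm
  have hinv : Tendsto (fun x : ℝ => 1 / x) (𝓝 u) (𝓝 v) := by
    simpa [hvdef] using (continuousAt_inv₀ hu.ne').tendsto
  have hfac : Tendsto (fun x : ℝ => ((1 / x : ℝ) : ℂ)) (𝓝 u) (𝓝 (v : ℂ)) :=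
    (Complex.continuous_ofReal.tendsto _).comp hinv
  have hiR : Tendsto (fun x : ℝ => 1 / x) (𝓝[>] u) (𝓝[<] v) := by
    refine tendsto_nhdsWithin_iff.2 ⟨hinv.mono_left nhdsWithin_le_nhds, ?_⟩
    filter_upwards [self_mem_nhdsWithin] with w hw using one_div_lt_one_div_of_lt hu hw
  have hiL : Tendsto (fun x : ℝ => 1 / x) (𝓝[<] u) (𝓝[>] v) := by
    refine tendsto_nhdsWithin_iff.2 ⟨hinv.mono_left nhdsWithin_le_nhds, ?_⟩
    filter_upwards [self_mem_nhdsWithin, nhdsWithin_le_nhds (lt_mem_nhds hu)] with w hw hw0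
      using one_div_lt_one_div_of_lt hw0 hw
  have h1 : Tendsto (ExplicitFormula.transpose g) (𝓝[>] u) _ :=
    (hfac.mono_left nhdsWithin_le_nhds).mul (hL.comp hiR)
  have h2 : Tendsto (ExplicitFormula.transpose g) (𝓝[<] u) _ :=
    (hfac.mono_left nhdsWithin_le_nhds).mul (hR.comp hiL)
  have h := hB v hv
  rw [rightLim_eq_of_tendsto hR, leftLim_eq_of_tendsto hL] at h
  rw [rightLim_eq_of_tendsto h1, leftLim_eq_of_tendsto h2, ExplicitFormula.transpose]
  linear_combination (v : ℂ) * h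

theorem mellin_transpose (g : ℝ → ℂ) (s : ℂ) : mellin (transpose g) s = mellin g (1 - s) := by
  have e : transpose g = fun t : ℝ => (t : ℂ) ^ (-1 : ℂ) • (fun x => g x⁻¹) t := by
    funext t
    rw [transpose, Complex.cpow_neg_one]
    simp
  rw [e, mellin_cpow_smul, mellin_comp_inv]
  congr 1
  ring

/-! ### The sum over prime powers -/

local notation "Λ" => ArithmeticFunction.vonMangoldt

theorem summable_vonMangoldt_mul_rpow {σ : ℝ} (hσ : 1 < σ) :
    Summable fun n : ℕ => (Λ n : ℝ) * (n : ℝ) ^ (-σ) := by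
  have h := (ArithmeticFunction.LSeriesSummable_vonMangoldt (s := (σ : ℂ)) (by simpa using hσ)).norm
  refine h.congr fun n => ?_
  rw [LSeries.norm_term_eq]
  split_ifs with hn
  · simp [hn]
  · rw [Complex.norm_real, Real.norm_eq_abs, abs_of_nonneg ArithmeticFunction.vonMangoldt_nonneg,
      Complex.ofReal_re, Real.rpow_neg (Nat.cast_nonneg n), div_eq_mul_inv]

theorem CondA.summable_norm_vonMangoldt_mul {ε : ℝ} (hε : 0 < ε) {g : ℝ → ℂ} (hA : CondA ε g) :
    Summable fun n : ℕ => ‖((Λ n : ℝ) : ℂ) * g n‖ := by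
  obtain ⟨C, hC0, hC⟩ := hA.exists_bound
  refine Summable.of_nonneg_of_le (fun _ => norm_nonneg _) (fun n => ?_)
    ((summable_vonMangoldt_mul_rpow (show 1 < 1 + ε by linarith)).mul_left C)
  rcases Nat.eq_zero_or_pos n with rfl | hn
  · simp
  · rw [norm_mul, Complex.norm_real, Real.norm_eq_abs,
      abs_of_nonneg ArithmeticFunction.vonMangoldt_nonneg, mul_left_comm]
    exact mul_le_mul_of_nonneg_left (CondA.norm_le_rpow hC (by exact_mod_cast hn)).1
      ArithmeticFunction.vonMangoldt_nonneg

theorem vonMangoldt_prodNatEquiv (q : Nat.Primes × ℕ) :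
    Λ (Nat.Primes.prodNatEquiv q : ℕ) = Real.log (q.1 : ℕ) := by
  obtain ⟨p, k⟩ := q
  rw [Nat.Primes.prodNatEquiv_apply]
  simp only
  rw [ArithmeticFunction.vonMangoldt_apply_pow (Nat.succ_ne_zero k),
    ArithmeticFunction.vonMangoldt_apply_prime p.2]

theorem vonMangoldt_mul_prodNatEquiv (g : ℝ → ℂ) (q : Nat.Primes × ℕ) :
    ((Λ (Nat.Primes.prodNatEquiv q : ℕ) : ℝ) : ℂ) * g ((Nat.Primes.prodNatEquiv q : ℕ) : ℝ) =
      (Real.log (q.1 : ℕ) : ℂ) * g (((q.1 : ℕ) : ℝ) ^ (q.2 + 1)) := by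
  rw [vonMangoldt_prodNatEquiv]
  congr 2
  obtain ⟨p, k⟩ := q
  rw [Nat.Primes.prodNatEquiv_apply]
  push_cast
  rfl

theorem CondA.primePowerSumConverges {ε : ℝ} (hε : 0 < ε) {g : ℝ → ℂ} (hA : CondA ε g) :
    PrimePowerSumConverges g := by
  have h := (hA.summable_norm_vonMangoldt_mul hε).comp_injective
    (Subtype.val_injective.comp Nat.Primes.prodNatEquiv.injective)
  refine h.congr fun q => ?_
  simp only [Function.comp_apply, vonMangoldt_mul_prodNatEquiv]

theorem CondA.hasSum_localTerm {ε : ℝ} (hε : 0 < ε) {g : ℝ → ℂ} (hA : CondA ε g) :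
    HasSum (fun p : Nat.Primes => localTerm p g) (∑' n : ℕ, ((Λ n : ℝ) : ℂ) * g n) := by
  have hs : Summable fun q : Nat.Primes × ℕ =>
      (Real.log (q.1 : ℕ) : ℂ) * g (((q.1 : ℕ) : ℝ) ^ (q.2 + 1)) :=
    (hA.primePowerSumConverges hε).of_norm
  have h1 : ∑' n : ℕ, ((Λ n : ℝ) : ℂ) * g n = ∑' q : Nat.Primes × ℕ,
      (Real.log (q.1 : ℕ) : ℂ) * g (((q.1 : ℕ) : ℝ) ^ (q.2 + 1)) := by
    simp_rw [← vonMangoldt_mul_prodNatEquiv]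
    rw [Nat.Primes.prodNatEquiv.tsum_eq
      (fun n : {n : ℕ // IsPrimePow n} => ((Λ (n : ℕ) : ℝ) : ℂ) * g ((n : ℕ) : ℝ))]
    symm
    refine tsum_subtype_eq_of_support_subset (s := {n : ℕ | IsPrimePow n})
      (f := fun n : ℕ => ((Λ n : ℝ) : ℂ) * g n) fun n hn => ?_
    by_contra hpp
    exact hn (by simp only [ArithmeticFunction.vonMangoldt_eq_zero_iff.2 hpp]; simp)
  rw [h1]
  have h2 := hs.hasSum.prod_fiberwise fun p => (hs.prod_factor p).hasSum
  refine h2.congr_fun fun p => ?_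
  exact tsum_mul_left.symm

/-- The contribution of `-ζ'/ζ` on a line of absolute convergence: the Dirichlet series is
integrated term by term and Mellin inversion is applied to each term, the bounds on truncated
inverse Mellin integrals dominating the series. -/
theorem CondA.tendsto_segmentIntegral_zeta {ε : ℝ} (hε : 0 < ε) {g : ℝ → ℂ} (hA : CondA ε g)
    (hB : CondB g) {σ : ℝ} (h1 : 1 < σ) (h2 : σ < 1 + ε) :
    Tendsto (fun T => segmentIntegral
      (fun s => -(deriv riemannZeta s / riemannZeta s) * mellin g s) σ T) atTop
      (𝓝 (∑' n : ℕ, ((Λ n : ℝ) : ℂ) * g n)) := by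
  obtain ⟨C, hC0, hC⟩ := hA.exists_norm_segmentIntegral_mellin_le
  have hsum := summable_vonMangoldt_mul_rpow h1
  have hcontm : Continuous fun t : ℝ => mellin g (σ + t * Complex.I) := by
    refine continuous_iff_continuousAt.2 fun t => ?_
    have hd := (hA.differentiableAt_mellin hε (s := σ + t * Complex.I) (by simp; linarith)
      (by simpa using h2)).continuousAt
    exact ContinuousAt.comp (f := fun t : ℝ => (σ : ℂ) + t * Complex.I) hd (by fun_prop)
  have hterm : ∀ T : ℝ, segmentIntegral
      (fun s => -(deriv riemannZeta s / riemannZeta s) * mellin g s) σ T =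
      ∑' n : ℕ, ((Λ n : ℝ) : ℂ) *
        segmentIntegral (fun s => ((n : ℝ) : ℂ) ^ (-s) * mellin g s) σ T := by
    intro T
    obtain ⟨B, hB⟩ := (isCompact_uIcc (a := -T) (b := T)).exists_bound_of_continuousOn
      hcontm.continuousOn
    have hcpow : ∀ n : ℕ, 0 < n → Continuous fun t : ℝ =>
        ((n : ℝ) : ℂ) ^ (-((σ : ℂ) + t * Complex.I)) := fun n hn => by
      have : ((n : ℝ) : ℂ) ≠ 0 := by exact_mod_cast hn.ne'
      exact Continuous.const_cpow (by fun_prop) (Or.inl this)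
    have hS := intervalIntegral.hasSum_integral_of_dominated_convergence (μ := volume) (a := -T)
      (b := T) (F := fun (n : ℕ) (t : ℝ) => ((Λ n : ℝ) : ℂ) *
        (((n : ℝ) : ℂ) ^ (-((σ : ℂ) + t * Complex.I)) * mellin g (σ + t * Complex.I) * Complex.I))
      (f := fun t : ℝ => -(deriv riemannZeta (σ + t * Complex.I) /
        riemannZeta (σ + t * Complex.I)) * mellin g (σ + t * Complex.I) * Complex.I)
      (fun n _ => (Λ n : ℝ) * (n : ℝ) ^ (-σ) * B) ?_ ?_ ?_ ?_ ?_
    · rw [segmentIntegral, ← hS.tsum_eq, ← tsum_mul_left]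
      congr 1; funext n
      rw [segmentIntegral, intervalIntegral.integral_const_mul]
      ring
    · intro n
      rcases Nat.eq_zero_or_pos n with rfl | hn
      · simp only [ArithmeticFunction.map_zero, Complex.ofReal_zero, zero_mul]
        exact aestronglyMeasurable_const
      · exact (continuous_const.mul (((hcpow n hn).mul hcontm).mul
          continuous_const)).aestronglyMeasurable
    · intro n
      refine Eventually.of_forall fun t ht => ?_
      rcases Nat.eq_zero_or_pos n with rfl | hn
      · simp
      · rw [norm_mul, norm_mul, norm_mul, Complex.norm_I, mul_one, Complex.norm_real,
          Real.norm_eq_abs, abs_of_nonneg ArithmeticFunction.vonMangoldt_nonneg, mul_assoc,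
          Complex.norm_cpow_eq_rpow_re_of_pos (by exact_mod_cast hn)]
        have : (-((σ : ℂ) + t * Complex.I)).re = -σ := by simp
        rw [this]
        have hB' := hB t (uIoc_subset_uIcc ht)
        have := ArithmeticFunction.vonMangoldt_nonneg (n := n)
        gcongr
    · exact Eventually.of_forall fun t _ => hsum.mul_right B
    · exact _root_.intervalIntegrable_const
    · refine Eventually.of_forall fun t _ => ?_
      have hs : 1 < ((σ : ℂ) + t * Complex.I).re := by simpa using h1
      have h := (ArithmeticFunction.LSeriesSummable_vonMangoldt hs).LSeriesHasSum
      rw [LSeriesHasSum, ArithmeticFunction.LSeries_vonMangoldt_eq_deriv_riemannZeta_div hs] at h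
      have h' := h.mul_right (mellin g (σ + t * Complex.I) * Complex.I)
      rw [← neg_div, mul_assoc]
      refine h'.congr_fun fun n => ?_
      rw [LSeries.term_def₀ (by simp)]
      push_cast
      ring
  simp_rw [hterm]
  refine tendsto_tsum_of_dominated_convergence (bound := fun n : ℕ => C * ((Λ n : ℝ) *
    (n : ℝ) ^ (-σ))) (hsum.mul_left C) (fun n => ?_) ?_
  · rcases Nat.eq_zero_or_pos n with rfl | hn
    · simp
    · exact (hA.tendsto_segmentIntegral_mellin hB (by linarith) h2
        (by exact_mod_cast hn)).const_mul _
  · filter_upwards [eventually_ge_atTop 0] with T hT n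
    rcases Nat.eq_zero_or_pos n with rfl | hn
    · simp
    · rw [norm_mul, Complex.norm_real, Real.norm_eq_abs,
        abs_of_nonneg ArithmeticFunction.vonMangoldt_nonneg, mul_left_comm]
      exact mul_le_mul_of_nonneg_left (hC σ (by linarith) h2 n (by exact_mod_cast hn) T hT)
        ArithmeticFunction.vonMangoldt_nonneg

/-! ### The logarithmic derivative of the Gamma factor -/

/-- Euler's sequence is dominated by the Gamma function, because `(1 - x / n) ^ n ≤ e ^ (-x)` in its
integral representation. -/
theorem norm_GammaSeq_le {s : ℂ} (hs : 0 < s.re) {n : ℕ} (hn : n ≠ 0) :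
    ‖Complex.GammaSeq s n‖ ≤ Real.Gamma s.re := by
  rw [Complex.GammaSeq_eq_approx_Gamma_integral hs hn, Real.Gamma_eq_integral hs]
  have hI := Real.GammaIntegral_convergent hs
  have hn0 : (0 : ℝ) ≤ n := Nat.cast_nonneg n
  refine (norm_integral_le_of_norm_le (g := fun x => Real.exp (-x) * x ^ (s.re - 1)) hn0
    (Eventually.of_forall fun x hx => ?_) ?_).trans ?_
  · rw [norm_mul, Complex.norm_cpow_eq_rpow_re_of_pos hx.1, Complex.norm_real, Complex.sub_re,
      Complex.one_re, Real.norm_eq_abs, abs_of_nonneg]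
    · have := hx.1
      gcongr
      exact Real.one_sub_div_pow_le_exp_neg hx.2
    · refine pow_nonneg ?_ n
      rw [sub_nonneg]
      exact div_le_one_of_le₀ hx.2 hn0
  · rw [intervalIntegrable_iff_integrableOn_Ioc_of_le hn0]
    exact hI.mono_set Ioc_subset_Ioi_self
  · rw [integral_of_le hn0]
    refine setIntegral_mono_set hI ?_ (Eventually.of_forall Ioc_subset_Ioi_self)
    filter_upwards [ae_restrict_mem measurableSet_Ioi] with x hx
    have : (0 : ℝ) < x := hx
    positivity

theorem add_natCast_ne_zero {s : ℂ} (hs : 0 < s.re) (k : ℕ) : s + k ≠ 0 := by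
  intro h
  have := congrArg Complex.re h
  simp only [Complex.add_re, Complex.natCast_re, Complex.zero_re] at this
  have h2 : (0 : ℝ) ≤ k := Nat.cast_nonneg k
  linarith

theorem differentiableAt_GammaSeq {s : ℂ} (hs : 0 < s.re) {n : ℕ} (hn : n ≠ 0) :
    DifferentiableAt ℂ (fun z => Complex.GammaSeq z n) s := by
  unfold Complex.GammaSeq
  refine DifferentiableAt.div ?_ ?_ (Finset.prod_ne_zero_iff.2 fun k _ => add_natCast_ne_zero hs k)
  · exact (differentiableAt_id.const_cpow (Or.inl (by exact_mod_cast hn))).mul_const _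
  · exact DifferentiableAt.fun_finsetProd fun k _ => by fun_prop

theorem logDeriv_GammaSeq {s : ℂ} (hs : 0 < s.re) {n : ℕ} (hn : n ≠ 0) :
    logDeriv (fun z => Complex.GammaSeq z n) s =
      Real.log n - ∑ k ∈ Finset.range (n + 1), 1 / (s + k) := by
  have hn' : (n : ℂ) ≠ 0 := by exact_mod_cast hn
  unfold Complex.GammaSeq
  rw [logDeriv_div (f := fun z => (n : ℂ) ^ z * (n.factorial : ℂ))
    (g := fun z => ∏ k ∈ Finset.range (n + 1), (z + k))]
  · congr 1
    · rw [logDeriv_mul_const (f := fun z => (n : ℂ) ^ z) _ _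
          (by exact_mod_cast n.factorial_ne_zero),
        logDeriv_apply, (hasDerivAt_id' s).const_cpow (Or.inl hn') |>.deriv]
      have : (n : ℂ) ^ s ≠ 0 := by
        rw [Complex.cpow_ne_zero_iff]; exact Or.inl hn'
      simp only [mul_one]
      rw [mul_div_cancel_left₀ _ this, Complex.natCast_log]
    · rw [logDeriv_prod (f := fun (k : ℕ) (z : ℂ) => z + k)]
      · refine Finset.sum_congr rfl fun k _ => ?_
        rw [logDeriv_apply]
        simp
      · exact fun k _ => add_natCast_ne_zero hs k
      · intro k _; fun_prop
  · refine mul_ne_zero ?_ (by exact_mod_cast n.factorial_ne_zero)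
    rw [Complex.cpow_ne_zero_iff]; exact Or.inl hn'
  · exact Finset.prod_ne_zero_iff.2 fun k _ => add_natCast_ne_zero hs k
  · exact (differentiableAt_id.const_cpow (Or.inl hn')).mul_const _
  · exact DifferentiableAt.fun_finsetProd fun k _ => by fun_prop

/-- The derivatives of Euler's sequence converge to the derivative of `Γ`: apply dominated
convergence to Cauchy's formula on a small circle. -/
theorem tendsto_deriv_GammaSeq {s : ℂ} (hs : 0 < s.re) :
    Tendsto (fun n => deriv (fun z => Complex.GammaSeq z n) s) atTop
      (𝓝 (deriv Complex.Gamma s)) := by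
  set r := s.re / 2 with hr
  have hr0 : 0 < r := by positivity
  have hball : ∀ z ∈ Metric.closedBall s r, r ≤ z.re ∧ z.re ≤ 3 * r := by
    intro z hz
    rw [mem_closedBall_iff_norm] at hz
    have h := (Complex.abs_re_le_norm (z - s)).trans hz
    rw [Complex.sub_re, abs_le] at h
    constructor <;> linarith [h.1, h.2]
  have hcirc : ∀ θ, circleMap s r θ ∈ Metric.closedBall s r := fun θ =>
    circleMap_mem_closedBall s hr0.le θ
  obtain ⟨B, hB⟩ := (isCompact_Icc (a := r) (b := 3 * r)).exists_bound_of_continuousOn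
    (f := Real.Gamma) fun x hx => by
      refine ContinuousAt.continuousWithinAt (Real.differentiableAt_Gamma fun m => ?_).continuousAt
      have : (0 : ℝ) ≤ m := Nat.cast_nonneg m
      linarith [hx.1]
  have key : Tendsto (fun n => ∮ z in C(s, r), (1 / (z - s) ^ 2) • Complex.GammaSeq z n) atTop
      (𝓝 (∮ z in C(s, r), (1 / (z - s) ^ 2) • Complex.Gamma z)) := by
    unfold circleIntegral
    refine intervalIntegral.tendsto_integral_filter_of_dominated_convergence
      (fun _ => r * (1 / r ^ 2 * B)) ?_ ?_ _root_.intervalIntegrable_const ?_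
    · filter_upwards [eventually_ne_atTop 0] with n hn
      have hc : Continuous fun θ => Complex.GammaSeq (circleMap s r θ) n := by
        refine continuous_iff_continuousAt.2 fun θ => ?_
        have h0 : 0 < (circleMap s r θ).re := hr0.trans_le (hball _ (hcirc θ)).1
        exact ContinuousAt.comp (f := circleMap s r) (differentiableAt_GammaSeq h0 hn).continuousAt
          (continuous_circleMap s r).continuousAt
      have hne : ∀ θ, (circleMap s r θ - s) ^ 2 ≠ 0 := fun θ =>
        pow_ne_zero 2 (sub_ne_zero.2 (circleMap_ne_center hr0.ne'))
      have hc2 : Continuous fun θ => 1 / (circleMap s r θ - s) ^ 2 :=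
        continuous_const.div (by fun_prop) hne
      have hc3 : Continuous fun θ => deriv (circleMap s r) θ := by
        simp only [deriv_circleMap]
        fun_prop
      exact (hc3.smul (hc2.smul hc)).aestronglyMeasurable
    · filter_upwards [eventually_ne_atTop 0] with n hn
      refine Eventually.of_forall fun θ _ => ?_
      have hz := hball _ (hcirc θ)
      rw [norm_smul, norm_smul, norm_div, norm_one, norm_pow, deriv_circleMap, norm_mul,
        Complex.norm_I, mul_one, norm_circleMap_zero, circleMap_sub_center, norm_circleMap_zero,
        abs_of_pos hr0]
      gcongr
      refine (norm_GammaSeq_le (hr0.trans_le hz.1) hn).trans ?_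
      exact (le_abs_self _).trans (hB _ hz)
    · refine Eventually.of_forall fun θ _ => ?_
      exact ((Complex.GammaSeq_tendsto_Gamma _).const_smul _).const_smul _
  have h2 : ∮ z in C(s, r), (1 / (z - s) ^ 2) • Complex.Gamma z =
      (2 * Real.pi * Complex.I) • deriv Complex.Gamma s :=
    DifferentiableOn.deriv_eq_smul_circleIntegral hr0 fun z hz =>
      (Complex.differentiableAt_Gamma z fun m h => by
        have := congrArg Complex.re h
        simp only [Complex.neg_re, Complex.natCast_re] at this
        have h0 : (0 : ℝ) ≤ m := Nat.cast_nonneg m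
        linarith [(hball z hz).1]).differentiableWithinAt
  rw [h2] at key
  have h3 : (fun n => ∮ z in C(s, r), (1 / (z - s) ^ 2) • Complex.GammaSeq z n) =ᶠ[atTop]
      fun n => (2 * Real.pi * Complex.I) • deriv (fun z => Complex.GammaSeq z n) s := by
    filter_upwards [eventually_ne_atTop 0] with n hn
    exact DifferentiableOn.deriv_eq_smul_circleIntegral hr0 fun z hz =>
      (differentiableAt_GammaSeq (hr0.trans_le (hball z hz).1) hn).differentiableWithinAt
  have h4 := (key.congr' h3).const_smul ((2 * Real.pi * Complex.I)⁻¹)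
  have hne : (2 * Real.pi * Complex.I : ℂ) ≠ 0 := Complex.two_pi_I_ne_zero
  simpa only [smul_smul, inv_mul_cancel₀ hne, one_smul] using h4

/-- Euler's limit for the digamma function. -/
theorem tendsto_log_sub_sum_inv {s : ℂ} (hs : 0 < s.re) :
    Tendsto (fun n : ℕ => (Real.log n : ℂ) - ∑ k ∈ Finset.range (n + 1), 1 / (s + k)) atTop
      (𝓝 (logDeriv Complex.Gamma s)) := by
  have hne : Complex.Gamma s ≠ 0 := Complex.Gamma_ne_zero_of_re_pos hs
  have h := (tendsto_deriv_GammaSeq hs).div (Complex.GammaSeq_tendsto_Gamma s) hne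
  rw [logDeriv_apply]
  refine h.congr' ?_
  filter_upwards [eventually_ne_atTop 0] with n hn
  rw [← logDeriv_GammaSeq hs hn, logDeriv_apply]
  rfl

theorem abs_log_sub_harmonic_le {n : ℕ} (hn : n ≠ 0) :
    |Real.log n - ∑ k ∈ Finset.range (n + 1), 1 / ((k : ℝ) + 1)| ≤ 2 := by
  have hn1 : (1 : ℝ) ≤ n := by exact_mod_cast Nat.one_le_iff_ne_zero.2 hn
  have e : ∑ k ∈ Finset.range (n + 1), 1 / ((k : ℝ) + 1) = (harmonic (n + 1) : ℝ) := by
    rw [harmonic]; push_cast; simp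
  have h1 := log_add_one_le_harmonic (n + 1)
  have h2 := harmonic_le_one_add_log (n + 1)
  push_cast at h1 h2
  rw [e, abs_le]
  have h3 : Real.log n ≤ Real.log (n + 1 + 1) := Real.log_le_log (by linarith) (by linarith)
  have h4 : Real.log (n + 1) ≤ Real.log n + 1 := by
    have h5 : Real.log ((n + 1) / n) ≤ (n + 1) / n - 1 :=
      Real.log_le_sub_one_of_pos (by positivity)
    rw [Real.log_div (by positivity) (by positivity)] at h5
    have h6 : ((n : ℝ) + 1) / n - 1 ≤ 1 := by
      rw [add_div, div_self (by positivity)]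
      have : 1 / (n : ℝ) ≤ 1 := by rw [div_le_one (by linarith)]; exact hn1
      linarith
    linarith
  constructor <;> linarith

/-- A crude bound for the digamma function in a vertical strip. Any `o(|t|)` serves the explicit
formula, and the exponent `1/2` comes from `|s + k|² ≥ (σ + k) |t|` in Euler's limit. -/
theorem exists_norm_digamma_le {a b : ℝ} (ha : 0 < a) :
    ∃ C, 0 ≤ C ∧ ∀ s : ℂ, a ≤ s.re → s.re ≤ b → 1 / 2 ≤ |s.im| →
      ‖logDeriv Complex.Gamma s‖ ≤ C * Real.sqrt |s.im| := by
  set a' := min a 1 with ha'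
  have ha'0 : 0 < a' := lt_min ha one_pos
  have hsum : Summable fun k : ℕ => 1 / ((k : ℝ) + 1) ^ (3 / 2 : ℝ) := by
    have := (summable_nat_add_iff 1).2 (Real.summable_one_div_nat_rpow.2
      (by norm_num : (1 : ℝ) < 3 / 2))
    simpa using this
  set S := ∑' k : ℕ, 1 / ((k : ℝ) + 1) ^ (3 / 2 : ℝ) with hS
  have hS0 : 0 ≤ S := tsum_nonneg fun k => by positivity
  refine ⟨4 + (2 * |b| + 3) / Real.sqrt a' * S, by positivity, fun s h1 h2 h3 => ?_⟩
  set t := |s.im| with ht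
  have ht0 : 0 < t := by linarith
  have hs : 0 < s.re := ha.trans_le h1
  refine le_of_tendsto (tendsto_log_sub_sum_inv hs).norm ?_
  filter_upwards [eventually_ne_atTop 0] with n hn
  -- Compare with the value at `s = 1`, which is bounded; the difference converges absolutely.
  have e : (Real.log n : ℂ) - ∑ k ∈ Finset.range (n + 1), 1 / (s + k) =
      ((Real.log n - ∑ k ∈ Finset.range (n + 1), 1 / ((k : ℝ) + 1) : ℝ) : ℂ) +
      ∑ k ∈ Finset.range (n + 1), (s - 1) / (((k : ℂ) + 1) * (s + k)) := by
    push_cast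
    rw [sub_add, sub_right_inj, ← Finset.sum_sub_distrib]
    refine Finset.sum_congr rfl fun k _ => ?_
    have hk1 : (k : ℂ) + 1 ≠ 0 := by exact_mod_cast Nat.succ_ne_zero k
    have hk2 := add_natCast_ne_zero hs k
    field_simp
    ring
  rw [e]
  refine (norm_add_le _ _).trans ?_
  rw [Complex.norm_real, Real.norm_eq_abs]
  have hsm1 : ‖s - 1‖ ≤ (2 * |b| + 3) * t := by
    refine (Complex.norm_le_abs_re_add_abs_im _).trans ?_
    rw [Complex.sub_re, Complex.sub_im, Complex.one_re, Complex.one_im, sub_zero]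
    have : |s.re - 1| ≤ |b| + 1 := by
      rw [abs_le]; constructor <;> linarith [le_abs_self b, abs_nonneg b]
    nlinarith [abs_nonneg b]
  have hterm : ∀ k ∈ Finset.range (n + 1), ‖(s - 1) / (((k : ℂ) + 1) * (s + k))‖ ≤
      (2 * |b| + 3) / Real.sqrt a' * Real.sqrt t * (1 / ((k : ℝ) + 1) ^ (3 / 2 : ℝ)) := by
    intro k _
    have hk0 : (0 : ℝ) < (k : ℝ) + 1 := by positivity
    have hden : Real.sqrt (a' * (k + 1) * t) ≤ ‖s + k‖ := by
      refine Real.sqrt_le_iff.2 ⟨norm_nonneg _, ?_⟩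
      rw [Complex.sq_norm, Complex.normSq_apply]
      simp only [Complex.add_re, Complex.natCast_re, Complex.add_im, Complex.natCast_im, add_zero]
      have h5 : s.im * s.im = t * t := (abs_mul_abs_self s.im).symm
      have hk : (0 : ℝ) ≤ k := Nat.cast_nonneg k
      have h6 : a' * (k + 1) ≤ s.re + k := by
        have : a' ≤ 1 := min_le_right _ _
        have : a' ≤ a := min_le_left _ _
        nlinarith
      have h7 : 0 ≤ a' * (k + 1) := by positivity
      rw [h5]
      nlinarith [sq_nonneg (s.re + k - t), mul_le_mul_of_nonneg_right h6 ht0.le]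
    have hq : 0 < Real.sqrt (a' * (k + 1) * t) := Real.sqrt_pos.2 (by positivity)
    rw [norm_div, norm_mul]
    have hk : ‖(k : ℂ) + 1‖ = (k : ℝ) + 1 := by
      have : (k : ℂ) + 1 = (((k : ℝ) + 1 : ℝ) : ℂ) := by push_cast; rfl
      rw [this, Complex.norm_real, Real.norm_eq_abs, abs_of_pos hk0]
    rw [hk]
    calc ‖s - 1‖ / ((k + 1) * ‖s + k‖)
        ≤ (2 * |b| + 3) * t / ((k + 1) * Real.sqrt (a' * (k + 1) * t)) := by gcongr
      _ = (2 * |b| + 3) / Real.sqrt a' * Real.sqrt t * (1 / ((k : ℝ) + 1) ^ (3 / 2 : ℝ)) := by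
          rw [Real.sqrt_mul (by positivity), Real.sqrt_mul (by positivity)]
          have h8 : ((k : ℝ) + 1) ^ (3 / 2 : ℝ) = (k + 1) * Real.sqrt (k + 1) := by
            rw [Real.sqrt_eq_rpow, show (3 / 2 : ℝ) = 1 + 1 / 2 by norm_num,
              Real.rpow_add hk0, Real.rpow_one]
          rw [h8]
          have h9 : t = Real.sqrt t * Real.sqrt t := (Real.mul_self_sqrt ht0.le).symm
          have h10 : 0 < Real.sqrt t := Real.sqrt_pos.2 ht0
          have h11 : 0 < Real.sqrt a' := Real.sqrt_pos.2 ha'0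
          have h12 : 0 < Real.sqrt ((k : ℝ) + 1) := Real.sqrt_pos.2 hk0
          field_simp
          rw [sq]
          exact h9
  have hfin : ‖∑ k ∈ Finset.range (n + 1), (s - 1) / (((k : ℂ) + 1) * (s + k))‖ ≤
      (2 * |b| + 3) / Real.sqrt a' * Real.sqrt t * S := by
    refine (norm_sum_le _ _).trans ((Finset.sum_le_sum hterm).trans ?_)
    rw [← Finset.mul_sum]
    gcongr
    exact hsum.sum_le_tsum _ fun k _ => by positivity
  have h20 : 2 ≤ 4 * Real.sqrt t := by
    have : Real.sqrt (1 / 4) ≤ Real.sqrt t := Real.sqrt_le_sqrt (by linarith)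
    rw [show (1 / 4 : ℝ) = (1 / 2) ^ 2 by norm_num, Real.sqrt_sq (by norm_num)] at this
    linarith
  have := abs_log_sub_harmonic_le hn
  calc _ ≤ 4 * Real.sqrt t + (2 * |b| + 3) / Real.sqrt a' * Real.sqrt t * S := by linarith
    _ = _ := by ring

theorem differentiableAt_Gammaℝ {s : ℂ} (hs : 0 < s.re) : DifferentiableAt ℂ Complex.Gammaℝ s := by
  have h : Complex.Gammaℝ = fun z => ((Complex.Gammaℝ z)⁻¹)⁻¹ := by funext z; rw [inv_inv]
  rw [h]
  exact (Complex.differentiable_Gammaℝ_inv s).inv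
    (inv_ne_zero (Complex.Gammaℝ_ne_zero_of_re_pos hs))

theorem exists_norm_logDeriv_Gammaℝ_le {a b : ℝ} (ha : 0 < a) :
    ∃ C, 0 ≤ C ∧ ∀ s : ℂ, a ≤ s.re → s.re ≤ b → 1 ≤ |s.im| →
      ‖logDeriv Complex.Gammaℝ s‖ ≤ C * Real.sqrt |s.im| := by
  obtain ⟨C, hC0, hC⟩ := exists_norm_digamma_le (a := a / 2) (b := b / 2) (by positivity)
  refine ⟨|Real.log Real.pi| + C, by positivity, fun s h1 h2 h3 => ?_⟩
  have hs : 0 < s.re := ha.trans_le h1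
  have hs2 : 0 < (s / 2).re := by simpa using by positivity
  have hpi : (Real.pi : ℂ) ≠ 0 := by exact_mod_cast Real.pi_ne_zero
  have hG : DifferentiableAt ℂ Complex.Gamma (s / 2) :=
    Complex.differentiableAt_Gamma _ fun m h => by
      have := congrArg Complex.re h
      simp only [Complex.neg_re, Complex.natCast_re] at this
      have h0 : (0 : ℝ) ≤ m := Nat.cast_nonneg m
      linarith
  have e : logDeriv Complex.Gammaℝ s =
      -(Real.log Real.pi : ℂ) / 2 + logDeriv Complex.Gamma (s / 2) / 2 := by
    have h : Complex.Gammaℝ = fun z =>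
        (Real.pi : ℂ) ^ (-z / 2) * (Complex.Gamma ∘ fun z => z / 2) z := rfl
    have hd1 : HasDerivAt (fun z : ℂ => (Real.pi : ℂ) ^ (-z / 2))
        ((Real.pi : ℂ) ^ (-s / 2) * Complex.log Real.pi * (-1 / 2)) s :=
      (((hasDerivAt_id s).neg).div_const 2).const_cpow (Or.inl hpi)
    have hne : (Real.pi : ℂ) ^ (-s / 2) ≠ 0 := by
      rw [Complex.cpow_ne_zero_iff]; exact Or.inl hpi
    rw [h, logDeriv_mul (f := fun z : ℂ => (Real.pi : ℂ) ^ (-z / 2)),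
      logDeriv_comp (f := Complex.Gamma) (g := fun z : ℂ => z / 2) hG (by fun_prop),
      logDeriv_apply, hd1.deriv]
    · congr 1
      · rw [Complex.ofReal_log Real.pi_pos.le]
        field_simp
      · have hd2 : deriv (fun z : ℂ => z / 2) s = 1 / 2 := by
          rw [deriv_div_const]; simp
        rw [hd2]; ring
    · exact hne
    · exact Complex.Gamma_ne_zero_of_re_pos hs2
    · exact hd1.differentiableAt
    · exact hG.comp s (by fun_prop)
  have him : (s / 2).im = s.im / 2 := by simp
  have him' : |(s / 2).im| = |s.im| / 2 := by rw [him, abs_div]; norm_num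
  have h5 := hC (s / 2) (by simp; linarith) (by simp; linarith) (by rw [him']; linarith)
  have h6 : Real.sqrt |(s / 2).im| ≤ Real.sqrt |s.im| :=
    Real.sqrt_le_sqrt (by rw [him']; linarith)
  have h7 : 1 ≤ Real.sqrt |s.im| := Real.one_le_sqrt.2 h3
  rw [e]
  refine (norm_add_le _ _).trans ?_
  rw [norm_div, norm_div, norm_neg, Complex.norm_real, Real.norm_eq_abs,
    show ‖(2 : ℂ)‖ = 2 by simp]
  have h8 : ‖logDeriv Complex.Gamma (s / 2)‖ ≤ C * Real.sqrt |s.im| :=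
    h5.trans (mul_le_mul_of_nonneg_left h6 hC0)
  have h9 : |Real.log Real.pi| ≤ |Real.log Real.pi| * Real.sqrt |s.im| :=
    le_mul_of_one_le_right (abs_nonneg _) h7
  have := norm_nonneg (logDeriv Complex.Gamma (s / 2))
  have := abs_nonneg (Real.log Real.pi)
  rw [add_mul]
  linarith

/-! ### Zeros of entire functions -/

/-- A zero of an entire function can be divided out, with an entire quotient. -/
theorem exists_eq_pow_mul_of_analyticOrderAt_eq {m : ℕ} {ρ : ℂ} {f : ℂ → ℂ}
    (hf : Differentiable ℂ f) (hm : analyticOrderAt f ρ = m) :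
    ∃ E : ℂ → ℂ, Differentiable ℂ E ∧ E ρ ≠ 0 ∧ ∀ z, f z = (z - ρ) ^ m * E z := by
  induction m generalizing f with
  | zero =>
    refine ⟨f, hf, ?_, by simp⟩
    exact ((hf.analyticAt ρ).analyticOrderAt_eq_zero).1 (by simp [hm])
  | succ m ih =>
    have h0 : f ρ = 0 := apply_eq_zero_of_analyticOrderAt_ne_zero (by rw [hm]; simp)
    have hg : Differentiable ℂ (dslope f ρ) := by
      rw [← differentiableOn_univ]
      exact (Complex.differentiableOn_dslope (by simp)).2 hf.differentiableOn
    have hfg : ∀ z, f z = (z - ρ) * dslope f ρ z := by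
      intro z
      have := sub_smul_dslope f ρ z
      rw [h0, sub_zero, smul_eq_mul] at this
      exact this.symm
    have hord : analyticOrderAt (dslope f ρ) ρ = m := by
      have e : f = (fun z => z - ρ) * dslope f ρ := funext hfg
      have h1 : analyticOrderAt (fun z : ℂ => z - ρ) ρ = 1 := by
        have := analyticOrderAt_centeredMonomial (𝕜 := ℂ) (z₀ := ρ) (n := 1)
        rwa [pow_one, Nat.cast_one] at this
      rw [e, analyticOrderAt_mul (by fun_prop) (hg.analyticAt ρ), h1] at hm
      push_cast at hm
      rw [add_comm] at hm
      exact ENat.add_left_injective_of_ne_top (n := 1) (by simp) hm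
    obtain ⟨E, hE, hE0, hEe⟩ := ih hg hord
    exact ⟨E, hE, hE0, fun z => by rw [hfg, hEe]; ring⟩

/-- Zeros of an entire function at finitely many prescribed points can be divided out. -/
theorem exists_eq_prod_pow_mul {f : ℂ → ℂ} (hf : Differentiable ℂ f)
    (hfin : ∀ z, analyticOrderAt f z ≠ ⊤) (S : Finset ℂ) :
    ∃ E : ℂ → ℂ, Differentiable ℂ E ∧ (∀ ρ ∈ S, E ρ ≠ 0) ∧
      ∀ z, f z = (∏ ρ ∈ S, (z - ρ) ^ analyticOrderNatAt f ρ) * E z := by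
  classical
  induction S using Finset.induction_on with
  | empty => exact ⟨f, hf, by simp, by simp⟩
  | insert a S ha ih =>
    obtain ⟨E, hE, hE0, hEe⟩ := ih
    have hP : AnalyticAt ℂ (fun z => ∏ ρ ∈ S, (z - ρ) ^ analyticOrderNatAt f ρ) a := by
      have : Differentiable ℂ (fun z : ℂ => ∏ ρ ∈ S, (z - ρ) ^ analyticOrderNatAt f ρ) := by
        fun_prop
      exact this.analyticAt a
    have hP0 : analyticOrderAt (fun z => ∏ ρ ∈ S, (z - ρ) ^ analyticOrderNatAt f ρ) a = 0 := by
      rw [hP.analyticOrderAt_eq_zero]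
      refine Finset.prod_ne_zero_iff.2 fun ρ hρ => pow_ne_zero _ (sub_ne_zero.2 ?_)
      rintro rfl; exact ha hρ
    have e : f = (fun z => ∏ ρ ∈ S, (z - ρ) ^ analyticOrderNatAt f ρ) * E := funext hEe
    have hord : analyticOrderAt E a = (analyticOrderNatAt f a : ℕ) := by
      rw [Nat.cast_analyticOrderNatAt (hfin a)]
      conv_rhs => rw [e]
      rw [analyticOrderAt_mul hP (hE.analyticAt a), hP0, zero_add]
    obtain ⟨G, hG, hG0, hGe⟩ := exists_eq_pow_mul_of_analyticOrderAt_eq hE hord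
    refine ⟨G, hG, ?_, ?_⟩
    · intro ρ hρ
      rcases Finset.mem_insert.1 hρ with rfl | h
      · exact hG0
      · intro h0
        exact hE0 ρ h (by rw [hGe, h0, mul_zero])
    · intro z
      rw [Finset.prod_insert ha, hEe, hGe]
      ring

theorem analyticOrderAt_ne_top_of_exists_ne_zero {f : ℂ → ℂ} (hf : Differentiable ℂ f) {c : ℂ}
    (hc : f c ≠ 0) (z : ℂ) : analyticOrderAt f z ≠ ⊤ := by
  intro h
  rw [analyticOrderAt_eq_top] at h
  have hfa : AnalyticOnNhd ℂ f univ := fun z _ => hf.analyticAt z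
  exact hc (hfa.eqOn_zero_of_preconnected_of_eventuallyEq_zero isPreconnected_univ
    (mem_univ z) h (mem_univ c))

theorem finite_zeros_of_isCompact {f : ℂ → ℂ} (hf : Differentiable ℂ f) {c : ℂ}
    (hc : f c ≠ 0) {K : Set ℂ} (hK : IsCompact K) : {z | z ∈ K ∧ f z = 0}.Finite := by
  by_contra h
  obtain ⟨z, hz, hacc⟩ := Set.Infinite.exists_accPt_of_subset_isCompact h hK (fun z hz => hz.1)
  have hfa : AnalyticOnNhd ℂ f univ := fun z _ => hf.analyticAt z
  have hfr : ∃ᶠ w in 𝓝[≠] z, f w = 0 := by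
    rw [accPt_iff_frequently_nhdsNE] at hacc
    exact hacc.mono fun w hw => hw.2
  exact hc (hfa.eqOn_zero_of_preconnected_of_frequently_eq_zero isPreconnected_univ
    (mem_univ z) hfr (mem_univ c))

theorem logDeriv_eq_sum_add_logDeriv {f E : ℂ → ℂ} {S : Finset ℂ} {m : ℂ → ℕ}
    (hE : Differentiable ℂ E) (h : ∀ z, f z = (∏ ρ ∈ S, (z - ρ) ^ m ρ) * E z) {s : ℂ}
    (hS : s ∉ S) (hs : E s ≠ 0) :
    logDeriv f s = ∑ ρ ∈ S, (m ρ : ℂ) / (s - ρ) + logDeriv E s := by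
  have hne : ∀ ρ ∈ S, s - ρ ≠ 0 := fun ρ hρ h0 => hS (by rwa [sub_eq_zero.1 h0])
  have e : f = fun z => (∏ ρ ∈ S, (z - ρ) ^ m ρ) * E z := funext h
  rw [e, logDeriv_mul (f := fun z => ∏ ρ ∈ S, (z - ρ) ^ m ρ) s
    (Finset.prod_ne_zero_iff.2 fun ρ hρ => pow_ne_zero _ (hne ρ hρ)) hs (by fun_prop) (hE s)]
  congr 1
  rw [logDeriv_prod (f := fun (ρ : ℂ) (z : ℂ) => (z - ρ) ^ m ρ)]
  · refine Finset.sum_congr rfl fun ρ hρ => ?_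
    rw [logDeriv_fun_pow (f := fun z : ℂ => z - ρ) (by fun_prop), logDeriv_apply]
    simp [div_eq_mul_inv]
  · exact fun ρ hρ => pow_ne_zero _ (hne ρ hρ)
  · exact fun ρ hρ => by fun_prop

/-- Jensen's bound for the number of zeros, counted with multiplicity. -/
theorem sum_analyticOrderNatAt_le {f : ℂ → ℂ} (hf : Differentiable ℂ f) {c : ℂ} (hc : f c ≠ 0)
    {R₁ R M : ℝ} (hR₁ : 0 < R₁) (hR : R₁ < R) (hM1 : 1 ≤ M)
    (hM : ∀ z ∈ Metric.closedBall c R, ‖f z‖ ≤ M) {S : Finset ℂ}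
    (hS : ∀ ρ ∈ S, ρ ∈ Metric.closedBall c R₁) :
    (∑ ρ ∈ S, (analyticOrderNatAt f ρ : ℝ)) ≤ Real.log (M / ‖f c‖) / Real.log (R / R₁) := by
  classical
  have hR0 : 0 < R := hR₁.trans hR
  have hfa : AnalyticOnNhd ℂ f (Metric.closedBall c |R|) := fun z _ => hf.analyticAt z
  have hJ := hfa.sum_divisor_le (r := R₁) (R := R) (by rwa [abs_of_pos hR₁])
    (by rwa [abs_of_pos hR₁, abs_of_pos hR0]) hM1 hc
    (fun z hz => hM z (by rw [abs_of_pos hR0] at hz; exact Metric.sphere_subset_closedBall hz))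
  refine le_trans ?_ hJ
  set D := MeromorphicOn.divisor f (Metric.closedBall c |R₁|) with hD
  have hDv : ∀ u ∈ Metric.closedBall c R₁, D u = analyticOrderNatAt f u := by
    intro u hu
    rw [hD, MeromorphicOn.divisor_apply (fun z _ => (hf.analyticAt z).meromorphicAt)
      (by rwa [abs_of_pos hR₁]), (hf.analyticAt u).meromorphicOrderAt_eq,
      ← Nat.cast_analyticOrderNatAt (analyticOrderAt_ne_top_of_exists_ne_zero hf hc u)]
    rfl
  have hD0 : ∀ u, 0 ≤ D u := by
    intro u
    by_cases hu : u ∈ Metric.closedBall c R₁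
    · rw [hDv u hu]; positivity
    · rw [Function.locallyFinsuppWithin.apply_eq_zero_of_notMem _ (by rwa [abs_of_pos hR₁])]
  have hfin : (Function.support D).Finite := D.finiteSupport (isCompact_closedBall _ _)
  rw [finsum_eq_sum_of_support_subset (s := hfin.toFinset ∪ S) _
    (by intro u hu; simp only [Finset.coe_union, Finite.coe_toFinset]; exact Or.inl hu)]
  push_cast
  calc (∑ ρ ∈ S, (analyticOrderNatAt f ρ : ℝ)) = ∑ ρ ∈ S, ((D ρ : ℤ) : ℝ) :=
        Finset.sum_congr rfl fun ρ hρ => by rw [hDv ρ (hS ρ hρ)]; simp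
    _ ≤ _ := Finset.sum_le_sum_of_subset_of_nonneg Finset.subset_union_right
        fun u _ _ => by exact_mod_cast hD0 u

/-- A holomorphic function without zeros on a disc has a logarithm there. -/
theorem exists_hasDerivAt_logDeriv_of_ne_zero {E : ℂ → ℂ} (hE : Differentiable ℂ E) {c : ℂ}
    {R : ℝ} (h0 : ∀ z ∈ Metric.ball c R, E z ≠ 0) (hR : 0 < R) :
    ∃ L : ℂ → ℂ, L c = 0 ∧ (∀ z ∈ Metric.ball c R, HasDerivAt L (logDeriv E z) z) ∧
      ∀ z ∈ Metric.ball c R, E z = E c * Complex.exp (L z) := by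
  have hd : DifferentiableOn ℂ (logDeriv E) (Metric.ball c R) := by
    intro z hz
    have h1 : DifferentiableAt ℂ (deriv E) z := (hE.analyticAt z).deriv.differentiableAt
    exact (h1.div (hE z) (h0 z hz)).differentiableWithinAt
  obtain ⟨L, hL0, hL⟩ := hd.isExactOn_ball.with_val_at c 0
  refine ⟨L, hL0, hL, ?_⟩
  have hc : c ∈ Metric.ball c R := Metric.mem_ball_self hR
  have hder : ∀ z ∈ Metric.ball c R,
      HasDerivAt (fun w => E w * Complex.exp (-L w)) 0 z := by
    intro z hz
    have h1 := (hE z).hasDerivAt.mul ((hL z hz).neg.cexp)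
    have e : deriv E z * Complex.exp ((-L) z) +
        E z * (Complex.exp ((-L) z) * -logDeriv E z) = 0 := by
      rw [logDeriv_apply]
      field_simp [h0 z hz]
      ring
    rw [e] at h1
    exact h1
  intro z hz
  have hconst : E z * Complex.exp (-L z) = E c * Complex.exp (-L c) := by
    refine Metric.isOpen_ball.is_const_of_deriv_eq_zero
      (convex_ball c R).isPreconnected (f := fun w => E w * Complex.exp (-L w)) ?_ ?_ hz hc
    · exact fun w hw => (hder w hw).differentiableAt.differentiableWithinAt
    · exact fun w hw => (hder w hw).deriv
  rw [hL0, neg_zero, Complex.exp_zero, mul_one] at hconst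
  rw [← hconst, mul_assoc, ← Complex.exp_add]
  simp

/-- A bound for the logarithmic derivative of a function without zeros in a disc, from an upper
bound on its modulus relative to the value at the centre (Borel–Carathéodory and Cauchy). -/
theorem norm_logDeriv_le_of_ne_zero {E : ℂ → ℂ} (hE : Differentiable ℂ E) {c : ℂ}
    {r R B : ℝ} (hr : 0 < r) (hR : r < R) (hB : 0 < B)
    (h0 : ∀ z ∈ Metric.ball c R, E z ≠ 0)
    (hbd : ∀ z ∈ Metric.ball c R, ‖E z‖ ≤ ‖E c‖ * Real.exp B) {s : ℂ}
    (hs : s ∈ Metric.closedBall c r) :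
    ‖logDeriv E s‖ ≤ 8 * R / (R - r) ^ 2 * B := by
  have hR0 : 0 < R := hr.trans hR
  obtain ⟨L, hL0, hL, hLe⟩ := exists_hasDerivAt_logDeriv_of_ne_zero hE h0 hR0
  have hc : c ∈ Metric.ball c R := Metric.mem_ball_self hR0
  have hre : ∀ z ∈ Metric.ball c R, (L z).re ≤ B := by
    intro z hz
    have h1 := hbd z hz
    rw [hLe z hz, norm_mul, Complex.norm_exp] at h1
    exact Real.exp_le_exp.1 (le_of_mul_le_mul_left h1 (norm_pos_iff.2 (h0 c hc)))
  have hLbd : ∀ z : ℂ, ‖z - c‖ < R → ‖L z‖ ≤ 2 * B * ‖z - c‖ / (R - ‖z - c‖) := by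
    intro z hz
    have hmem : ∀ w ∈ Metric.ball (0 : ℂ) R, c + w ∈ Metric.ball c R := by
      intro w hw
      simpa [Metric.mem_ball, dist_eq_norm] using hw
    have := Complex.borelCaratheodory_zero (f := fun w => L (c + w)) (z := z - c) hB
      (fun w hw => by
        have := (hL (c + w) (hmem w hw)).differentiableAt
        exact (DifferentiableAt.comp w (g := L) (f := fun w => c + w) this
          (by fun_prop)).differentiableWithinAt)
      (fun w hw => hre _ (hmem w hw)) hR0 (by simpa using hz) (by simpa using hL0)
    simpa using this
  have hs' : ‖s - c‖ ≤ r := by simpa [dist_eq_norm] using hs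
  have hd : 0 < (R - r) / 2 := by linarith
  have hin : ∀ z ∈ Metric.closedBall s ((R - r) / 2), ‖z - c‖ ≤ (R + r) / 2 := by
    intro z hz
    have h1 : ‖z - s‖ ≤ (R - r) / 2 := by simpa [dist_eq_norm] using hz
    calc ‖z - c‖ = ‖(z - s) + (s - c)‖ := by ring_nf
      _ ≤ _ := (norm_add_le _ _).trans (by linarith)
  have hball : ∀ z ∈ Metric.closedBall s ((R - r) / 2), z ∈ Metric.ball c R := by
    intro z hz
    rw [Metric.mem_ball, dist_eq_norm]
    have := hin z hz
    linarith
  have hder := Complex.norm_deriv_le_of_forall_mem_sphere_norm_le (f := L) (c := s)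
    (C := 2 * B * R / ((R - r) / 2)) hd
    (DifferentiableOn.diffContOnCl (by
      rw [closure_ball _ hd.ne']
      exact fun z hz => (hL z (hball z hz)).differentiableAt.differentiableWithinAt))
    (by
      intro z hz
      have hz' := Metric.sphere_subset_closedBall hz
      have h1 := hin z hz'
      refine (hLbd z (by linarith)).trans ?_
      have h2 : 0 < R - ‖z - c‖ := by linarith
      gcongr <;> linarith)
  rw [(hL s (hball s (Metric.mem_closedBall_self hd.le))).deriv] at hder
  refine hder.trans (le_of_eq ?_)
  have : R - r ≠ 0 := by linarith
  field_simp
  ring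

/-- Landau's local formula: on a smaller disc, the logarithmic derivative of an entire function is
the sum of `m_ρ / (s - ρ)` over the zeros in a larger disc, up to an error controlled by the ratio
of the maximum modulus to the value at the centre. -/
theorem exists_norm_logDeriv_le_sum_add {r R₁ R : ℝ} (hr : 0 < r) (hR₁ : r < R₁) (hR : R₁ < R) :
    ∃ K : ℝ, 0 ≤ K ∧ ∀ (f : ℂ → ℂ) (c : ℂ) (M : ℝ) (S : Finset ℂ), Differentiable ℂ f → f c ≠ 0 →
      1 ≤ M → (∀ z ∈ Metric.closedBall c R, ‖f z‖ ≤ M) →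
      (∀ ρ, ρ ∈ S ↔ ρ ∈ Metric.closedBall c R₁ ∧ f ρ = 0) →
      ∀ s ∈ Metric.closedBall c r, f s ≠ 0 → ‖logDeriv f s‖ ≤
        ∑ ρ ∈ S, (analyticOrderNatAt f ρ : ℝ) / ‖s - ρ‖ + K * (Real.log (M / ‖f c‖) + 1) := by
  have hR₁0 : 0 < R₁ := hr.trans hR₁
  have hR0 : 0 < R := hR₁0.trans hR
  have hlog : 0 < Real.log (R / R₁) := Real.log_pos ((one_lt_div hR₁0).2 hR)
  set δ := R - R₁ with hδ
  have hδ0 : 0 < δ := by rw [hδ]; linarith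
  set q := |Real.log (R₁ / δ)| with hq
  set K₁ := 1 + q / Real.log (R / R₁) with hK₁
  have hK₁1 : 1 ≤ K₁ := by
    rw [hK₁]; have : 0 ≤ q / Real.log (R / R₁) := by positivity
    linarith
  refine ⟨8 * R₁ / (R₁ - r) ^ 2 * K₁, by positivity, ?_⟩
  intro f c M S hf hc hM1 hM hS s hs hfs
  have hfin := analyticOrderAt_ne_top_of_exists_ne_zero hf hc
  obtain ⟨E, hE, hE0, hfE⟩ := exists_eq_prod_pow_mul hf hfin S
  set A := Real.log (M / ‖f c‖) with hA
  have hfc : 0 < ‖f c‖ := norm_pos_iff.2 hc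
  have hM0 : 0 < M := by linarith
  have hA0 : 0 ≤ A := by
    refine Real.log_nonneg ((one_le_div hfc).2 (hM c (Metric.mem_closedBall_self hR0.le)))
  set n : ℕ := ∑ ρ ∈ S, analyticOrderNatAt f ρ with hn
  have hcount : (n : ℝ) ≤ A / Real.log (R / R₁) := by
    rw [hn]; push_cast
    exact sum_analyticOrderNatAt_le hf hc hR₁0 hR hM1 hM fun ρ hρ => ((hS ρ).1 hρ).1
  -- On the large circle each factor `z - ρ` has modulus at least `δ`, and the bound for the
  -- quotient `E` extends to the disc by the maximum principle.
  have hsph : ∀ z ∈ Metric.sphere c R, ‖E z‖ ≤ M / δ ^ n := by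
    intro z hz
    rw [le_div_iff₀ (by positivity)]
    have h1 := hM z (Metric.sphere_subset_closedBall hz)
    rw [hfE, norm_mul, norm_prod] at h1
    refine le_trans ?_ h1
    rw [mul_comm]
    gcongr
    rw [hn, ← Finset.prod_pow_eq_pow_sum]
    refine Finset.prod_le_prod (fun _ _ => by positivity) fun ρ hρ => ?_
    rw [norm_pow]
    gcongr
    have h2 := ((hS ρ).1 hρ).1
    rw [mem_closedBall_iff_norm] at h2
    rw [mem_sphere_iff_norm] at hz
    have h3 : ‖z - c‖ ≤ ‖z - ρ‖ + ‖ρ - c‖ := by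
      calc ‖z - c‖ = ‖(z - ρ) + (ρ - c)‖ := by ring_nf
        _ ≤ _ := norm_add_le _ _
    rw [hδ]; linarith
  have hbig : ∀ z ∈ Metric.closedBall c R, ‖E z‖ ≤ M / δ ^ n := by
    intro z hz
    refine Complex.norm_le_of_forall_mem_frontier_norm_le (U := Metric.ball c R)
      Metric.isBounded_ball hE.diffContOnCl ?_ (by rwa [closure_ball _ hR0.ne'])
    rw [frontier_ball _ hR0.ne']
    exact hsph
  -- At the centre each factor has modulus at most `R₁`.
  have hcen : ‖f c‖ ≤ R₁ ^ n * ‖E c‖ := by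
    rw [hfE c, norm_mul, norm_prod]
    gcongr
    rw [hn, ← Finset.prod_pow_eq_pow_sum]
    refine Finset.prod_le_prod (fun _ _ => by positivity) fun ρ hρ => ?_
    rw [norm_pow]
    gcongr
    have h2 := ((hS ρ).1 hρ).1
    rwa [mem_closedBall_iff_norm, norm_sub_rev] at h2
  have hEne : ∀ z ∈ Metric.ball c R₁, E z ≠ 0 := by
    intro z hz h0
    have hzS : z ∈ S := (hS z).2 ⟨Metric.ball_subset_closedBall hz, by rw [hfE, h0, mul_zero]⟩
    exact hE0 z hzS h0
  have hrat : ∀ z ∈ Metric.ball c R₁, ‖E z‖ ≤ ‖E c‖ * Real.exp (K₁ * (A + 1)) := by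
    intro z hz
    have h1 := hbig z (Metric.closedBall_subset_closedBall hR.le (Metric.ball_subset_closedBall hz))
    refine h1.trans ?_
    have e1 : M = ‖f c‖ * Real.exp A := by
      rw [hA, Real.exp_log (by positivity)]; field_simp
    have e2 : (R₁ / δ) ^ n ≤ Real.exp (n * q) := by
      rw [← Real.exp_log (show (0 : ℝ) < R₁ / δ by positivity), ← Real.exp_nat_mul]
      gcongr
      exact le_abs_self _
    have e3 : n * q + A ≤ K₁ * (A + 1) := by
      have h2 : n * q ≤ A / Real.log (R / R₁) * q := by gcongr
      have h3 : K₁ * (A + 1) = A + A / Real.log (R / R₁) * q + K₁ := by rw [hK₁]; ring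
      rw [h3]; linarith
    calc M / δ ^ n = ‖f c‖ * Real.exp A / δ ^ n := by rw [← e1]
      _ ≤ R₁ ^ n * ‖E c‖ * Real.exp A / δ ^ n := by gcongr
      _ = ‖E c‖ * ((R₁ / δ) ^ n * Real.exp A) := by rw [div_pow]; ring
      _ ≤ ‖E c‖ * (Real.exp (n * q) * Real.exp A) := by gcongr
      _ = ‖E c‖ * Real.exp (n * q + A) := by rw [Real.exp_add]
      _ ≤ _ := by gcongr
  have hsS : s ∉ S := fun h => hfs ((hS s).1 h).2
  have hEs : E s ≠ 0 := fun h => hfs (by rw [hfE, h, mul_zero])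
  rw [logDeriv_eq_sum_add_logDeriv hE hfE hsS hEs]
  refine (norm_add_le _ _).trans (add_le_add ?_ ?_)
  · refine (norm_sum_le _ _).trans (Finset.sum_le_sum fun ρ _ => ?_)
    rw [norm_div]; simp
  · have := norm_logDeriv_le_of_ne_zero hE hr hR₁ (B := K₁ * (A + 1)) (by positivity) hEne hrat hs
    linarith

/-! ### Growth of the zeta function in the half-plane `0 < Re s` -/

/-- The integral `∫_1^∞ {t} t ^ (-s - 1) dt`, as a Mellin transform. -/
noncomputable def fractIntegral (s : ℂ) : ℂ :=
  mellin ((Ioi (1 : ℝ)).indicator fun t => ((Int.fract t : ℝ) : ℂ)) (-s)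

theorem fractIntegral_eq (s : ℂ) :
    fractIntegral s = ∫ t in Ioi (1 : ℝ), (t : ℂ) ^ (-s - 1) * ((Int.fract t : ℝ) : ℂ) := by
  unfold fractIntegral mellin
  have : (fun t : ℝ => (t : ℂ) ^ (-s - 1) •
      (Ioi (1 : ℝ)).indicator (fun t => ((Int.fract t : ℝ) : ℂ)) t) =
      (Ioi (1 : ℝ)).indicator fun t => (t : ℂ) ^ (-s - 1) * ((Int.fract t : ℝ) : ℂ) := by
    funext t
    by_cases h : t ∈ Ioi (1 : ℝ) <;> simp [h]
  rw [this, setIntegral_indicator measurableSet_Ioi, Ioi_inter_Ioi]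
  simp

theorem norm_indicator_fract_le (t : ℝ) :
    ‖(Ioi (1 : ℝ)).indicator (fun t => ((Int.fract t : ℝ) : ℂ)) t‖ ≤ 1 := by
  refine (norm_indicator_le_norm_self _ _).trans ?_
  rw [Complex.norm_real, Real.norm_eq_abs, abs_of_nonneg (Int.fract_nonneg t)]
  exact (Int.fract_lt_one t).le

theorem differentiableAt_fractIntegral {s : ℂ} (hs : 0 < s.re) :
    DifferentiableAt ℂ fractIntegral s := by
  have hmeas : Measurable ((Ioi (1 : ℝ)).indicator fun t => ((Int.fract t : ℝ) : ℂ)) :=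
    (Complex.measurable_ofReal.comp measurable_fract).indicator measurableSet_Ioi
  have h : DifferentiableAt ℂ
      (mellin ((Ioi (1 : ℝ)).indicator fun t => ((Int.fract t : ℝ) : ℂ))) (-s) := by
    refine mellin_differentiableAt_of_isBigO_rpow (a := 0) (b := (-s).re - 1) ?_ ?_
      (by simpa using hs) ?_ (by linarith)
    · have : LocallyIntegrable ((Ioi (1 : ℝ)).indicator fun t => ((Int.fract t : ℝ) : ℂ)) := by
        refine (locallyIntegrable_const (1 : ℝ)).mono hmeas.aestronglyMeasurable
          (Eventually.of_forall fun t => ?_)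
        simpa using norm_indicator_fract_le t
      exact this.locallyIntegrableOn _
    · simp only [neg_zero, Real.rpow_zero]
      exact Asymptotics.isBigO_of_le _ fun t => by simpa using norm_indicator_fract_le t
    · refine Asymptotics.IsBigO.of_norm_eventuallyLE ?_
      have h1 : ∀ᶠ t : ℝ in 𝓝[>] 0, t < 1 := nhdsWithin_le_nhds (gt_mem_nhds one_pos)
      filter_upwards [h1, self_mem_nhdsWithin] with t ht ht0
      have : t ∉ Ioi (1 : ℝ) := by simpa using ht.le
      simp only [this, not_false_eq_true, indicator_of_notMem, norm_zero]
      exact Real.rpow_nonneg (le_of_lt ht0) _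
  exact h.comp s (by fun_prop)

theorem norm_fractIntegral_le {s : ℂ} (hs : 0 < s.re) : ‖fractIntegral s‖ ≤ 1 / s.re := by
  rw [fractIntegral_eq]
  have hint : IntegrableOn (fun t : ℝ => t ^ (-s.re - 1)) (Ioi 1) :=
    integrableOn_Ioi_rpow_of_lt (by linarith) one_pos
  calc _ ≤ ∫ t in Ioi (1 : ℝ), t ^ (-s.re - 1) := by
        refine norm_integral_le_of_norm_le hint ?_
        refine (ae_restrict_mem measurableSet_Ioi).mono fun t ht => ?_
        have ht0 : 0 < t := zero_lt_one.trans ht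
        rw [norm_mul, Complex.norm_cpow_eq_rpow_re_of_pos ht0, Complex.norm_real,
          Real.norm_eq_abs, abs_of_nonneg (Int.fract_nonneg t)]
        simp only [Complex.sub_re, Complex.neg_re, Complex.one_re]
        exact mul_le_of_le_one_right (by positivity) (Int.fract_lt_one t).le
    _ = 1 / s.re := by
        rw [integral_Ioi_rpow_of_lt (by linarith) one_pos]
        simp

/-- Partial summation: here `riemannZeta₁ s` is `(s - 1) ζ(s)`. -/
theorem riemannZeta₁_eq_of_one_lt_re {s : ℂ} (hs : 1 < s.re) :
    riemannZeta₁ s = s - s * (s - 1) * fractIntegral s := by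
  have hs1 : s ≠ 1 := by rintro rfl; simp at hs
  have hs0 : s - 1 ≠ 0 := sub_ne_zero.2 hs1
  have hL := LSeries_eq_mul_integral' (fun _ => (1 : ℂ)) zero_le_one hs (by
    simp only [norm_one, Finset.sum_const, Nat.card_Icc, add_tsub_cancel_right, nsmul_eq_mul,
      mul_one, Real.rpow_one]
    exact Asymptotics.isBigO_refl _ _)
  have hz : riemannZeta s = LSeries (fun _ => (1 : ℂ)) s := (LSeries_one_eq_riemannZeta hs).symm
  have hint1 : IntegrableOn (fun t : ℝ => (t : ℂ) ^ (-s)) (Ioi 1) :=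
    integrableOn_Ioi_cpow_of_lt (by simpa using hs) one_pos
  have hint2 : IntegrableOn
      (fun t : ℝ => (t : ℂ) ^ (-s - 1) * ((Int.fract t : ℝ) : ℂ)) (Ioi 1) := by
    have h1 : IntegrableOn (fun t : ℝ => (t : ℂ) ^ (-s - 1)) (Ioi 1) :=
      integrableOn_Ioi_cpow_of_lt (by simp; linarith) one_pos
    refine Integrable.mono h1 (h1.aestronglyMeasurable.mul
      (Complex.measurable_ofReal.comp measurable_fract).aestronglyMeasurable) ?_
    refine Eventually.of_forall fun t => ?_
    rw [norm_mul, Complex.norm_real, Real.norm_eq_abs, abs_of_nonneg (Int.fract_nonneg t)]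
    exact mul_le_of_le_one_right (by positivity) (Int.fract_lt_one t).le
  have e : ∫ t in Ioi (1 : ℝ), (∑ k ∈ Finset.Icc 1 ⌊t⌋₊, (1 : ℂ)) * (t : ℂ) ^ (-(s + 1)) =
      (∫ t in Ioi (1 : ℝ), (t : ℂ) ^ (-s)) - fractIntegral s := by
    rw [fractIntegral_eq, ← integral_sub hint1 hint2]
    refine setIntegral_congr_fun measurableSet_Ioi fun t ht => ?_
    have ht0 : 0 < t := zero_lt_one.trans ht
    have htc : (t : ℂ) ≠ 0 := by exact_mod_cast ht0.ne'
    have h1 : (t : ℂ) ^ (-s) = (t : ℂ) ^ (-s - 1) * t := by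
      rw [Complex.cpow_sub _ _ htc, Complex.cpow_one]; field_simp
    have h2 : ((Int.fract t : ℝ) : ℂ) = t - (⌊t⌋₊ : ℂ) := by
      rw [Int.fract, ← natCast_floor_eq_intCast_floor ht0.le]
      push_cast
      rfl
    simp only [Finset.sum_const, Nat.card_Icc, add_tsub_cancel_right, nsmul_eq_mul, mul_one]
    rw [h1, h2, show -(s + 1) = -s - 1 by ring]
    ring
  rw [← hz, e, integral_Ioi_cpow_of_lt (by simpa using hs) one_pos] at hL
  have h3 := riemannZeta_eq_inv_sub_mul hs1
  have h4 : riemannZeta₁ s = (s - 1) * riemannZeta s := by rw [h3]; field_simp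
  rw [h4, hL]
  simp only [Complex.ofReal_one, Complex.one_cpow]
  have : -s + 1 ≠ 0 := by rw [← neg_ne_zero]; convert hs0 using 1; ring
  field_simp
  ring

/-- The analytic continuation of the zeta function to the half-plane `0 < Re s` by partial
summation. -/
theorem riemannZeta₁_eq {s : ℂ} (hs : 0 < s.re) :
    riemannZeta₁ s = s - s * (s - 1) * fractIntegral s := by
  have hU : IsOpen {z : ℂ | 0 < z.re} := isOpen_lt continuous_const Complex.continuous_re
  have hc : IsPreconnected {z : ℂ | 0 < z.re} := (convex_halfSpace_re_gt 0).isPreconnected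
  have h1 : AnalyticOnNhd ℂ riemannZeta₁ {z : ℂ | 0 < z.re} :=
    fun z _ => differentiable_riemannZeta₁.analyticAt z
  have h2 : AnalyticOnNhd ℂ (fun s => s - s * (s - 1) * fractIntegral s) {z : ℂ | 0 < z.re} := by
    refine DifferentiableOn.analyticOnNhd (fun z hz => ?_) hU
    have := differentiableAt_fractIntegral hz
    exact (by fun_prop : DifferentiableAt ℂ (fun s => s - s * (s - 1) * fractIntegral s) z)
      |>.differentiableWithinAt
  have hev : riemannZeta₁ =ᶠ[𝓝 (2 : ℂ)] fun s => s - s * (s - 1) * fractIntegral s := by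
    have : ∀ᶠ z : ℂ in 𝓝 2, 1 < z.re :=
      (isOpen_lt continuous_const Complex.continuous_re).mem_nhds (by simp)
    filter_upwards [this] with z hz using riemannZeta₁_eq_of_one_lt_re hz
  exact h1.eqOn_of_preconnected_of_eventuallyEq h2 hc (by simp) hev hs

theorem norm_riemannZeta₁_le {s : ℂ} (hs : 0 < s.re) :
    ‖riemannZeta₁ s‖ ≤ ‖s‖ + ‖s‖ * ‖s - 1‖ * (1 / s.re) := by
  rw [riemannZeta₁_eq hs]
  refine (norm_sub_le _ _).trans ?_
  rw [norm_mul, norm_mul]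
  gcongr
  exact norm_fractIntegral_le hs

/-- The terms of the Dirichlet series after the first contribute at most `π² / 6 - 1 < 3 / 4`. -/
theorem norm_riemannZeta_ge_of_re_eq_two {s : ℂ} (hs : s.re = 2) : 1 / 4 ≤ ‖riemannZeta s‖ := by
  have h1 := zeta_eq_tsum_one_div_nat_add_one_cpow (s := s) (by linarith)
  have hn : ∀ n : ℕ, ‖1 / ((n : ℂ) + 1) ^ s‖ = 1 / ((n : ℝ) + 1) ^ 2 := by
    intro n
    have := Complex.norm_natCast_cpow_of_pos (Nat.succ_pos n) s
    push_cast at this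
    rw [norm_div, this, hs, norm_one]
    norm_num
  have hz2 : HasSum (fun n : ℕ => 1 / ((n : ℝ) + 1) ^ 2) (Real.pi ^ 2 / 6) := by
    have := (hasSum_nat_add_iff' (f := fun n : ℕ => 1 / (n : ℝ) ^ 2) 1).2 hasSum_zeta_two
    simpa using this
  have hsum : Summable fun n : ℕ => 1 / ((n : ℂ) + 1) ^ s :=
    Summable.of_norm (by simp_rw [hn]; exact hz2.summable)
  have hz3 := (hasSum_nat_add_iff' 1).2 hz2
  have e : riemannZeta s = 1 + ∑' n : ℕ, 1 / (((n + 1 : ℕ) : ℂ) + 1) ^ s := by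
    rw [h1, hsum.tsum_eq_zero_add]; simp
  have hb : ‖∑' n : ℕ, 1 / (((n + 1 : ℕ) : ℂ) + 1) ^ s‖ ≤ Real.pi ^ 2 / 6 - 1 := by
    refine tsum_of_norm_bounded (g := fun n : ℕ => 1 / (((n + 1 : ℕ) : ℝ) + 1) ^ 2) ?_
      fun n => (hn (n + 1)).le
    simpa using hz3
  have hpi : Real.pi ^ 2 ≤ 10 := by
    have h2 := Real.pi_lt_d2; have h3 := Real.pi_pos
    nlinarith
  have h4 : ‖(1 : ℂ)‖ ≤ ‖riemannZeta s‖ + ‖∑' n : ℕ, 1 / (((n + 1 : ℕ) : ℂ) + 1) ^ s‖ := by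
    have : (1 : ℂ) = riemannZeta s - ∑' n : ℕ, 1 / (((n + 1 : ℕ) : ℂ) + 1) ^ s := by rw [e]; ring
    calc ‖(1 : ℂ)‖ = ‖riemannZeta s - ∑' n : ℕ, 1 / (((n + 1 : ℕ) : ℂ) + 1) ^ s‖ := by rw [← this]
      _ ≤ _ := norm_sub_le _ _
  rw [norm_one] at h4
  linarith

theorem norm_riemannZeta₁_ge_of_re_eq_two {s : ℂ} (hs : s.re = 2) : 1 / 4 ≤ ‖riemannZeta₁ s‖ := by
  have hs1 : s ≠ 1 := by rintro rfl; norm_num at hs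
  have h4 : riemannZeta₁ s = (s - 1) * riemannZeta s := by
    rw [riemannZeta_eq_inv_sub_mul hs1]
    have : s - 1 ≠ 0 := sub_ne_zero.2 hs1
    field_simp
  have h5 : 1 ≤ ‖s - 1‖ := by
    have := Complex.re_le_norm (s - 1)
    simp [hs] at this
    linarith
  rw [h4, norm_mul]
  have := norm_riemannZeta_ge_of_re_eq_two hs
  nlinarith [norm_nonneg (riemannZeta s)]

/-! ### Zeros near a given height -/

/-- The radius `7 / 4` keeps the disc about a point with real part `2` inside `1 / 4 ≤ Re s`. -/
theorem norm_riemannZeta₁_le_of_mem_closedBall {N : ℕ} {σ : ℝ} (hσ : |σ| = 1) {z : ℂ}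
    (hz : z ∈ Metric.closedBall (⟨2, σ * (N + 1 / 2)⟩ : ℂ) (7 / 4)) :
    ‖riemannZeta₁ z‖ ≤ 5 * ((N : ℝ) + 5) ^ 2 := by
  set c : ℂ := ⟨2, σ * (N + 1 / 2)⟩ with hc
  rw [mem_closedBall_iff_norm] at hz
  have hN : (0 : ℝ) ≤ N := Nat.cast_nonneg N
  have him : |c.im| = N + 1 / 2 := by
    rw [hc, abs_mul, hσ, one_mul, abs_of_pos (by positivity)]
  have hre : 1 / 4 ≤ z.re := by
    have h1 := (abs_le.1 ((Complex.abs_re_le_norm (z - c)).trans hz)).1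
    simp [hc] at h1
    linarith
  have h1 : ‖c‖ ≤ 2 + (N + 1 / 2) := by
    refine (Complex.norm_le_abs_re_add_abs_im c).trans ?_
    rw [him]; simp [hc]
  have h2 : ‖c - 1‖ ≤ 1 + (N + 1 / 2) := by
    refine (Complex.norm_le_abs_re_add_abs_im (c - 1)).trans ?_
    have e1 : (c - 1).im = c.im := by simp
    have e2 : (c - 1).re = 1 := by simp [hc]; norm_num
    rw [e1, e2, him, abs_one]
  have h3 : ‖z‖ ≤ N + 5 := by
    calc ‖z‖ = ‖(z - c) + c‖ := by ring_nf
      _ ≤ _ := (norm_add_le _ _).trans (by linarith)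
  have h4 : ‖z - 1‖ ≤ N + 5 := by
    calc ‖z - 1‖ = ‖(z - c) + (c - 1)‖ := by ring_nf
      _ ≤ _ := (norm_add_le _ _).trans (by linarith)
  have h5 : 1 / z.re ≤ 4 := by
    rw [div_le_iff₀ (by linarith)]; linarith
  calc ‖riemannZeta₁ z‖ ≤ ‖z‖ + ‖z‖ * ‖z - 1‖ * (1 / z.re) := norm_riemannZeta₁_le (by linarith)
    _ ≤ (N + 5) + (N + 5) * (N + 5) * 4 := by gcongr
    _ ≤ _ := by nlinarith

theorem one_le_log_natCast_add_five (N : ℕ) : 1 ≤ Real.log ((N : ℝ) + 5) := by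
  have hN : (0 : ℝ) ≤ N := Nat.cast_nonneg N
  rw [Real.le_log_iff_exp_le (by positivity)]
  have := Real.exp_one_lt_d9
  linarith

/-- The logarithm of the ratio of the maximum modulus to the value at the centre, which controls
both the number of zeros and the error in the local formula. -/
theorem log_div_norm_riemannZeta₁_le {N : ℕ} {σ : ℝ} :
    Real.log (5 * ((N : ℝ) + 5) ^ 2 / ‖riemannZeta₁ ⟨2, σ * (N + 1 / 2)⟩‖) ≤
      4 * Real.log ((N : ℝ) + 5) := by
  have hN : (0 : ℝ) ≤ N := Nat.cast_nonneg N
  have h1 := norm_riemannZeta₁_ge_of_re_eq_two (s := (⟨2, σ * (N + 1 / 2)⟩ : ℂ)) rfl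
  set a := ‖riemannZeta₁ ⟨2, σ * (N + 1 / 2)⟩‖
  have ha : 0 < a := by linarith
  have h2 : 4 * Real.log ((N : ℝ) + 5) = Real.log (((N : ℝ) + 5) ^ 4) := by
    rw [Real.log_pow]; norm_num
  rw [h2]
  refine Real.log_le_log (by positivity) ?_
  rw [div_le_iff₀ ha]
  nlinarith [mul_nonneg hN hN, pow_nonneg hN 3, pow_nonneg hN 4,
    mul_le_mul_of_nonneg_left h1 (show (0 : ℝ) ≤ ((N : ℝ) + 5) ^ 4 by positivity)]

/-- The half-window `1 / 2 ≤ Re s ≤ 2`, `N ≤ |Im s| ≤ N + 1` is covered by two discs centred on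
`Re s = 2`; the radius suffices as `(3 / 2)² + (1 / 2)² ≤ 1.59²`. -/
theorem mem_closedBall_of_abs_im {N : ℕ} {s : ℂ} (h1 : 1 / 2 ≤ s.re) (h2 : s.re ≤ 2)
    (h3 : (N : ℝ) ≤ |s.im|) (h4 : |s.im| ≤ N + 1) :
    ∃ σ : ℝ, (σ = 1 ∨ σ = -1) ∧
      s ∈ Metric.closedBall (⟨2, σ * (N + 1 / 2)⟩ : ℂ) (159 / 100) := by
  obtain ⟨σ, hσ, hs⟩ : ∃ σ : ℝ, (σ = 1 ∨ σ = -1) ∧ s.im = σ * |s.im| := by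
    rcases le_total 0 s.im with h | h
    · exact ⟨1, Or.inl rfl, by rw [abs_of_nonneg h, one_mul]⟩
    · exact ⟨-1, Or.inr rfl, by rw [abs_of_nonpos h]; ring⟩
  refine ⟨σ, hσ, ?_⟩
  rw [mem_closedBall_iff_norm, ← abs_of_nonneg (norm_nonneg _)]
  refine abs_le_of_sq_le_sq (h := ?_) (by norm_num)
  rw [Complex.sq_norm, Complex.normSq_apply]
  simp only [Complex.sub_re, Complex.sub_im]
  rw [hs]
  have hσ2 : σ * σ = 1 := by rcases hσ with h | h <;> rw [h] <;> norm_num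
  have e : (σ * |s.im| - σ * (N + 1 / 2)) * (σ * |s.im| - σ * (N + 1 / 2)) =
      (|s.im| - (N + 1 / 2)) ^ 2 := by
    calc _ = (σ * σ) * (|s.im| - (N + 1 / 2)) ^ 2 := by ring
      _ = _ := by rw [hσ2, one_mul]
  rw [e]
  nlinarith

/-- Some height in `[N, N + 1]` stays away from finitely many given ordinates. -/
theorem exists_forall_abs_sub_ge (H : Finset ℝ) (N : ℕ) :
    ∃ T : ℝ, (N : ℝ) ≤ T ∧ T ≤ N + 1 ∧ ∀ γ ∈ H, 1 / (2 * ((H.card : ℝ) + 1)) ≤ |T - γ| := by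
  classical
  set n := H.card with hn
  have hn0 : (0 : ℝ) < (n : ℝ) + 1 := by positivity
  -- One of `n + 1` subintervals of length `1 / (n + 1)` contains no ordinate: take its midpoint.
  obtain ⟨j, hj, hjH⟩ : ∃ j ∈ Finset.range (n + 1),
      (j : ℤ) ∉ H.image fun γ : ℝ => ⌊(γ - N) * (n + 1)⌋ := by
    have := Finset.exists_mem_notMem_of_card_lt_card
      (s := H.image fun γ : ℝ => ⌊(γ - N) * ((n : ℝ) + 1)⌋)
      (t := (Finset.range (n + 1)).image fun j : ℕ => (j : ℤ))
      (by
        rw [Finset.card_image_of_injective _ Nat.cast_injective, Finset.card_range]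
        exact Nat.lt_succ_of_le Finset.card_image_le)
    obtain ⟨e, he, he'⟩ := this
    obtain ⟨j, hj, rfl⟩ := Finset.mem_image.1 he
    exact ⟨j, hj, he'⟩
  have hj' : (j : ℝ) ≤ n := by exact_mod_cast Nat.lt_succ_iff.1 (Finset.mem_range.1 hj)
  have hj0 : (0 : ℝ) ≤ j := Nat.cast_nonneg j
  refine ⟨N + (j + 1 / 2) / (n + 1), ?_, ?_, ?_⟩
  · have : 0 ≤ ((j : ℝ) + 1 / 2) / (n + 1) := by positivity
    linarith
  · have : ((j : ℝ) + 1 / 2) / (n + 1) ≤ 1 := by rw [div_le_one hn0]; linarith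
    linarith
  · intro γ hγ
    by_contra hlt
    push Not at hlt
    apply hjH
    refine Finset.mem_image.2 ⟨γ, hγ, ?_⟩
    have h1 := abs_lt.1 hlt
    have e : 1 / (2 * ((n : ℝ) + 1)) * (n + 1) = 1 / 2 := by field_simp
    have e2 : ((j : ℝ) + 1 / 2) / (n + 1) * (n + 1) = j + 1 / 2 := by field_simp
    rw [Int.floor_eq_iff]
    push_cast
    constructor
    · nlinarith [mul_lt_mul_of_pos_right h1.2 hn0]
    · nlinarith [mul_lt_mul_of_pos_right h1.1 hn0]

/-- Near height `N` the zeta function has `O(log N)` zeros, and there is a height in `[N, N + 1]`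
at which its logarithmic derivative is `O(log² N)`. -/
theorem exists_zeta_window_bounds : ∃ C : ℝ, 0 ≤ C ∧ ∀ N : ℕ,
    (∀ Z : Finset ℂ, (∀ ρ ∈ Z, riemannZeta₁ ρ = 0 ∧ 1 / 2 ≤ ρ.re ∧ ρ.re ≤ 2 ∧ (N : ℝ) ≤ |ρ.im| ∧
      |ρ.im| ≤ N + 1) →
      ∑ ρ ∈ Z, (analyticOrderNatAt riemannZeta₁ ρ : ℝ) ≤ C * Real.log ((N : ℝ) + 5)) ∧
    ∃ T : ℝ, (N : ℝ) ≤ T ∧ T ≤ N + 1 ∧ ∀ s : ℂ, 1 / 2 ≤ s.re → s.re ≤ 2 → |s.im| = T →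
      riemannZeta₁ s ≠ 0 ∧ ‖logDeriv riemannZeta₁ s‖ ≤ C * Real.log ((N : ℝ) + 5) ^ 2 := by
  classical
  obtain ⟨K, hK0, hK⟩ := exists_norm_logDeriv_le_sum_add (r := 159 / 100) (R₁ := 13 / 8)
    (R := 7 / 4) (by norm_num) (by norm_num) (by norm_num)
  -- For `σ = 1` and `σ = -1` in turn, `c σ` below is the centre of the disc around the upper and
  -- the lower window, and `S σ` the set of zeros in it. The constant `C` is that of the last step.
  set B := 4 / Real.log ((7 / 4 : ℝ) / (13 / 8)) with hB
  have hlog : 0 < Real.log ((7 / 4 : ℝ) / (13 / 8)) := Real.log_pos (by norm_num)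
  have hB0 : 0 < B := by positivity
  have hd := differentiable_riemannZeta₁
  set C := B * (4 * B + 2) + 5 * K + 2 * B with hC
  have hC0 : 0 ≤ C := by positivity
  refine ⟨C, hC0, fun N => ?_⟩
  set l := Real.log ((N : ℝ) + 5) with hl
  have hl1 : 1 ≤ l := one_le_log_natCast_add_five N
  let c : ℝ → ℂ := fun σ => ⟨2, σ * (N + 1 / 2)⟩
  have hcne : ∀ σ, riemannZeta₁ (c σ) ≠ 0 := by
    intro σ h
    have := norm_riemannZeta₁_ge_of_re_eq_two (s := c σ) rfl
    rw [h, norm_zero] at this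
    norm_num at this
  have hfin : ∀ σ, {z | z ∈ Metric.closedBall (c σ) (13 / 8) ∧ riemannZeta₁ z = 0}.Finite :=
    fun σ => finite_zeros_of_isCompact hd (hcne σ) (isCompact_closedBall _ _)
  let S : ℝ → Finset ℂ := fun σ => (hfin σ).toFinset
  have hS : ∀ σ ρ, ρ ∈ S σ ↔ ρ ∈ Metric.closedBall (c σ) (13 / 8) ∧ riemannZeta₁ ρ = 0 := by
    intro σ ρ; simp [S]
  have hM1 : (1 : ℝ) ≤ 5 * ((N : ℝ) + 5) ^ 2 := by
    have : (0 : ℝ) ≤ N := Nat.cast_nonneg N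
    nlinarith
  have hcount : ∀ σ : ℝ, |σ| = 1 → ∑ ρ ∈ S σ, (analyticOrderNatAt riemannZeta₁ ρ : ℝ) ≤ B * l := by
    intro σ hσ
    have := sum_analyticOrderNatAt_le hd (hcne σ) (R₁ := 13 / 8) (R := 7 / 4) (by norm_num)
      (by norm_num) hM1 (fun z hz => norm_riemannZeta₁_le_of_mem_closedBall hσ hz)
      (S := S σ) fun ρ hρ => ((hS σ ρ).1 hρ).1
    refine this.trans ?_
    rw [hB, div_mul_eq_mul_div]
    gcongr
    exact log_div_norm_riemannZeta₁_le
  have habs : ∀ σ : ℝ, σ = 1 ∨ σ = -1 → |σ| = 1 := by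
    rintro σ (h | h) <;> rw [h] <;> simp
  have hsub : ∀ ρ, riemannZeta₁ ρ = 0 ∧ 1 / 2 ≤ ρ.re ∧ ρ.re ≤ 2 ∧ (N : ℝ) ≤ |ρ.im| ∧
      |ρ.im| ≤ N + 1 → ρ ∈ S 1 ∪ S (-1) := by
    rintro ρ ⟨h0, h1, h2, h3, h4⟩
    obtain ⟨σ, hσ, hm⟩ := mem_closedBall_of_abs_im h1 h2 h3 h4
    have hmem : ρ ∈ S σ :=
      (hS σ ρ).2 ⟨Metric.closedBall_subset_closedBall (by norm_num) hm, h0⟩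
    rcases hσ with rfl | rfl
    · exact Finset.mem_union_left _ hmem
    · exact Finset.mem_union_right _ hmem
  have hunion : ∑ ρ ∈ S 1 ∪ S (-1), (analyticOrderNatAt riemannZeta₁ ρ : ℝ) ≤ 2 * B * l := by
    have h1 := hcount 1 (by simp)
    have h2 := hcount (-1) (by simp)
    have h3 := Finset.sum_union_inter (s₁ := S 1) (s₂ := S (-1))
      (f := fun ρ => (analyticOrderNatAt riemannZeta₁ ρ : ℝ))
    have h4 : 0 ≤ ∑ ρ ∈ S 1 ∩ S (-1), (analyticOrderNatAt riemannZeta₁ ρ : ℝ) := by positivity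
    linarith
  refine ⟨?_, ?_⟩
  · intro Z hZ
    calc ∑ ρ ∈ Z, (analyticOrderNatAt riemannZeta₁ ρ : ℝ)
        ≤ ∑ ρ ∈ S 1 ∪ S (-1), (analyticOrderNatAt riemannZeta₁ ρ : ℝ) :=
          Finset.sum_le_sum_of_subset_of_nonneg (fun ρ hρ => hsub ρ (hZ ρ hρ))
            fun _ _ _ => by positivity
      _ ≤ 2 * B * l := hunion
      _ ≤ C * l := by
          gcongr
          rw [hC]
          have : 0 ≤ B * (4 * B + 2) + 5 * K := by positivity
          linarith
  · -- A single height avoids the zeros in both discs, since only `|Im ρ|` matters.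
    set H := (S 1 ∪ S (-1)).image fun ρ => |ρ.im| with hH
    obtain ⟨T, hT1, hT2, hT⟩ := exists_forall_abs_sub_ge H N
    have hcard : (H.card : ℝ) ≤ 2 * B * l := by
      have h1 : H.card ≤ ∑ ρ ∈ S 1 ∪ S (-1), analyticOrderNatAt riemannZeta₁ ρ := by
        refine Finset.card_image_le.trans ?_
        rw [Finset.card_eq_sum_ones]
        refine Finset.sum_le_sum fun ρ hρ => ?_
        have h0 : riemannZeta₁ ρ = 0 := by
          rcases Finset.mem_union.1 hρ with h | h
          exacts [((hS _ _).1 h).2, ((hS _ _).1 h).2]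
        have h2 : analyticOrderAt riemannZeta₁ ρ ≠ 0 :=
          ((hd.analyticAt ρ).analyticOrderAt_ne_zero).2 h0
        rw [← Nat.cast_analyticOrderNatAt
          (analyticOrderAt_ne_top_of_exists_ne_zero hd (hcne 1) ρ)] at h2
        exact Nat.one_le_iff_ne_zero.2 (by exact_mod_cast h2)
      calc (H.card : ℝ) ≤ ((∑ ρ ∈ S 1 ∪ S (-1), analyticOrderNatAt riemannZeta₁ ρ : ℕ) : ℝ) := by
            exact_mod_cast h1
        _ ≤ _ := by push_cast; exact hunion
    refine ⟨T, hT1, hT2, fun s h1 h2 h3 => ?_⟩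
    obtain ⟨σ, hσ, hm⟩ := mem_closedBall_of_abs_im (N := N) h1 h2 (by rw [h3]; exact hT1)
      (by rw [h3]; exact hT2)
    have hdist : ∀ ρ ∈ S σ, 1 / (2 * ((H.card : ℝ) + 1)) ≤ ‖s - ρ‖ := by
      intro ρ hρ
      have hρH : |ρ.im| ∈ H := by
        refine Finset.mem_image.2 ⟨ρ, ?_, rfl⟩
        rcases hσ with rfl | rfl
        exacts [Finset.mem_union_left _ hρ, Finset.mem_union_right _ hρ]
      refine (hT _ hρH).trans ?_
      rw [← h3]
      refine (abs_abs_sub_abs_le_abs_sub _ _).trans ?_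
      simpa using Complex.abs_im_le_norm (s - ρ)
    have hs0 : riemannZeta₁ s ≠ 0 := by
      intro h0
      have := hdist s ((hS σ s).2 ⟨Metric.closedBall_subset_closedBall (by norm_num) hm, h0⟩)
      rw [sub_self, norm_zero] at this
      have hpos : 0 < 1 / (2 * ((H.card : ℝ) + 1)) := by positivity
      linarith
    refine ⟨hs0, ?_⟩
    refine (hK riemannZeta₁ (c σ) _ (S σ) hd (hcne σ) hM1
      (fun z hz => norm_riemannZeta₁_le_of_mem_closedBall (habs σ hσ) hz) (hS σ) s hm hs0).trans ?_
    have e1 : ∑ ρ ∈ S σ, (analyticOrderNatAt riemannZeta₁ ρ : ℝ) / ‖s - ρ‖ ≤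
        B * l * (2 * (2 * B * l + 1)) := by
      calc _ ≤ ∑ ρ ∈ S σ, (analyticOrderNatAt riemannZeta₁ ρ : ℝ) * (2 * (2 * B * l + 1)) := by
            refine Finset.sum_le_sum fun ρ hρ => ?_
            rw [div_eq_mul_inv]
            gcongr
            have h5 := hdist ρ hρ
            rw [inv_le_comm₀ (lt_of_lt_of_le (by positivity) h5) (by positivity)]
            refine le_trans ?_ h5
            rw [← one_div]
            gcongr
        _ = (∑ ρ ∈ S σ, (analyticOrderNatAt riemannZeta₁ ρ : ℝ)) * (2 * (2 * B * l + 1)) := by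
            rw [Finset.sum_mul]
        _ ≤ _ := by gcongr; exact hcount σ (habs σ hσ)
    have e2 : K * (Real.log (5 * ((N : ℝ) + 5) ^ 2 / ‖riemannZeta₁ (c σ)‖) + 1) ≤
        K * (5 * l) := by
      gcongr
      have := log_div_norm_riemannZeta₁_le (N := N) (σ := σ)
      linarith
    calc _ ≤ B * l * (2 * (2 * B * l + 1)) + K * (5 * l) := add_le_add e1 e2
      _ = 4 * B ^ 2 * l ^ 2 + 2 * B * l + 5 * K * l := by ring
      _ ≤ 4 * B ^ 2 * l ^ 2 + 2 * B * l ^ 2 + 5 * K * l ^ 2 := by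
          have : l ≤ l ^ 2 := by nlinarith
          gcongr
      _ ≤ C * l ^ 2 := by
          rw [hC]
          have : 0 ≤ B * l ^ 2 := by positivity
          nlinarith

/-! ### Residues in a rectangle -/

/-- The integral of `F` along the boundary of the rectangle `a ≤ Re s ≤ b`, `|Im s| ≤ T`, in the
positive direction. -/
noncomputable def rectIntegral (F : ℂ → ℂ) (a b T : ℝ) : ℂ :=
  (∫ x : ℝ in a..b, F (x + (-T : ℝ) * Complex.I)) - (∫ x : ℝ in a..b, F (x + T * Complex.I)) +
    Complex.I * (∫ y : ℝ in (-T)..T, F (b + y * Complex.I)) -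
    Complex.I * (∫ y : ℝ in (-T)..T, F (a + y * Complex.I))

/-- The closed rectangle `a ≤ Re s ≤ b`, `|Im s| ≤ T`. -/
def rect (a b T : ℝ) : Set ℂ := {s | a ≤ s.re ∧ s.re ≤ b ∧ |s.im| ≤ T}

/-- The boundary of `rect a b T`. -/
def rectBoundary (a b T : ℝ) : Set ℂ :=
  {s | s ∈ rect a b T ∧ (s.re = a ∨ s.re = b ∨ |s.im| = T)}

section rect

variable {a b T : ℝ}

theorem bottom_mem_rectBoundary (hT : 0 ≤ T) {x : ℝ} (hx : x ∈ Icc a b) :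
    (x + (-T : ℝ) * Complex.I : ℂ) ∈ rectBoundary a b T := by
  refine ⟨⟨by simpa using hx.1, by simpa using hx.2, ?_⟩, Or.inr (Or.inr ?_)⟩ <;>
    simp [abs_of_nonneg hT]

theorem top_mem_rectBoundary (hT : 0 ≤ T) {x : ℝ} (hx : x ∈ Icc a b) :
    (x + T * Complex.I : ℂ) ∈ rectBoundary a b T := by
  refine ⟨⟨by simpa using hx.1, by simpa using hx.2, ?_⟩, Or.inr (Or.inr ?_)⟩ <;>
    simp [abs_of_nonneg hT]

theorem right_mem_rectBoundary (hab : a ≤ b) {y : ℝ} (hy : y ∈ Icc (-T) T) :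
    (b + y * Complex.I : ℂ) ∈ rectBoundary a b T := by
  refine ⟨⟨by simpa using hab, by simp, ?_⟩, Or.inr (Or.inl (by simp))⟩
  simpa using abs_le.2 hy

theorem left_mem_rectBoundary (hab : a ≤ b) {y : ℝ} (hy : y ∈ Icc (-T) T) :
    (a + y * Complex.I : ℂ) ∈ rectBoundary a b T := by
  refine ⟨⟨by simp, by simpa using hab, ?_⟩, Or.inl (by simp)⟩
  simpa using abs_le.2 hy

theorem rectIntegral_congr {F G : ℂ → ℂ} (hab : a ≤ b) (hT : 0 ≤ T)
    (h : ∀ s ∈ rectBoundary a b T, F s = G s) : rectIntegral F a b T = rectIntegral G a b T := by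
  have hT' : -T ≤ T := by linarith
  unfold rectIntegral
  congr 1
  · congr 1
    · congr 1
      · refine intervalIntegral.integral_congr fun x hx => h _ (bottom_mem_rectBoundary hT ?_)
        rwa [uIcc_of_le hab] at hx
      · refine intervalIntegral.integral_congr fun x hx => h _ (top_mem_rectBoundary hT ?_)
        rwa [uIcc_of_le hab] at hx
    · congr 1
      refine intervalIntegral.integral_congr fun x hx => h _ (right_mem_rectBoundary hab ?_)
      rwa [uIcc_of_le hT'] at hx
  · congr 1
    refine intervalIntegral.integral_congr fun x hx => h _ (left_mem_rectBoundary hab ?_)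
    rwa [uIcc_of_le hT'] at hx

theorem intervalIntegrable_of_continuousOn_rectBoundary {F : ℂ → ℂ} (hab : a ≤ b) (hT : 0 ≤ T)
    (hF : ContinuousOn F (rectBoundary a b T)) :
    IntervalIntegrable (fun x : ℝ => F (x + (-T : ℝ) * Complex.I)) volume a b ∧
    IntervalIntegrable (fun x : ℝ => F (x + T * Complex.I)) volume a b ∧
    IntervalIntegrable (fun y : ℝ => F (b + y * Complex.I)) volume (-T) T ∧
    IntervalIntegrable (fun y : ℝ => F (a + y * Complex.I)) volume (-T) T := by
  have hT' : -T ≤ T := by linarith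
  refine ⟨?_, ?_, ?_, ?_⟩ <;> refine ContinuousOn.intervalIntegrable ?_
  · rw [uIcc_of_le hab]
    exact hF.comp (by fun_prop) fun x hx => bottom_mem_rectBoundary hT hx
  · rw [uIcc_of_le hab]
    exact hF.comp (by fun_prop) fun x hx => top_mem_rectBoundary hT hx
  · rw [uIcc_of_le hT']
    exact hF.comp (by fun_prop) fun x hx => right_mem_rectBoundary hab hx
  · rw [uIcc_of_le hT']
    exact hF.comp (by fun_prop) fun x hx => left_mem_rectBoundary hab hx

theorem rectIntegral_add {F G : ℂ → ℂ} (hab : a ≤ b) (hT : 0 ≤ T)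
    (hF : ContinuousOn F (rectBoundary a b T)) (hG : ContinuousOn G (rectBoundary a b T)) :
    rectIntegral (fun s => F s + G s) a b T = rectIntegral F a b T + rectIntegral G a b T := by
  obtain ⟨f1, f2, f3, f4⟩ := intervalIntegrable_of_continuousOn_rectBoundary hab hT hF
  obtain ⟨g1, g2, g3, g4⟩ := intervalIntegrable_of_continuousOn_rectBoundary hab hT hG
  unfold rectIntegral
  rw [intervalIntegral.integral_add f1 g1, intervalIntegral.integral_add f2 g2,
    intervalIntegral.integral_add f3 g3, intervalIntegral.integral_add f4 g4]
  ring

theorem rectIntegral_const_mul (F : ℂ → ℂ) (k : ℂ) :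
    rectIntegral (fun s => k * F s) a b T = k * rectIntegral F a b T := by
  unfold rectIntegral
  simp only [intervalIntegral.integral_const_mul]
  ring

theorem rectIntegral_sum {ι : Type*} {F : ι → ℂ → ℂ} (S : Finset ι) (hab : a ≤ b) (hT : 0 ≤ T)
    (hF : ∀ i ∈ S, ContinuousOn (F i) (rectBoundary a b T)) :
    rectIntegral (fun s => ∑ i ∈ S, F i s) a b T = ∑ i ∈ S, rectIntegral (F i) a b T := by
  classical
  induction S using Finset.induction_on with
  | empty => simp [rectIntegral]
  | insert i S hi ih =>
    simp only [Finset.sum_insert hi]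
    rw [rectIntegral_add hab hT (hF i (Finset.mem_insert_self i S))
      (continuousOn_finsetSum S fun j hj => hF j (Finset.mem_insert_of_mem hj)),
      ih fun j hj => hF j (Finset.mem_insert_of_mem hj)]

theorem rectIntegral_eq_zero {F : ℂ → ℂ} (hab : a ≤ b) (hT : 0 ≤ T)
    (hF : DifferentiableOn ℂ F (rect a b T)) : rectIntegral F a b T = 0 := by
  have := Complex.integral_boundary_rect_eq_zero_of_differentiableOn F ⟨a, -T⟩ ⟨b, T⟩ (by
    refine hF.mono ?_
    rintro s ⟨h1, h2⟩
    simp only [mem_preimage] at h1 h2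
    rw [uIcc_of_le hab] at h1
    rw [uIcc_of_le (by linarith)] at h2
    exact ⟨h1.1, h1.2, abs_le.2 h2⟩)
  simpa [rectIntegral] using this

end rect

/-- The winding number of the rectangle is computed with the principal logarithm. It is an
antiderivative of `1 / z` near three of the sides; the left side crosses the cut, and `log (-z)` is
used there, whose two end values account for `2πi`. -/
theorem rectIntegral_inv_sub {a b T : ℝ} {ρ : ℂ} (ha : a < ρ.re) (hb : ρ.re < b)
    (hT : |ρ.im| < T) :
    rectIntegral (fun s => 1 / (s - ρ)) a b T = 2 * Real.pi * Complex.I := by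
  obtain ⟨hT1, hT2⟩ := abs_lt.1 hT
  have hof : ∀ x : ℝ, HasDerivAt (fun x : ℝ => (x : ℂ)) 1 x := fun x =>
    (hasDerivAt_id x).ofReal_comp
  have key : ∀ (p q : ℝ) (γ : ℝ → ℂ) (v : ℂ), (∀ x, HasDerivAt γ v x) →
      (∀ x ∈ uIcc p q, γ x ∈ Complex.slitPlane) →
      v * ∫ x in p..q, 1 / γ x = Complex.log (γ q) - Complex.log (γ p) := by
    intro p q γ v hγ hs
    rw [← intervalIntegral.integral_const_mul]
    refine integral_eq_sub_of_hasDerivAt (f := fun x => Complex.log (γ x)) ?_ ?_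
    · intro x hx
      have := (hγ x).clog_real (hs x hx)
      simpa [div_eq_mul_inv] using this
    · refine ContinuousOn.intervalIntegrable ?_
      have hc : Continuous γ := continuous_iff_continuousAt.2 fun x => (hγ x).continuousAt
      exact continuousOn_const.mul (continuousOn_const.div hc.continuousOn
        fun x hx => Complex.slitPlane_ne_zero (hs x hx))
  have hbot := key a b (fun x => x + (-T : ℝ) * Complex.I - ρ) 1
    (fun x => ((hof x).add_const _).sub_const ρ)
    (fun x _ => by
      rw [Complex.mem_slitPlane_iff]; right; simp; linarith)
  have htop := key a b (fun x => x + T * Complex.I - ρ) 1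
    (fun x => ((hof x).add_const _).sub_const ρ)
    (fun x _ => by
      rw [Complex.mem_slitPlane_iff]; right; simp; linarith)
  have hright := key (-T) T (fun y => b + y * Complex.I - ρ) Complex.I
    (fun x => by
      simpa only [one_mul] using (((hof x).mul_const Complex.I).const_add (b : ℂ)).sub_const ρ)
    (fun x _ => by
      rw [Complex.mem_slitPlane_iff]; left; simp; linarith)
  have hleft := key (-T) T (fun y => -(a + y * Complex.I - ρ)) (-Complex.I)
    (fun x => by
      simpa only [one_mul] using
        ((((hof x).mul_const Complex.I).const_add (a : ℂ)).sub_const ρ).fun_neg)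
    (fun x _ => by
      rw [Complex.mem_slitPlane_iff]; left; simp; linarith)
  have hleft' : Complex.I * ∫ y : ℝ in (-T)..T, 1 / ((a : ℂ) + y * Complex.I - ρ) =
      Complex.log (-((a : ℂ) + T * Complex.I - ρ)) -
        Complex.log (-((a : ℂ) + (-T : ℝ) * Complex.I - ρ)) := by
    rw [← hleft]
    simp only [one_div, inv_neg, intervalIntegral.integral_neg]
    ring
  have hpos : Complex.log (-((a : ℂ) + T * Complex.I - ρ)) =
      Complex.log ((a : ℂ) + T * Complex.I - ρ) - Real.pi * Complex.I := by
    have him : 0 < ((a : ℂ) + T * Complex.I - ρ).im := by simp; linarith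
    rw [Complex.log, Complex.log, norm_neg, Complex.arg_neg_eq_arg_sub_pi_of_im_pos him]
    push_cast; ring
  have hneg : Complex.log (-((a : ℂ) + (-T : ℝ) * Complex.I - ρ)) =
      Complex.log ((a : ℂ) + (-T : ℝ) * Complex.I - ρ) + Real.pi * Complex.I := by
    have him : ((a : ℂ) + (-T : ℝ) * Complex.I - ρ).im < 0 := by simp; linarith
    rw [Complex.log, Complex.log, norm_neg, Complex.arg_neg_eq_arg_add_pi_of_im_neg him]
    push_cast; ring
  rw [one_mul] at hbot htop
  unfold rectIntegral
  rw [hbot, htop, hright, hleft', hpos, hneg]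
  ring

theorem rect_interior_of_notMem_rectBoundary {a b T : ℝ} {s : ℂ} (h : s ∈ rect a b T)
    (h' : s ∉ rectBoundary a b T) : a < s.re ∧ s.re < b ∧ |s.im| < T := by
  obtain ⟨h1, h2, h3⟩ := h
  refine ⟨lt_of_le_of_ne h1 fun e => h' ⟨⟨h1, h2, h3⟩, Or.inl e.symm⟩,
    lt_of_le_of_ne h2 fun e => h' ⟨⟨h1, h2, h3⟩, Or.inr (Or.inl e)⟩,
    lt_of_le_of_ne h3 fun e => h' ⟨⟨h1, h2, h3⟩, Or.inr (Or.inr e)⟩⟩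

theorem continuousOn_div_sub_rectBoundary {a b T : ℝ} {ρ : ℂ} (ha : a < ρ.re) (hb : ρ.re < b)
    (hT : |ρ.im| < T) {h : ℂ → ℂ} (hc : ContinuousOn h (rectBoundary a b T)) :
    ContinuousOn (fun s => h s / (s - ρ)) (rectBoundary a b T) := by
  refine hc.div (by fun_prop) fun s hs h0 => ?_
  rw [sub_eq_zero] at h0
  subst h0
  rcases hs.2 with h | h | h <;> linarith

/-- Cauchy's integral formula for a rectangle. -/
theorem rectIntegral_div_sub {a b T : ℝ} {ρ : ℂ} (ha : a < ρ.re) (hb : ρ.re < b)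
    (hT : |ρ.im| < T) {h : ℂ → ℂ} {U : Set ℂ} (hU : IsOpen U) (hrect : rect a b T ⊆ U)
    (hh : DifferentiableOn ℂ h U) :
    rectIntegral (fun s => h s / (s - ρ)) a b T = 2 * Real.pi * Complex.I * h ρ := by
  have hab : a ≤ b := by linarith
  have hT0 : 0 ≤ T := (abs_nonneg _).trans hT.le
  have hρ : ρ ∈ rect a b T := ⟨ha.le, hb.le, hT.le⟩
  have hd : DifferentiableOn ℂ (dslope h ρ) U :=
    (Complex.differentiableOn_dslope (hU.mem_nhds (hrect hρ))).2 hh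
  have hsub : rectBoundary a b T ⊆ U := fun s hs => hrect hs.1
  have e : ∀ s ∈ rectBoundary a b T, h s / (s - ρ) = dslope h ρ s + h ρ * (1 / (s - ρ)) := by
    intro s hs
    have hne : s ≠ ρ := by
      rintro rfl
      rcases hs.2 with h | h | h <;> linarith
    rw [dslope_of_ne _ hne, slope_def_field]
    have := sub_ne_zero.2 hne
    field_simp
    ring
  have hc : ContinuousOn (fun s => h ρ * (1 / (s - ρ))) (rectBoundary a b T) :=
    continuousOn_const.mul (continuousOn_div_sub_rectBoundary ha hb hT continuousOn_const)
  rw [rectIntegral_congr hab hT0 e, rectIntegral_add hab hT0 (hd.continuousOn.mono hsub) hc,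
    rectIntegral_eq_zero hab hT0 (hd.mono hrect), rectIntegral_const_mul,
    rectIntegral_inv_sub ha hb hT]
  ring

/-- The argument principle in a rectangle, with a holomorphic weight. -/
theorem rectIntegral_logDeriv_mul {a b T : ℝ} (hab : a ≤ b) (hT : 0 ≤ T) {f h : ℂ → ℂ}
    (hf : Differentiable ℂ f) (hf0 : ∀ s ∈ rectBoundary a b T, f s ≠ 0) {U : Set ℂ}
    (hU : IsOpen U) (hrect : rect a b T ⊆ U) (hh : DifferentiableOn ℂ h U) {S : Finset ℂ}
    (hS : ∀ ρ, ρ ∈ S ↔ ρ ∈ rect a b T ∧ f ρ = 0) :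
    rectIntegral (fun s => logDeriv f s * h s) a b T =
      2 * Real.pi * Complex.I * ∑ ρ ∈ S, (analyticOrderNatAt f ρ : ℂ) * h ρ := by
  have hcorner : f (a + T * Complex.I) ≠ 0 := hf0 _ (top_mem_rectBoundary hT ⟨le_rfl, hab⟩)
  obtain ⟨E, hE, hE0, hfE⟩ :=
    exists_eq_prod_pow_mul hf (analyticOrderAt_ne_top_of_exists_ne_zero hf hcorner) S
  have hEne : ∀ s ∈ rect a b T, E s ≠ 0 := by
    intro s hs h0
    exact hE0 s ((hS s).2 ⟨hs, by rw [hfE, h0, mul_zero]⟩) h0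
  have hin : ∀ ρ ∈ S, a < ρ.re ∧ ρ.re < b ∧ |ρ.im| < T := fun ρ hρ =>
    rect_interior_of_notMem_rectBoundary ((hS ρ).1 hρ).1 fun h => hf0 ρ h ((hS ρ).1 hρ).2
  have hsub : rectBoundary a b T ⊆ U := fun s hs => hrect hs.1
  have hdE : DifferentiableOn ℂ (fun s => logDeriv E s * h s) (rect a b T) := by
    intro s hs
    have h1 : DifferentiableAt ℂ (deriv E) s := (hE.analyticAt s).deriv.differentiableAt
    have h2 : DifferentiableAt ℂ (logDeriv E) s := h1.div (hE s) (hEne s hs)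
    exact h2.differentiableWithinAt.mul ((hh s (hrect hs)).mono hrect)
  have e : ∀ s ∈ rectBoundary a b T, logDeriv f s * h s =
      (∑ ρ ∈ S, (analyticOrderNatAt f ρ : ℂ) * (h s / (s - ρ))) + logDeriv E s * h s := by
    intro s hs
    have hsS : s ∉ S := fun h => hf0 s hs ((hS s).1 h).2
    rw [logDeriv_eq_sum_add_logDeriv hE hfE hsS (hEne s hs.1), add_mul, Finset.sum_mul]
    congr 1
    exact Finset.sum_congr rfl fun ρ _ => by ring
  have hcont : ∀ ρ ∈ S, ContinuousOn (fun s => (analyticOrderNatAt f ρ : ℂ) * (h s / (s - ρ)))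
      (rectBoundary a b T) := fun ρ hρ => by
    obtain ⟨h1, h2, h3⟩ := hin ρ hρ
    exact continuousOn_const.mul
      (continuousOn_div_sub_rectBoundary h1 h2 h3 (hh.continuousOn.mono hsub))
  rw [rectIntegral_congr hab hT e, rectIntegral_add hab hT (continuousOn_finsetSum S hcont)
    (hdE.continuousOn.mono fun s hs => hs.1), rectIntegral_eq_zero hab hT hdE, add_zero,
    rectIntegral_sum S hab hT hcont, Finset.mul_sum]
  refine Finset.sum_congr rfl fun ρ hρ => ?_
  obtain ⟨h1, h2, h3⟩ := hin ρ hρ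
  rw [rectIntegral_const_mul, rectIntegral_div_sub h1 h2 h3 hU hrect hh]
  ring

/-! ### The completed zeta function -/

/-- The entire function `s (s - 1) π ^ (-s / 2) Γ(s / 2) ζ(s)`, whose zeros are the zeros of the
zeta function in the critical strip. -/
noncomputable def xi (s : ℂ) : ℂ := 1 + s * (s - 1) * completedRiemannZeta₀ s

theorem differentiable_xi : Differentiable ℂ xi := by
  have := differentiable_completedZeta₀
  unfold xi
  fun_prop

theorem xi_one_sub (s : ℂ) : xi (1 - s) = xi s := by
  unfold xi
  rw [completedRiemannZeta₀_one_sub]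
  ring

theorem xi_eq {s : ℂ} (hs : 0 < s.re) : xi s = s * Complex.Gammaℝ s * riemannZeta₁ s := by
  have h0 : s ≠ 0 := by rintro rfl; simp at hs
  by_cases h1 : s = 1
  · subst h1
    simp [xi, Complex.Gammaℝ_one]
  · have h2 : s - 1 ≠ 0 := sub_ne_zero.2 h1
    have h3 : 1 - s ≠ 0 := sub_ne_zero.2 (Ne.symm h1)
    have hG := Complex.Gammaℝ_ne_zero_of_re_pos hs
    have e1 := riemannZeta_eq_inv_sub_mul h1
    rw [riemannZeta_def_of_ne_zero h0, completedRiemannZeta_eq] at e1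
    have e2 : riemannZeta₁ s =
        (s - 1) * ((completedRiemannZeta₀ s - 1 / s - 1 / (1 - s)) / Complex.Gammaℝ s) := by
      rw [e1]; field_simp
    rw [e2]
    unfold xi
    field_simp
    ring

theorem riemannZeta₁_eq_mul {s : ℂ} (hs : s ≠ 1) : riemannZeta₁ s = (s - 1) * riemannZeta s := by
  rw [riemannZeta_eq_inv_sub_mul hs]
  have : s - 1 ≠ 0 := sub_ne_zero.2 hs
  field_simp

theorem riemannZeta₁_ne_zero_of_one_le_re {s : ℂ} (hs : 1 ≤ s.re) : riemannZeta₁ s ≠ 0 := by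
  by_cases h1 : s = 1
  · rw [h1, riemannZeta₁_one]; exact one_ne_zero
  · rw [riemannZeta₁_eq_mul h1]
    exact mul_ne_zero (sub_ne_zero.2 h1) (riemannZeta_ne_zero_of_one_le_re hs)

theorem xi_eq_zero_iff {s : ℂ} (hs : 0 < s.re) : xi s = 0 ↔ riemannZeta₁ s = 0 := by
  have h0 : s ≠ 0 := by rintro rfl; simp at hs
  rw [xi_eq hs]
  simp [h0, Complex.Gammaℝ_ne_zero_of_re_pos hs]

theorem xi_ne_zero_of_one_le_re {s : ℂ} (hs : 1 ≤ s.re) : xi s ≠ 0 := by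
  rw [Ne, xi_eq_zero_iff (by linarith)]
  exact riemannZeta₁_ne_zero_of_one_le_re hs

theorem xi_ne_zero_of_re_nonpos {s : ℂ} (hs : s.re ≤ 0) : xi s ≠ 0 := by
  rw [← xi_one_sub]
  exact xi_ne_zero_of_one_le_re (by simp; linarith)

theorem xi_eq_zero_iff_riemannZeta {s : ℂ} :
    xi s = 0 ↔ riemannZeta s = 0 ∧ 0 < s.re ∧ s.re < 1 := by
  constructor
  · intro h
    have h1 : 0 < s.re := by
      by_contra h'
      exact xi_ne_zero_of_re_nonpos (not_lt.1 h') h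
    have h2 : s.re < 1 := by
      by_contra h'
      exact xi_ne_zero_of_one_le_re (not_lt.1 h') h
    have hs1 : s ≠ 1 := by rintro rfl; simp at h2
    rw [xi_eq_zero_iff h1, riemannZeta₁_eq_mul hs1] at h
    exact ⟨(mul_eq_zero.1 h).resolve_left (sub_ne_zero.2 hs1), h1, h2⟩
  · rintro ⟨h, h1, h2⟩
    have hs1 : s ≠ 1 := by rintro rfl; simp at h2
    rw [xi_eq_zero_iff h1, riemannZeta₁_eq_mul hs1, h, mul_zero]

theorem analyticOrderAt_mul_of_ne_zero {f h : ℂ → ℂ} {z : ℂ} (hf : AnalyticAt ℂ f z)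
    (hh : AnalyticAt ℂ h z) (h0 : h z ≠ 0) : analyticOrderAt (h * f) z = analyticOrderAt f z := by
  rw [analyticOrderAt_mul hh hf, hh.analyticOrderAt_eq_zero.2 h0, zero_add]

theorem analyticOrderNatAt_xi {s : ℂ} (hs : 0 < s.re) :
    analyticOrderNatAt xi s = analyticOrderNatAt riemannZeta₁ s := by
  have hU : IsOpen {z : ℂ | 0 < z.re} := isOpen_lt continuous_const Complex.continuous_re
  have h0 : s ≠ 0 := by rintro rfl; simp at hs
  have hG : AnalyticAt ℂ (fun z => z * Complex.Gammaℝ z) s := by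
    refine DifferentiableOn.analyticAt (s := {z : ℂ | 0 < z.re}) (fun z hz => ?_) (hU.mem_nhds hs)
    exact (differentiableAt_id.mul (differentiableAt_Gammaℝ hz)).differentiableWithinAt
  have e : xi =ᶠ[𝓝 s] (fun z => z * Complex.Gammaℝ z) * riemannZeta₁ := by
    filter_upwards [hU.mem_nhds hs] with z hz using xi_eq hz
  unfold analyticOrderNatAt
  rw [analyticOrderAt_congr e, analyticOrderAt_mul_of_ne_zero
    (differentiable_riemannZeta₁.analyticAt s) hG
    (mul_ne_zero h0 (Complex.Gammaℝ_ne_zero_of_re_pos hs))]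

theorem analyticOrderNatAt_riemannZeta₁ {s : ℂ} (hs : s ≠ 1) :
    analyticOrderNatAt riemannZeta₁ s = analyticOrderNatAt riemannZeta s := by
  have e : riemannZeta₁ =ᶠ[𝓝 s] (fun z => z - 1) * riemannZeta := by
    filter_upwards [isOpen_ne.mem_nhds hs] with z hz using riemannZeta₁_eq_mul hz
  unfold analyticOrderNatAt
  rw [analyticOrderAt_congr e, analyticOrderAt_mul_of_ne_zero (h := fun z => z - 1)
    (analyticOn_riemannZeta s hs) (by fun_prop) (sub_ne_zero.2 hs)]

theorem analyticOrderNatAt_xi_one_sub (s : ℂ) :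
    analyticOrderNatAt xi (1 - s) = analyticOrderNatAt xi s := by
  have h := analyticOrderAt_comp_of_deriv_ne_zero (f := xi) (g := fun z : ℂ => 1 - z) (z₀ := s)
    (by fun_prop) (by simp)
  have e : xi ∘ (fun z : ℂ => 1 - z) = xi := funext xi_one_sub
  rw [e] at h
  unfold analyticOrderNatAt
  rw [h]

theorem analyticOrderNatAt_riemannZeta_of_strip {s : ℂ} (h1 : 0 < s.re) (h2 : s.re < 1) :
    analyticOrderNatAt xi s = analyticOrderNatAt riemannZeta s := by
  have hs1 : s ≠ 1 := by rintro rfl; simp at h2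
  rw [analyticOrderNatAt_xi h1, analyticOrderNatAt_riemannZeta₁ hs1]

/-- The logarithmic derivative of `π ^ (-s / 2) Γ(s / 2) ζ(s)`. -/
noncomputable def completedLogDeriv (s : ℂ) : ℂ := logDeriv xi s - 1 / s - 1 / (s - 1)

theorem completedLogDeriv_one_sub (s : ℂ) :
    completedLogDeriv (1 - s) = -completedLogDeriv s := by
  have h1 : logDeriv xi (1 - s) = -logDeriv xi s := by
    have h := logDeriv_comp (f := xi) (g := fun z : ℂ => 1 - z) (x := s) (differentiable_xi _)
      (by fun_prop)
    have e : xi ∘ (fun z : ℂ => 1 - z) = xi := funext xi_one_sub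
    rw [e] at h
    rw [h]
    simp
  unfold completedLogDeriv
  rw [h1, show (1 : ℂ) - s - 1 = -s by ring, show (1 : ℂ) - s = -(s - 1) by ring, div_neg, div_neg]
  ring

theorem completedLogDeriv_eq {s : ℂ} (hs : 0 < s.re) (h1 : riemannZeta₁ s ≠ 0) :
    completedLogDeriv s =
      logDeriv Complex.Gammaℝ s + logDeriv riemannZeta₁ s - 1 / (s - 1) := by
  have hU : IsOpen {z : ℂ | 0 < z.re} := isOpen_lt continuous_const Complex.continuous_re
  have h0 : s ≠ 0 := by rintro rfl; simp at hs
  have hG := Complex.Gammaℝ_ne_zero_of_re_pos hs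
  have e : xi =ᶠ[𝓝 s] fun z => (z * Complex.Gammaℝ z) * riemannZeta₁ z := by
    filter_upwards [hU.mem_nhds hs] with z hz using xi_eq hz
  have e2 : logDeriv xi s = 1 / s + logDeriv Complex.Gammaℝ s + logDeriv riemannZeta₁ s := by
    rw [logDeriv_apply, e.deriv_eq, e.self_of_nhds,
      ← logDeriv_apply (fun z => (z * Complex.Gammaℝ z) * riemannZeta₁ z),
      logDeriv_mul (f := fun z => z * Complex.Gammaℝ z) s (mul_ne_zero h0 hG) h1
        (differentiableAt_id.mul (differentiableAt_Gammaℝ hs)) (differentiable_riemannZeta₁ s),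
      logDeriv_mul (f := fun z => z) s h0 hG differentiableAt_id (differentiableAt_Gammaℝ hs)]
    simp [logDeriv_apply]
  unfold completedLogDeriv
  rw [e2]
  ring

theorem completedLogDeriv_eq_of_one_lt_re {s : ℂ} (hs : 1 < s.re) :
    completedLogDeriv s = deriv Complex.Gammaℝ s / Complex.Gammaℝ s +
      deriv riemannZeta s / riemannZeta s := by
  have hs1 : s ≠ 1 := by rintro rfl; simp at hs
  have hz := riemannZeta_ne_zero_of_one_le_re hs.le
  have e : riemannZeta₁ =ᶠ[𝓝 s] fun z => (z - 1) * riemannZeta z := by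
    filter_upwards [isOpen_ne.mem_nhds hs1] with z hz using riemannZeta₁_eq_mul hz
  have e2 : logDeriv riemannZeta₁ s = 1 / (s - 1) + logDeriv riemannZeta s := by
    rw [logDeriv_apply, e.deriv_eq, e.self_of_nhds,
      ← logDeriv_apply (fun z => (z - 1) * riemannZeta z),
      logDeriv_mul (f := fun z => z - 1) s (sub_ne_zero.2 hs1) hz (by fun_prop)
        (differentiableAt_riemannZeta hs1)]
    simp [logDeriv_apply]
  rw [completedLogDeriv_eq (by linarith) (riemannZeta₁_ne_zero_of_one_le_re hs.le), e2,
    logDeriv_apply, logDeriv_apply]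
  ring

/-! ### The explicit formula at a finite height -/

theorem segmentIntegral_congr {F G : ℂ → ℂ} {c T : ℝ}
    (h : ∀ t : ℝ, F (c + t * Complex.I) = G (c + t * Complex.I)) :
    segmentIntegral F c T = segmentIntegral G c T := by
  unfold segmentIntegral
  simp only [h]

theorem segmentIntegral_add {F G : ℂ → ℂ} {c T : ℝ}
    (hF : Continuous fun t : ℝ => F (c + t * Complex.I))
    (hG : Continuous fun t : ℝ => G (c + t * Complex.I)) :
    segmentIntegral (fun s => F s + G s) c T = segmentIntegral F c T + segmentIntegral G c T := by
  unfold segmentIntegral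
  have h1 : Continuous fun t : ℝ => F (c + t * Complex.I) * Complex.I := hF.mul continuous_const
  have h2 : Continuous fun t : ℝ => G (c + t * Complex.I) * Complex.I := hG.mul continuous_const
  rw [← mul_add, ← intervalIntegral.integral_add (h1.intervalIntegrable _ _)
    (h2.intervalIntegrable _ _)]
  simp only [add_mul]

/-- The substitution `s ↦ 1 - s` in an integral along a vertical segment. -/
theorem segmentIntegral_one_sub (F : ℂ → ℂ) (c T : ℝ) :
    segmentIntegral F (1 - c) T = segmentIntegral (fun s => F (1 - s)) c T := by
  unfold segmentIntegral
  congr 1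
  have h := intervalIntegral.integral_comp_neg (a := -T) (b := T)
    (fun t : ℝ => F ((1 - c : ℝ) + t * Complex.I) * Complex.I)
  rw [neg_neg] at h
  rw [← h]
  refine intervalIntegral.integral_congr fun t _ => ?_
  congr 2
  push_cast
  ring

/-- The horizontal sides of the rectangle, as the error in replacing its boundary by the vertical
sides. -/
theorem norm_rectIntegral_sub_le {F : ℂ → ℂ} {a b T B : ℝ} (hab : a ≤ b) (hT : 0 ≤ T)
    (hB : ∀ s : ℂ, a ≤ s.re → s.re ≤ b → |s.im| = T → ‖F s‖ ≤ B) :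
    ‖1 / (2 * Real.pi * Complex.I) * rectIntegral F a b T -
      (segmentIntegral F b T - segmentIntegral F a T)‖ ≤ B * (b - a) := by
  have hbot : ‖∫ x : ℝ in a..b, F (x + (-T : ℝ) * Complex.I)‖ ≤ B * (b - a) := by
    rw [← abs_of_nonneg (sub_nonneg.2 hab)]
    refine intervalIntegral.norm_integral_le_of_norm_le_const fun x hx => ?_
    rw [uIoc_of_le hab] at hx
    exact hB _ (by simpa using hx.1.le) (by simpa using hx.2) (by simp [abs_of_nonneg hT])
  have htop : ‖∫ x : ℝ in a..b, F (x + T * Complex.I)‖ ≤ B * (b - a) := by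
    rw [← abs_of_nonneg (sub_nonneg.2 hab)]
    refine intervalIntegral.norm_integral_le_of_norm_le_const fun x hx => ?_
    rw [uIoc_of_le hab] at hx
    exact hB _ (by simpa using hx.1.le) (by simpa using hx.2) (by simp [abs_of_nonneg hT])
  have hpi : (2 * Real.pi * Complex.I : ℂ) ≠ 0 := Complex.two_pi_I_ne_zero
  have e : 1 / (2 * Real.pi * Complex.I) * rectIntegral F a b T -
      (segmentIntegral F b T - segmentIntegral F a T) = 1 / (2 * Real.pi * Complex.I) *
      ((∫ x : ℝ in a..b, F (x + (-T : ℝ) * Complex.I)) -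
        ∫ x : ℝ in a..b, F (x + T * Complex.I)) := by
    unfold rectIntegral segmentIntegral
    simp only [intervalIntegral.integral_mul_const]
    ring
  have hn : ‖(1 / (2 * Real.pi * Complex.I) : ℂ)‖ ≤ 1 / 2 := by
    rw [norm_div, norm_mul, norm_mul]
    simp only [norm_one, Complex.norm_ofNat, Complex.norm_real, Complex.norm_I, mul_one,
      Real.norm_eq_abs, abs_of_pos Real.pi_pos]
    have := Real.pi_gt_three
    gcongr
    linarith
  rw [e, norm_mul]
  have h3 := (norm_sub_le (∫ x : ℝ in a..b, F (x + (-T : ℝ) * Complex.I))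
    (∫ x : ℝ in a..b, F (x + T * Complex.I))).trans (add_le_add hbot htop)
  calc _ ≤ 1 / 2 * (B * (b - a) + B * (b - a)) := by gcongr
    _ = _ := by ring

/-- The strip in which the Mellin transform of `g` is holomorphic. -/
def strip (ε : ℝ) : Set ℂ := {s | -ε < s.re ∧ s.re < 1 + ε}

theorem isOpen_strip (ε : ℝ) : IsOpen (strip ε) :=
  (isOpen_lt continuous_const Complex.continuous_re).inter
    (isOpen_lt Complex.continuous_re continuous_const)

theorem CondA.differentiableOn_mellin {ε : ℝ} (hε : 0 < ε) {g : ℝ → ℂ} (hA : CondA ε g) :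
    DifferentiableOn ℂ (mellin g) (strip ε) := fun _ hs =>
  (hA.differentiableAt_mellin hε hs.1 hs.2).differentiableWithinAt

theorem differentiableAt_logDeriv_Gammaℝ {s : ℂ} (hs : 0 < s.re) :
    DifferentiableAt ℂ (fun s => deriv Complex.Gammaℝ s / Complex.Gammaℝ s) s := by
  have hU : IsOpen {z : ℂ | 0 < z.re} := isOpen_lt continuous_const Complex.continuous_re
  have h1 : DifferentiableOn ℂ Complex.Gammaℝ {z : ℂ | 0 < z.re} :=
    fun z hz => (differentiableAt_Gammaℝ hz).differentiableWithinAt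
  exact ((h1.deriv hU).differentiableAt (hU.mem_nhds hs)).div (differentiableAt_Gammaℝ hs)
    (Complex.Gammaℝ_ne_zero_of_re_pos hs)

theorem CondA.differentiableAt_archIntegrand {ε : ℝ} (hε : 0 < ε) {g : ℝ → ℂ} (hA : CondA ε g)
    {s : ℂ} (h1 : 0 < s.re) (h2 : s.re < 1 + ε) : DifferentiableAt ℂ (archIntegrand g) s := by
  have h3 := hA.differentiableAt_mellin hε (s := s) (by linarith) h2
  have h4 := hA.differentiableAt_mellin hε (s := 1 - s) (by simp; linarith) (by simp; linarith)
  have h5 := DifferentiableAt.comp s (g := mellin g) (f := fun s : ℂ => 1 - s) h4 (by fun_prop)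
  exact (differentiableAt_logDeriv_Gammaℝ h1).neg.mul (h3.add h5)

theorem continuous_comp_line {F : ℂ → ℂ} {c : ℝ}
    (h : ∀ s : ℂ, s.re = c → ContinuousAt F s) :
    Continuous fun t : ℝ => F (c + t * Complex.I) := by
  refine continuous_iff_continuousAt.2 fun t => ?_
  exact ContinuousAt.comp (g := F) (f := fun t : ℝ => (c : ℂ) + t * Complex.I) (h _ (by simp))
    (by fun_prop)

/-- The logarithmic derivative of the Gamma factor grows like `|t| ^ (1 / 2)` at most, the Mellin
transform decays like `1 / |t|`. -/
theorem CondA.exists_norm_archIntegrand_le {ε : ℝ} {g : ℝ → ℂ} (hA : CondA ε g)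
    {a b : ℝ} (ha : 0 < a) (hb : b < 1 + ε) (hε : 0 < ε) :
    ∃ C, 0 ≤ C ∧ ∀ s : ℂ, a ≤ s.re → s.re ≤ b → 1 ≤ |s.im| →
      ‖archIntegrand g s‖ ≤ C / √|s.im| := by
  obtain ⟨C, hC0, hC⟩ := exists_norm_logDeriv_Gammaℝ_le (a := a) (b := b) ha
  obtain ⟨M, hM0, hM⟩ := hA.exists_norm_mellin_le
  refine ⟨C * (2 * M), by positivity, fun s h1 h2 h3 => ?_⟩
  have h0 : s.im ≠ 0 := by intro h; rw [h, abs_zero] at h3; linarith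
  have hm1 := hM s (by linarith) (by linarith) h0
  have hm2 := hM (1 - s) (by simp; linarith) (by simp; linarith) (by simpa using h0)
  have him : |(1 - s).im| = |s.im| := by simp
  rw [him] at hm2
  have hpos : 0 < √|s.im| := Real.sqrt_pos.2 (by linarith)
  have hsq : √|s.im| * √|s.im| = |s.im| := Real.mul_self_sqrt (by linarith)
  unfold archIntegrand
  rw [norm_mul, norm_neg, ← logDeriv_apply]
  calc _ ≤ C * √|s.im| * (M / |s.im| + M / |s.im|) := by
        gcongr
        · exact hC s h1 h2 h3
        · exact (norm_add_le _ _).trans (add_le_add hm1 hm2)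
    _ = C * (2 * M) / √|s.im| := by
        have e : M / |s.im| = M / (√|s.im| * √|s.im|) := by rw [hsq]
        rw [e]; field_simp; ring

/-- The archimedean integral may be moved between vertical lines. -/
theorem CondA.tendsto_segmentIntegral_arch_sub {ε : ℝ} (hε : 0 < ε) {g : ℝ → ℂ}
    (hA : CondA ε g) {a b : ℝ} (ha : 0 < a) (hab : a ≤ b) (hb : b < 1 + ε) :
    Tendsto (fun T => segmentIntegral (archIntegrand g) b T - segmentIntegral (archIntegrand g) a T)
      atTop (𝓝 0) := by
  obtain ⟨C, hC0, hC⟩ := hA.exists_norm_archIntegrand_le ha hb hε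
  have hlim : Tendsto (fun T : ℝ => C / √T * (b - a)) atTop (𝓝 (0 * (b - a))) :=
    ((tendsto_const_nhds (x := C)).div_atTop Real.tendsto_sqrt_atTop).mul_const _
  rw [zero_mul] at hlim
  refine squeeze_zero_norm' ?_ hlim
  filter_upwards [eventually_ge_atTop 1] with T hT
  have h := norm_rectIntegral_sub_le (F := archIntegrand g) (B := C / √T) hab (by linarith : 0 ≤ T)
    (fun s h1 h2 h3 => by
      have := hC s h1 h2 (by rw [h3]; exact hT)
      rwa [h3] at this)
  rwa [rectIntegral_eq_zero hab (by linarith) fun s hs =>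
    (hA.differentiableAt_archIntegrand hε (by linarith [hs.1]) (by linarith [hs.2.1])
      ).differentiableWithinAt, mul_zero, zero_sub, norm_neg] at h

theorem log_sq_le_sqrt {N : ℕ} (hN : 1 ≤ N) :
    Real.log ((N : ℝ) + 5) ^ 2 ≤ 48 * √(N : ℝ) := by
  have hN' : (1 : ℝ) ≤ N := by exact_mod_cast hN
  have h0 : 0 ≤ Real.log ((N : ℝ) + 5) := zero_le_one.trans (one_le_log_natCast_add_five N)
  have h1 := Real.log_le_rpow_div (x := (N : ℝ) + 5) (ε := 1 / 4) (by positivity) (by norm_num)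
  have h2 : (((N : ℝ) + 5) ^ (1 / 4 : ℝ)) ^ 2 = √((N : ℝ) + 5) := by
    rw [← Real.rpow_natCast, ← Real.rpow_mul (by positivity), Real.sqrt_eq_rpow]
    norm_num
  have h3 : √((N : ℝ) + 5) ≤ 3 * √(N : ℝ) := by
    rw [Real.sqrt_le_left (by positivity), mul_pow, Real.sq_sqrt (by positivity)]
    linarith
  calc Real.log ((N : ℝ) + 5) ^ 2 ≤ (((N : ℝ) + 5) ^ (1 / 4 : ℝ) / (1 / 4)) ^ 2 := by gcongr
    _ = 16 * √((N : ℝ) + 5) := by rw [div_pow, h2]; ring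
    _ ≤ _ := by linarith

/-- Heights at which the completed zeta function has no zeros and its logarithmic derivative is
`O(√N)`, and a bound for the number of zeros between consecutive integral heights. -/
theorem exists_xi_window_bounds : ∃ C : ℝ, 0 ≤ C ∧ ∀ N : ℕ, 1 ≤ N →
    (∀ Z : Finset ℂ, (∀ ρ ∈ Z, xi ρ = 0 ∧ (N : ℝ) ≤ |ρ.im| ∧ |ρ.im| ≤ N + 1) →
      ∑ ρ ∈ Z, (analyticOrderNatAt xi ρ : ℝ) ≤ C * √(N : ℝ)) ∧
    ∃ T : ℝ, (N : ℝ) ≤ T ∧ T ≤ N + 1 ∧ ∀ s : ℂ, -1 ≤ s.re → s.re ≤ 2 → |s.im| = T →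
      xi s ≠ 0 ∧ ‖completedLogDeriv s‖ ≤ C * √(N : ℝ) := by
  classical
  obtain ⟨C₁, hC₁0, hC₁⟩ := exists_zeta_window_bounds
  obtain ⟨C₂, hC₂0, hC₂⟩ := exists_norm_logDeriv_Gammaℝ_le (a := 1 / 2) (b := 2) (by norm_num)
  refine ⟨96 * C₁ + 2 * C₂ + 1, by positivity, fun N hN => ?_⟩
  have hN' : (1 : ℝ) ≤ N := by exact_mod_cast hN
  obtain ⟨hZ, T, hT1, hT2, hT⟩ := hC₁ N
  have hl1 := one_le_log_natCast_add_five N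
  have hl2 := log_sq_le_sqrt hN
  have hl3 : Real.log ((N : ℝ) + 5) ≤ 48 * √(N : ℝ) := by nlinarith
  have hs1 : 1 ≤ √(N : ℝ) := Real.one_le_sqrt.2 hN'
  refine ⟨?_, T, hT1, hT2, ?_⟩
  · intro Z hZ'
    -- The functional equation reflects the zeros with `Re ρ < 1 / 2` into the half-window.
    set Z₁ := Z.filter fun ρ => 1 / 2 ≤ ρ.re with hZ₁
    set Z₂ := (Z.filter fun ρ => ¬ 1 / 2 ≤ ρ.re).image fun ρ => 1 - ρ with hZ₂
    have hstrip : ∀ ρ ∈ Z, 0 < ρ.re ∧ ρ.re < 1 := fun ρ hρ =>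
      (xi_eq_zero_iff_riemannZeta.1 (hZ' ρ hρ).1).2
    have h1 : ∑ ρ ∈ Z₁, (analyticOrderNatAt xi ρ : ℝ) ≤ C₁ * Real.log ((N : ℝ) + 5) := by
      rw [Finset.sum_congr rfl fun ρ hρ => by
        rw [analyticOrderNatAt_xi (hstrip ρ (Finset.mem_filter.1 hρ).1).1]]
      refine hZ Z₁ fun ρ hρ => ?_
      obtain ⟨hm, hre⟩ := Finset.mem_filter.1 hρ
      obtain ⟨h0, h2, h3⟩ := hZ' ρ hm
      have h4 := hstrip ρ hm
      exact ⟨(xi_eq_zero_iff h4.1).1 h0, hre, by linarith, h2, h3⟩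
    have h2 : ∑ ρ ∈ Z.filter (fun ρ => ¬ 1 / 2 ≤ ρ.re), (analyticOrderNatAt xi ρ : ℝ) ≤
        C₁ * Real.log ((N : ℝ) + 5) := by
      have e : ∑ ρ ∈ Z.filter (fun ρ => ¬ 1 / 2 ≤ ρ.re), (analyticOrderNatAt xi ρ : ℝ) =
          ∑ ρ ∈ Z₂, (analyticOrderNatAt riemannZeta₁ ρ : ℝ) := by
        rw [hZ₂, Finset.sum_image (fun x _ y _ h => sub_right_injective h)]
        refine Finset.sum_congr rfl fun ρ hρ => ?_
        have h4 := hstrip ρ (Finset.mem_filter.1 hρ).1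
        rw [← analyticOrderNatAt_xi (s := 1 - ρ) (by simp; linarith), analyticOrderNatAt_xi_one_sub]
      rw [e]
      refine hZ Z₂ fun σ hσ => ?_
      obtain ⟨ρ, hρ, rfl⟩ := Finset.mem_image.1 hσ
      obtain ⟨hm, hre⟩ := Finset.mem_filter.1 hρ
      obtain ⟨h0, h2, h3⟩ := hZ' ρ hm
      have h4 := hstrip ρ hm
      have him : |(1 - ρ).im| = |ρ.im| := by simp
      rw [him]
      refine ⟨(xi_eq_zero_iff (by simp; linarith)).1 (by rwa [xi_one_sub]), ?_, ?_, h2, h3⟩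
      · simp only [Complex.sub_re, Complex.one_re]; linarith
      · simp only [Complex.sub_re, Complex.one_re]; linarith
    rw [← Finset.sum_filter_add_sum_filter_not Z fun ρ => 1 / 2 ≤ ρ.re]
    have h5 : C₁ * Real.log ((N : ℝ) + 5) ≤ C₁ * (48 * √(N : ℝ)) := by gcongr
    have h6 : 0 ≤ C₂ * √(N : ℝ) := by positivity
    nlinarith
  · have main : ∀ s : ℂ, 1 / 2 ≤ s.re → s.re ≤ 2 → |s.im| = T →
        xi s ≠ 0 ∧ ‖completedLogDeriv s‖ ≤ (96 * C₁ + 2 * C₂ + 1) * √(N : ℝ) := by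
      intro s h1 h2 h3
      obtain ⟨h4, h5⟩ := hT s h1 h2 h3
      have hre : 0 < s.re := by linarith
      refine ⟨fun h => h4 ((xi_eq_zero_iff hre).1 h), ?_⟩
      have him : 1 ≤ |s.im| := by rw [h3]; linarith
      have h6 := hC₂ s h1 h2 him
      have h7 : √|s.im| ≤ 2 * √(N : ℝ) := by
        rw [Real.sqrt_le_left (by positivity), mul_pow, Real.sq_sqrt (by positivity), h3]
        linarith
      have h8 : ‖1 / (s - 1)‖ ≤ 1 := by
        rw [norm_div, norm_one]
        have h9 : 1 ≤ ‖s - 1‖ := him.trans (by simpa using Complex.abs_im_le_norm (s - 1))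
        rw [div_le_one (by linarith)]
        exact h9
      rw [completedLogDeriv_eq hre h4]
      calc _ ≤ ‖logDeriv Complex.Gammaℝ s‖ + ‖logDeriv riemannZeta₁ s‖ + ‖1 / (s - 1)‖ :=
            (norm_sub_le _ _).trans (add_le_add_left (norm_add_le _ _) _)
        _ ≤ C₂ * (2 * √(N : ℝ)) + C₁ * (48 * √(N : ℝ)) + 1 * √(N : ℝ) := by
            gcongr
            · exact h6.trans (by gcongr)
            · exact h5.trans (by gcongr)
            · rw [one_mul]; exact h8.trans hs1
        _ ≤ _ := by
            have : 0 ≤ C₁ * √(N : ℝ) := by positivity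
            nlinarith
    intro s h1 h2 h3
    by_cases h : 1 / 2 ≤ s.re
    · exact main s h h2 h3
    · have h' := main (1 - s) (by simp; linarith) (by simp; linarith) (by simpa using h3)
      rwa [xi_one_sub, completedLogDeriv_one_sub, norm_neg] at h'

theorem mem_toFinset_zerosBelow_iff {a b T : ℝ} (ha : a ≤ 0) (hb : 1 ≤ b)
    (hT : ∀ s : ℂ, xi s = 0 → |s.im| ≠ T) (ρ : ℂ) :
    ρ ∈ (zerosBelow_finite T).toFinset ↔ ρ ∈ rect a b T ∧ xi ρ = 0 := by
  rw [Finite.mem_toFinset, xi_eq_zero_iff_riemannZeta]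
  constructor
  · rintro ⟨h0, h1, h2, h3⟩
    exact ⟨⟨by linarith, by linarith, h3.le⟩, h0, h1, h2⟩
  · rintro ⟨⟨-, -, h3⟩, h0, h1, h2⟩
    exact ⟨h0, h1, h2, lt_of_le_of_ne h3 (hT ρ (xi_eq_zero_iff_riemannZeta.2 ⟨h0, h1, h2⟩))⟩

/-- The residue theorem for the logarithmic derivative of the completed zeta function times the
Mellin transform. -/
theorem CondA.rectIntegral_completedLogDeriv_mul {ε : ℝ} (hε : 0 < ε) {g : ℝ → ℂ}
    (hA : CondA ε g) {a b T : ℝ} (ha : a < 0) (ha' : -ε < a) (hb : 1 < b) (hb' : b < 1 + ε)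
    (hT : 0 < T) (hxi : ∀ s : ℂ, xi s = 0 → |s.im| ≠ T) :
    rectIntegral (fun s => completedLogDeriv s * mellin g s) a b T =
      2 * Real.pi * Complex.I * (zeroSum g T - mellin g 0 - mellin g 1) := by
  have hab : a ≤ b := by linarith
  have hrect : rect a b T ⊆ strip ε := fun s hs => ⟨by linarith [hs.1], by linarith [hs.2.1]⟩
  have hd := hA.differentiableOn_mellin hε
  have hxi0 : ∀ s ∈ rectBoundary a b T, xi s ≠ 0 := by
    rintro s ⟨-, h | h | h⟩
    · exact xi_ne_zero_of_re_nonpos (by linarith)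
    · exact xi_ne_zero_of_one_le_re (by linarith)
    · exact fun h0 => hxi s h0 h
  have hzero := rectIntegral_logDeriv_mul hab hT.le differentiable_xi hxi0 (isOpen_strip ε) hrect hd
    (mem_toFinset_zerosBelow_iff ha.le hb.le hxi)
  have h0 := rectIntegral_div_sub (a := a) (b := b) (T := T) (ρ := 0) (by simpa using ha)
    (by simp; linarith) (by simpa using hT) (isOpen_strip ε) hrect hd
  have h1 := rectIntegral_div_sub (a := a) (b := b) (T := T) (ρ := 1) (by simp; linarith)
    (by simpa using hb) (by simpa using hT) (isOpen_strip ε) hrect hd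
  have hcm : ContinuousOn (mellin g) (rectBoundary a b T) :=
    hd.continuousOn.mono fun s hs => hrect hs.1
  have hc0 : ContinuousOn (fun s => (-1 : ℂ) * (mellin g s / (s - 0))) (rectBoundary a b T) :=
    continuousOn_const.mul (continuousOn_div_sub_rectBoundary (by simpa using ha)
      (by simp; linarith) (by simpa using hT) hcm)
  have hc1 : ContinuousOn (fun s => (-1 : ℂ) * (mellin g s / (s - 1))) (rectBoundary a b T) :=
    continuousOn_const.mul (continuousOn_div_sub_rectBoundary (by simp; linarith)
      (by simpa using hb) (by simpa using hT) hcm)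
  have hcl : ContinuousOn (fun s => logDeriv xi s * mellin g s) (rectBoundary a b T) := by
    refine ContinuousOn.mul (fun s hs => ?_) hcm
    have hx : DifferentiableAt ℂ (deriv xi) s :=
      (differentiable_xi.analyticAt s).deriv.differentiableAt
    exact (hx.div (differentiable_xi s) (hxi0 s hs)).continuousAt.continuousWithinAt
  have hc01 : ContinuousOn (fun s => logDeriv xi s * mellin g s +
      (-1 : ℂ) * (mellin g s / (s - 0))) (rectBoundary a b T) := hcl.add hc0
  have e : ∀ s ∈ rectBoundary a b T, completedLogDeriv s * mellin g s =
      (logDeriv xi s * mellin g s + (-1) * (mellin g s / (s - 0))) +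
        (-1) * (mellin g s / (s - 1)) := by
    intro s _
    unfold completedLogDeriv
    rw [sub_zero]
    ring
  have hsum : ∑ ρ ∈ (zerosBelow_finite T).toFinset,
      (analyticOrderNatAt xi ρ : ℂ) * mellin g ρ = zeroSum g T := by
    refine Finset.sum_congr rfl fun ρ hρ => ?_
    obtain ⟨-, h1, h2, -⟩ := (Finite.mem_toFinset _).1 hρ
    rw [analyticOrderNatAt_riemannZeta_of_strip h1 h2]
  rw [rectIntegral_congr hab hT.le e, rectIntegral_add hab hT.le hc01 hc1,
    rectIntegral_add hab hT.le hcl hc0, rectIntegral_const_mul, rectIntegral_const_mul, h0, h1,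
    hzero, hsum]
  ring

/-- By the functional equation, the two vertical sides of the contour combine into one integral,
which splits into an archimedean part and two Dirichlet series parts. -/
theorem CondA.segmentIntegral_completedLogDeriv {ε : ℝ} (hε : 0 < ε) {g : ℝ → ℂ}
    (hA : CondA ε g) {c : ℝ} (hc : 1 < c) (hc' : c < 1 + ε) (T : ℝ) :
    segmentIntegral (fun s => completedLogDeriv s * mellin g s) c T -
      segmentIntegral (fun s => completedLogDeriv s * mellin g s) (1 - c) T =
    -(segmentIntegral (archIntegrand g) c T +
      (segmentIntegral (fun s => -(deriv riemannZeta s / riemannZeta s) * mellin g s) c T +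
      segmentIntegral
        (fun s => -(deriv riemannZeta s / riemannZeta s) *
          mellin (ExplicitFormula.transpose g) s) c T)) := by
  set Z : ℂ → ℂ := fun s => -(deriv riemannZeta s / riemannZeta s) with hZ
  have hd1 : ∀ s : ℂ, s.re = c → ContinuousAt (mellin g) s := fun s hs =>
    (hA.differentiableAt_mellin hε (by linarith) (by linarith)).continuousAt
  have hd2 : ∀ s : ℂ, s.re = c → ContinuousAt (fun s => mellin g (1 - s)) s := fun s hs =>
    ContinuousAt.comp (g := mellin g) (f := fun s : ℂ => 1 - s)
      (hA.differentiableAt_mellin hε (by simp; linarith) (by simp; linarith)).continuousAt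
      (by fun_prop)
  have hdZ : ∀ s : ℂ, s.re = c → ContinuousAt Z s := fun s hs => by
    have hs1 : s ≠ 1 := by rintro rfl; simp at hs; linarith
    have ha := analyticOn_riemannZeta s hs1
    exact (ha.deriv.continuousAt.div ha.continuousAt
      (riemannZeta_ne_zero_of_one_le_re (by linarith))).neg
  have hdG : ∀ s : ℂ, s.re = c →
      ContinuousAt (fun s => deriv Complex.Gammaℝ s / Complex.Gammaℝ s) s := fun s hs =>
    (differentiableAt_logDeriv_Gammaℝ (by linarith)).continuousAt
  have hI1 := continuous_comp_line (F := fun s => Z s * mellin g s) (c := c)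
    fun s hs => (hdZ s hs).mul (hd1 s hs)
  have hI2 := continuous_comp_line (F := fun s => Z s * mellin g (1 - s)) (c := c)
    fun s hs => (hdZ s hs).mul (hd2 s hs)
  have hI3 := continuous_comp_line (F := archIntegrand g) (c := c) fun s hs =>
    (hA.differentiableAt_archIntegrand hε (by linarith) (by linarith)).continuousAt
  have hI4 := continuous_comp_line (c := c)
    (F := fun s => (deriv Complex.Gammaℝ s / Complex.Gammaℝ s - Z s) * mellin g s)
    fun s hs => ((hdG s hs).sub (hdZ s hs)).mul (hd1 s hs)
  have hI5 := continuous_comp_line (c := c)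
    (F := fun s => (deriv Complex.Gammaℝ s / Complex.Gammaℝ s - Z s) * mellin g (1 - s))
    fun s hs => ((hdG s hs).sub (hdZ s hs)).mul (hd2 s hs)
  have e1 : segmentIntegral (fun s => completedLogDeriv s * mellin g s) c T = segmentIntegral
      (fun s => (deriv Complex.Gammaℝ s / Complex.Gammaℝ s - Z s) * mellin g s) c T := by
    refine segmentIntegral_congr fun t => ?_
    simp only [hZ]
    rw [completedLogDeriv_eq_of_one_lt_re (by simpa using hc)]
    ring
  have e2 : segmentIntegral (fun s => completedLogDeriv s * mellin g s) (1 - c) T =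
      segmentIntegral (fun s => -((deriv Complex.Gammaℝ s / Complex.Gammaℝ s - Z s) *
        mellin g (1 - s))) c T := by
    rw [segmentIntegral_one_sub]
    refine segmentIntegral_congr fun t => ?_
    simp only [hZ]
    rw [completedLogDeriv_one_sub, completedLogDeriv_eq_of_one_lt_re (by simpa using hc)]
    ring
  have e3 : segmentIntegral (fun s => Z s * mellin (ExplicitFormula.transpose g) s) c T =
      segmentIntegral (fun s => Z s * mellin g (1 - s)) c T :=
    segmentIntegral_congr fun t => by simp only [mellin_transpose]
  have hneg : ∀ F : ℂ → ℂ, segmentIntegral (fun s => -F s) c T = -segmentIntegral F c T := by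
    intro F
    unfold segmentIntegral
    simp only [neg_mul, intervalIntegral.integral_neg, mul_neg]
  have hI12 : Continuous fun t : ℝ => (fun s => Z s * mellin g s + Z s * mellin g (1 - s))
      (c + t * Complex.I) := hI1.add hI2
  rw [e1, e2, e3, hneg, sub_neg_eq_add, ← segmentIntegral_add hI4 hI5,
    ← segmentIntegral_add hI1 hI2, ← segmentIntegral_add hI3 hI12, ← hneg]
  refine segmentIntegral_congr fun t => ?_
  simp only [archIntegrand, hZ]
  ring

/-- The explicit formula at a finite height, with an error term coming from the horizontal sides of
the contour. -/
theorem CondA.norm_zeroSide_sub_le {ε : ℝ} (hε : 0 < ε) {g : ℝ → ℂ} (hA : CondA ε g) {c T M B : ℝ}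
    (hc : 1 < c) (hc' : c < 1 + ε) (hc2 : c ≤ 2) (hT : 0 < T) (hB : 0 ≤ B)
    (hM : ∀ s : ℂ, -ε < s.re → s.re < 1 + ε → s.im ≠ 0 → ‖mellin g s‖ ≤ M / |s.im|)
    (hgood : ∀ s : ℂ, -1 ≤ s.re → s.re ≤ 2 → |s.im| = T → xi s ≠ 0 ∧ ‖completedLogDeriv s‖ ≤ B) :
    ‖mellin g 0 + mellin g 1 - zeroSum g T - segmentIntegral (archIntegrand g) c T -
      (segmentIntegral (fun s => -(deriv riemannZeta s / riemannZeta s) * mellin g s) c T +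
      segmentIntegral
        (fun s => -(deriv riemannZeta s / riemannZeta s) *
          mellin (ExplicitFormula.transpose g) s) c T)‖ ≤
      3 * B * (M / T) := by
  have hxi : ∀ s : ℂ, xi s = 0 → |s.im| ≠ T := by
    intro s h0 h
    obtain ⟨-, h1, h2⟩ := xi_eq_zero_iff_riemannZeta.1 h0
    exact (hgood s (by linarith) (by linarith) h).1 h0
  have h1 := hA.rectIntegral_completedLogDeriv_mul hε (a := 1 - c) (b := c) (by linarith)
    (by linarith) hc hc' hT hxi
  have h2 := norm_rectIntegral_sub_le (F := fun s => completedLogDeriv s * mellin g s)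
    (a := 1 - c) (b := c) (T := T) (B := B * (M / T)) (by linarith) hT.le (by
      intro s h3 h4 h5
      have him : s.im ≠ 0 := by
        intro h; rw [h, abs_zero] at h5; linarith
      have h6 := hM s (by linarith) (by linarith) him
      rw [h5] at h6
      rw [norm_mul]
      exact mul_le_mul (hgood s (by linarith) (by linarith) h5).2 h6 (norm_nonneg _) hB)
  have hpi : (2 * Real.pi * Complex.I : ℂ) ≠ 0 := Complex.two_pi_I_ne_zero
  rw [h1, hA.segmentIntegral_completedLogDeriv hε hc hc', ← mul_assoc, one_div,
    inv_mul_cancel₀ hpi, one_mul] at h2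
  rw [← norm_neg]
  have hM0 : 0 ≤ B * (M / T) := by
    have h3 := hM (T * Complex.I) (by simpa using hε) (by simp; linarith) (by simpa using hT.ne')
    have h4 : 0 ≤ M / |((T : ℂ) * Complex.I).im| := (norm_nonneg _).trans h3
    simp only [Complex.mul_im, Complex.ofReal_re, Complex.I_im, mul_one, Complex.ofReal_im,
      Complex.I_re, mul_zero, add_zero, abs_of_pos hT] at h4
    positivity
  calc _ = ‖zeroSum g T - mellin g 0 - mellin g 1 - -(segmentIntegral (archIntegrand g) c T +
      (segmentIntegral (fun s => -(deriv riemannZeta s / riemannZeta s) * mellin g s) c T +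
      segmentIntegral
        (fun s => -(deriv riemannZeta s / riemannZeta s) *
          mellin (ExplicitFormula.transpose g) s) c T))‖ := by
        congr 1; ring
    _ ≤ B * (M / T) * (c - (1 - c)) := h2
    _ ≤ B * (M / T) * 3 := by gcongr; linarith
    _ = _ := by ring

/-! ### Passage to the limit -/

/-- Between consecutive integral heights the zero sum changes by at most the number of zeros there
times the bound for the Mellin transform. -/
theorem norm_zeroSum_sub_le {ε : ℝ} (hε : 0 < ε) {g : ℝ → ℂ} {M B : ℝ} {N : ℕ} (hN : 1 ≤ N)
    (hM0 : 0 ≤ M)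
    (hM : ∀ s : ℂ, -ε < s.re → s.re < 1 + ε → s.im ≠ 0 → ‖mellin g s‖ ≤ M / |s.im|)
    (hB : ∀ Z : Finset ℂ, (∀ ρ ∈ Z, xi ρ = 0 ∧ (N : ℝ) ≤ |ρ.im| ∧ |ρ.im| ≤ N + 1) →
      ∑ ρ ∈ Z, (analyticOrderNatAt xi ρ : ℝ) ≤ B)
    {T T' : ℝ} (hT : (N : ℝ) ≤ T) (hTT' : T ≤ T') (hT' : T' ≤ N + 1) :
    ‖zeroSum g T' - zeroSum g T‖ ≤ B * (M / N) := by
  classical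
  have hN0 : (0 : ℝ) < N := by exact_mod_cast hN
  have hsub : (zerosBelow_finite T).toFinset ⊆ (zerosBelow_finite T').toFinset := by
    intro ρ
    simp only [Finite.mem_toFinset]
    rintro ⟨h0, h1, h2, h3⟩
    exact ⟨h0, h1, h2, h3.trans_le hTT'⟩
  set Z := (zerosBelow_finite T').toFinset \ (zerosBelow_finite T).toFinset with hZ
  have hmem : ∀ ρ ∈ Z, riemannZeta ρ = 0 ∧ 0 < ρ.re ∧ ρ.re < 1 ∧ (N : ℝ) ≤ |ρ.im| ∧
      |ρ.im| ≤ N + 1 := by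
    intro ρ hρ
    simp only [hZ, Finset.mem_sdiff, Finite.mem_toFinset] at hρ
    obtain ⟨⟨h0, h1, h2, h3⟩, h4⟩ := hρ
    refine ⟨h0, h1, h2, ?_, by linarith⟩
    by_contra h5
    exact h4 ⟨h0, h1, h2, by linarith⟩
  have e : zeroSum g T' - zeroSum g T =
      ∑ ρ ∈ Z, (analyticOrderNatAt riemannZeta ρ : ℂ) * mellin g ρ := by
    unfold zeroSum
    rw [← Finset.sum_sdiff hsub, add_sub_cancel_right]
  rw [e]
  refine (norm_sum_le _ _).trans ?_
  calc _ ≤ ∑ ρ ∈ Z, (analyticOrderNatAt xi ρ : ℝ) * (M / N) := by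
        refine Finset.sum_le_sum fun ρ hρ => ?_
        obtain ⟨h0, h1, h2, h3, h4⟩ := hmem ρ hρ
        have him : ρ.im ≠ 0 := by
          intro h; rw [h, abs_zero] at h3; linarith
        rw [norm_mul, Complex.norm_natCast, analyticOrderNatAt_riemannZeta_of_strip h1 h2]
        gcongr
        refine (hM ρ (by linarith) (by linarith) him).trans ?_
        gcongr
    _ = (∑ ρ ∈ Z, (analyticOrderNatAt xi ρ : ℝ)) * (M / N) := by rw [Finset.sum_mul]
    _ ≤ B * (M / N) := by
        gcongr
        refine hB Z fun ρ hρ => ?_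
        obtain ⟨h0, h1, h2, h3⟩ := hmem ρ hρ
        exact ⟨xi_eq_zero_iff_riemannZeta.2 ⟨h0, h1, h2⟩, h3⟩

/-- Between consecutive integral heights a vertical integral changes by at most the supremum of the
integrand there. -/
theorem norm_segmentIntegral_sub_le {F : ℂ → ℂ} {c B : ℝ} {N : ℕ}
    (hF : Continuous fun t : ℝ => F (c + t * Complex.I))
    (hB : ∀ t : ℝ, (N : ℝ) ≤ |t| → |t| ≤ N + 1 → ‖F (c + t * Complex.I)‖ ≤ B)
    {T T' : ℝ} (hT : (N : ℝ) ≤ T) (hTT' : T ≤ T') (hT' : T' ≤ N + 1) :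
    ‖segmentIntegral F c T' - segmentIntegral F c T‖ ≤ B := by
  have hN0 : (0 : ℝ) ≤ N := Nat.cast_nonneg N
  have hB0 : 0 ≤ B := (norm_nonneg _).trans
    (hB N (by rw [abs_of_nonneg hN0]) (by rw [abs_of_nonneg hN0]; linarith))
  have hG : Continuous fun t : ℝ => F (c + t * Complex.I) * Complex.I := hF.mul continuous_const
  have h1 : ‖∫ t : ℝ in (-T')..(-T), F (c + t * Complex.I) * Complex.I‖ ≤ B * 1 := by
    refine (intervalIntegral.norm_integral_le_of_norm_le_const (C := B) fun t ht => ?_).trans ?_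
    · rw [uIoc_of_le (by linarith)] at ht
      rw [norm_mul, Complex.norm_I, mul_one]
      have : |t| = -t := abs_of_nonpos (by linarith [ht.2])
      exact hB t (by rw [this]; linarith [ht.2]) (by rw [this]; linarith [ht.1])
    · gcongr
      rw [abs_of_nonneg (by linarith)]; linarith
  have h2 : ‖∫ t : ℝ in T'..T, F (c + t * Complex.I) * Complex.I‖ ≤ B * 1 := by
    refine (intervalIntegral.norm_integral_le_of_norm_le_const (C := B) fun t ht => ?_).trans ?_
    · rw [uIoc_of_ge hTT'] at ht
      rw [norm_mul, Complex.norm_I, mul_one]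
      have : |t| = t := abs_of_nonneg (by linarith [ht.1])
      exact hB t (by rw [this]; linarith [ht.1]) (by rw [this]; linarith [ht.2])
    · gcongr
      rw [abs_of_nonpos (by linarith)]; linarith
  have hn : ‖(1 / (2 * Real.pi * Complex.I) : ℂ)‖ ≤ 1 / 2 := by
    rw [norm_div, norm_mul, norm_mul]
    simp only [norm_one, Complex.norm_ofNat, Complex.norm_real, Complex.norm_I, mul_one,
      Real.norm_eq_abs, abs_of_pos Real.pi_pos]
    have := Real.pi_gt_three
    gcongr
    linarith
  unfold segmentIntegral
  rw [← mul_sub, intervalIntegral.integral_interval_sub_interval_comm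
    (hG.intervalIntegrable _ _) (hG.intervalIntegrable _ _) (hG.intervalIntegrable _ _), norm_mul]
  calc _ ≤ 1 / 2 * (B * 1 + B * 1) := by
        gcongr
        exact (norm_sub_le _ _).trans (add_le_add h1 h2)
    _ = B := by ring

/-- The difference between the zero side and the archimedean side, truncated at height `T`, tends to
the sum over prime powers, when the archimedean integral is taken to the right of `1`. -/
theorem CondA.tendsto_zeroSide_sub_arch_of_one_lt {ε : ℝ} (hε : 0 < ε) {g : ℝ → ℂ}
    (hA : CondA ε g) (hB : CondB g) {c : ℝ} (hc : 1 < c) (hc' : c < 1 + ε) (hc2 : c ≤ 2) :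
    Tendsto (fun T => mellin g 0 + mellin g 1 - zeroSum g T -
      segmentIntegral (archIntegrand g) c T) atTop
      (𝓝 ((∑' n : ℕ, ((Λ n : ℝ) : ℂ) * g n) +
        ∑' n : ℕ, ((Λ n : ℝ) : ℂ) * ExplicitFormula.transpose g n)) := by
  obtain ⟨M, hM0, hM⟩ := hA.exists_norm_mellin_le
  obtain ⟨C, hC0, hC⟩ := exists_xi_window_bounds
  obtain ⟨K, hK0, hK⟩ := hA.exists_norm_archIntegrand_le (a := c) (b := c) (by linarith) hc' hε
  have hτ : ∀ N : ℕ, ∃ T : ℝ, 1 ≤ N → (N : ℝ) ≤ T ∧ T ≤ N + 1 ∧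
      ∀ s : ℂ, -1 ≤ s.re → s.re ≤ 2 → |s.im| = T →
        xi s ≠ 0 ∧ ‖completedLogDeriv s‖ ≤ C * √(N : ℝ) := by
    intro N
    by_cases hN : 1 ≤ N
    · obtain ⟨T, hT⟩ := (hC N hN).2
      exact ⟨T, fun _ => hT⟩
    · exact ⟨0, fun h => absurd h hN⟩
  choose τ hτ using hτ
  set S : ℝ → ℂ := fun T =>
    segmentIntegral (fun s => -(deriv riemannZeta s / riemannZeta s) * mellin g s) c T +
      segmentIntegral
        (fun s => -(deriv riemannZeta s / riemannZeta s) * mellin (ExplicitFormula.transpose g) s)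
        c T with hSdef
  set Φ : ℝ → ℂ := fun T => mellin g 0 + mellin g 1 - zeroSum g T -
    segmentIntegral (archIntegrand g) c T with hΦdef
  have hcont : Continuous fun t : ℝ => archIntegrand g (c + t * Complex.I) :=
    continuous_comp_line fun s hs =>
      (hA.differentiableAt_archIntegrand hε (by linarith) (by linarith)).continuousAt
  -- `Φ` varies little between consecutive integers
  have hvar : ∀ N : ℕ, 1 ≤ N → ∀ T T' : ℝ, (N : ℝ) ≤ T → T ≤ T' → T' ≤ N + 1 →
      ‖Φ T' - Φ T‖ ≤ (C * M + K) / √(N : ℝ) := by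
    intro N hN T T' h1 h2 h3
    have hN0 : (0 : ℝ) < N := by exact_mod_cast hN
    have hs0 : 0 < √(N : ℝ) := Real.sqrt_pos.2 hN0
    have hz := norm_zeroSum_sub_le hε hN hM0 hM (hC N hN).1 h1 h2 h3
    have ha := norm_segmentIntegral_sub_le (B := K / √(N : ℝ)) (N := N) hcont (by
      intro t ht1 ht2
      have him : |((c : ℂ) + t * Complex.I).im| = |t| := by simp
      refine (hK _ (by simp) (by simp) (by
        rw [him]; exact le_trans (by exact_mod_cast hN) ht1)).trans ?_
      rw [him]
      gcongr) h1 h2 h3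
    have e : Φ T' - Φ T = -(zeroSum g T' - zeroSum g T) -
        (segmentIntegral (archIntegrand g) c T' - segmentIntegral (archIntegrand g) c T) := by
      simp only [hΦdef]; ring
    rw [e]
    refine (norm_sub_le _ _).trans ?_
    rw [norm_neg]
    have e2 : C * √(N : ℝ) * (M / N) = C * M / √(N : ℝ) := by
      have e3 : M / (N : ℝ) = M / (√(N : ℝ) * √(N : ℝ)) := by rw [Real.mul_self_sqrt hN0.le]
      rw [e3]; field_simp
    rw [e2] at hz
    rw [add_div]
    exact add_le_add hz ha
  -- at the heights `τ N` the explicit formula holds up to a small error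
  have hmain : ∀ N : ℕ, 1 ≤ N → ‖Φ (τ N) - S (τ N)‖ ≤ 3 * (C * M) / √(N : ℝ) := by
    intro N hN
    have hN0 : (0 : ℝ) < N := by exact_mod_cast hN
    have hs0 : 0 < √(N : ℝ) := Real.sqrt_pos.2 hN0
    obtain ⟨h1, h2, h3⟩ := hτ N hN
    have h4 := hA.norm_zeroSide_sub_le hε hc hc' hc2 (hN0.trans_le h1)
      (B := C * √(N : ℝ)) (by positivity) hM h3
    refine h4.trans ?_
    calc 3 * (C * √(N : ℝ)) * (M / τ N) ≤ 3 * (C * √(N : ℝ)) * (M / N) := by gcongr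
      _ = 3 * (C * M) / √(N : ℝ) := by
        have e3 : M / (N : ℝ) = M / (√(N : ℝ) * √(N : ℝ)) := by rw [Real.mul_self_sqrt hN0.le]
        rw [e3]; field_simp
  have hfloor : Tendsto (fun T : ℝ => ⌊T⌋₊) atTop atTop := tendsto_nat_floor_atTop
  have hτlim : Tendsto τ atTop atTop := by
    refine tendsto_atTop_mono' _ ?_ tendsto_natCast_atTop_atTop
    filter_upwards [eventually_ge_atTop 1] with N hN using (hτ N hN).1
  have hS : Tendsto S atTop (𝓝 ((∑' n : ℕ, ((Λ n : ℝ) : ℂ) * g n) +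
        ∑' n : ℕ, ((Λ n : ℝ) : ℂ) * ExplicitFormula.transpose g n)) :=
    (hA.tendsto_segmentIntegral_zeta hε hB hc hc').add
      (hA.transpose.tendsto_segmentIntegral_zeta hε (CondB.transpose hA hε hB) hc hc')
  have hSτ := (hS.comp hτlim).comp hfloor
  have herr : Tendsto (fun T : ℝ => Φ T - S (τ ⌊T⌋₊)) atTop (𝓝 0) := by
    have hlim : Tendsto (fun T : ℝ => (C * M + K + 3 * (C * M)) / √(⌊T⌋₊ : ℝ)) atTop (𝓝 0) :=
      (tendsto_const_nhds (x := C * M + K + 3 * (C * M))).div_atTop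
        (Real.tendsto_sqrt_atTop.comp (tendsto_natCast_atTop_atTop.comp hfloor))
    refine squeeze_zero_norm' ?_ hlim
    filter_upwards [eventually_ge_atTop 1] with T hT
    have hN : 1 ≤ ⌊T⌋₊ := Nat.le_floor (by exact_mod_cast hT)
    obtain ⟨h1, h2, -⟩ := hτ _ hN
    have h3 : (⌊T⌋₊ : ℝ) ≤ T := Nat.floor_le (by linarith)
    have h4 : T ≤ ⌊T⌋₊ + 1 := (Nat.lt_floor_add_one T).le
    have h5 : ‖Φ T - Φ (τ ⌊T⌋₊)‖ ≤ (C * M + K) / √(⌊T⌋₊ : ℝ) := by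
      rcases le_total T (τ ⌊T⌋₊) with h | h
      · rw [norm_sub_rev]; exact hvar _ hN _ _ h3 h h2
      · exact hvar _ hN _ _ h1 h h4
    calc ‖Φ T - S (τ ⌊T⌋₊)‖ = ‖(Φ T - Φ (τ ⌊T⌋₊)) + (Φ (τ ⌊T⌋₊) - S (τ ⌊T⌋₊))‖ := by
          congr 1; ring
      _ ≤ _ := (norm_add_le _ _).trans (add_le_add h5 (hmain _ hN))
      _ = _ := by rw [← add_div]
  have := herr.add hSτ
  rw [zero_add] at this
  refine this.congr fun T => ?_
  simp only [Function.comp_apply]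
  ring

/-- The difference between the zero side and the archimedean side converges to the sum over the
primes for every admissible line, without convergence of either side. -/
theorem CondA.tendsto_zeroSide_sub_arch {ε : ℝ} (hε : 0 < ε) {g : ℝ → ℂ}
    (hA : CondA ε g) (hB : CondB g) {c : ℝ} (hc : 0 < c) (hc' : c < 1 + ε) :
    Tendsto (fun T => mellin g 0 + mellin g 1 - zeroSum g T -
      segmentIntegral (archIntegrand g) c T) atTop
      (𝓝 (∑' p : Nat.Primes, (localTerm p g + localTerm p (ExplicitFormula.transpose g)))) := by
  have hmin : 0 < min ε 1 := lt_min hε one_pos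
  have hmin1 := min_le_left ε 1
  have hmin2 := min_le_right ε 1
  -- a line to the right of `1` inside the strip, on which the Dirichlet series converges
  set b := 1 + min ε 1 / 2 with hb
  have h1 := hA.tendsto_zeroSide_sub_arch_of_one_lt hε hB (c := b) (by linarith) (by linarith)
    (by linarith)
  have h2 : Tendsto (fun T => segmentIntegral (archIntegrand g) b T -
      segmentIntegral (archIntegrand g) c T) atTop (𝓝 0) := by
    rcases le_total c b with h | h
    · exact hA.tendsto_segmentIntegral_arch_sub hε hc h (by linarith)
    · have := (hA.tendsto_segmentIntegral_arch_sub hε (by linarith) h hc').neg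
      rw [neg_zero] at this
      exact this.congr fun T => by ring
  have h3 := h1.add h2
  rw [add_zero, ← ((hA.hasSum_localTerm hε).add (hA.transpose.hasSum_localTerm hε)).tsum_eq] at h3
  exact h3.congr fun T => by ring

end ExplicitFormula

theorem mainTheorem1 (ε : ℝ) (hε : 0 < ε) (g : ℝ → ℂ)
    (hA : ExplicitFormula.CondA ε g) (hB : ExplicitFormula.CondB g)
    (c : ℝ) (hc0 : 0 < c) (hc1 : c < 1 + ε) :
    (∀ s : ℂ, -ε < s.re → s.re < 1 + ε → MellinConvergent g s) ∧
    ExplicitFormula.PrimePowerSumConverges g ∧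
    ExplicitFormula.PrimePowerSumConverges (ExplicitFormula.transpose g) ∧
    ((∃ w : ℂ, ExplicitFormula.IsArchLimit g c w) ↔
      (∃ z : ℂ, ExplicitFormula.IsZeroSide g z)) ∧
    (∀ w z : ℂ, ExplicitFormula.IsArchLimit g c w → ExplicitFormula.IsZeroSide g z →
      z = (∑' p : Nat.Primes, (ExplicitFormula.localTerm p g +
        ExplicitFormula.localTerm p (ExplicitFormula.transpose g))) + w) := by
  have hlim := hA.tendsto_zeroSide_sub_arch hε hB hc0 hc1
  set P := ∑' p : Nat.Primes, (ExplicitFormula.localTerm p g +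
    ExplicitFormula.localTerm p (ExplicitFormula.transpose g))
  have hzero : ∀ w, ExplicitFormula.IsArchLimit g c w →
      Tendsto (fun T => ExplicitFormula.zeroSum g T) atTop
        (𝓝 (mellin g 0 + mellin g 1 - P - w)) := by
    intro w hw
    exact ((tendsto_const_nhds.sub hlim).sub hw).congr fun T => by ring
  refine ⟨fun s h1 h2 => hA.mellinConvergent h1 h2, hA.primePowerSumConverges hε,
    hA.transpose.primePowerSumConverges hε, ⟨?_, ?_⟩, ?_⟩
  · rintro ⟨w, hw⟩
    exact ⟨_, _, hzero w hw, rfl⟩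
  · rintro ⟨z, S, hS, -⟩
    exact ⟨mellin g 0 + mellin g 1 - S - P,
      ((tendsto_const_nhds.sub hS).sub hlim).congr fun T => by ring⟩
  · rintro w z hw ⟨S, hS, rfl⟩
    rw [tendsto_nhds_unique hS (hzero w hw)]
    ring
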